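/- Let $d\in\{1,2\}$, $\mathcal O=(0,1)^d$, $L^p=L^p(\mathcal O;\mathbb R)$, and let $\Lambda$ be the Laplacian on $\mathcal O$ with homogeneous Dirichlet boundary condition. Let $(e_k)_{k\ge1}$ be an orthonormal basis of $L^2$ with $-\Lambda e_k=\lambda_k e_k$, $\lambda_1\le\lambda_2\le\cdots$, and put $\|w\|_{\dot{\mathbb H}^1}^2=\sum_k\lambda_k\langle w,e_k\rangle_{L^2}^2$, $\dot{\mathbb H}^1=\{w\in L^2:\|w\|_{\dot{\mathbb H}^1}<\infty\}$, $\mathbb H^1=\dot{\mathbb H}^1\times L^2$. Let $U_N=\operatorname{span}\{e_1,\dots,e_N\}$, $P_N g=\sum_{k\le N}\langle g,e_k\rangle e_k$ and $\Lambda_N w=-\sum_{k\le N}\lambda_k\langle w,e_k\rangle e_k$. Let $f(z)=c_3z^3+c_2z^2+c_1z+c_0$ with real coefficients and $c_3>0$, and $\Phi(z)=\int_0^z f(y)\,dy$. Let $T>0$, let $X_0=(u_0,v_0)\in\mathbb H^1$ be deterministic, and let $\mathbf Q$ be a symmetric positive operator on $L^2$ with Hilbert--Schmidt square root $\mathbf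 Q^{1/2}$. Let $W(t)=\sum_k\beta_k(t)\mathbf Q^{1/2}b_k$ be a $\mathbf Q$-Wiener process on some probability space, where $(b_k)$ is an orthonormal basis of $L^2$ and the $\beta_k$ are mutually independent standard real Brownian motions. For $N,M\in\mathbb N^+$, $h=T/M$ and $t_m=mh$, consider the full discretization $u_0^N=P_Nu_0$, $v_0^N=P_Nv_0$ and, for $0\le m<M$, $$u^N_{m+1}=u^N_m+\tfrac h2(\bar v^N_{m+1}+v^N_m),$$ $$\bar v^N_{m+1}=v^N_m+\tfrac h2\Lambda_N(u^N_{m+1}+u^N_m)-hP_N\Big(\int_0^1 f\big(u^N_m+\theta(u^N_{m+1}-u^N_m)\big)d\theta\Big),$$ $$v^N_{m+1}=\bar v^N_{m+1}+P_N\big(W(t_{m+1})-W(t_m)\big).$$ Call $h_0$ admissible if for all $N\in\mathbb N^+$, all $h\in(0,h_0]$ and all $u^N_m,v^N_m\in U_N$ the first two equations have exactly one solution $(u^N_{m+1},\bar v^N_{m+1})$. Then: (i) There is an admissible $h_0>0$. (ii) For every $c>0$ there is a constant $C=C(X_0,\mathbf Q,T,c)>0$ (which may also depend on $d$, $f$ and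 the basis $(e_k)$, but not on $N$, $M$, $h$, $m$, $h_0$ or the probability space) such that, for every admissible $h_0$, all $N,M\in\mathbb N^+$ with $h=T/M\le h_0$, and all $m\in\{0,\dots,M\}$, $$\mathbb E\Big[\exp\Big(ch\sum_{i=0}^m\|u^N_i\|_{L^6}^2\Big)\Big]\le C .$$ (iii) Let $C_1\in\mathbb R$ be such that $\Phi+C_1\ge0$ on $\mathbb R$, and let $V_1(u,v)=\tfrac12\|u\|_{\dot{\mathbb H}^1}^2+\tfrac12\|v\|_{L^2}^2+\int_{\mathcal O}\Phi(u(x))\,dx+C_1$. For every $\alpha\ge\operatorname{trace}(\mathbf Q)$ and all $h_0$, $N$, $M$, $h$, $m$ as in (ii), $$\mathbb E\Big[\exp\big(V_1(u^N_m,v^N_m)e^{-\alpha t_m}\big)\Big]\le\exp\Big(V_1(u^N_0,v^N_0)+\tfrac12\operatorname{trace}(\mathbf Q)\int_0^{t_m}e^{-\alpha s}ds\Big).$$ -/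

import Mathlib

open MeasureTheory ProbabilityTheory Filter Topology
open scoped NNReal ENNReal

noncomputable section

namespace StochWave

/-- The open unit cube `(0,1)^d`. -/
def cube (d : ℕ) : TopologicalSpace.Opens (EuclideanSpace ℝ (Fin d)) where
  carrier := {x | ∀ i, x i ∈ Set.Ioo (0 : ℝ) 1}
  is_open' := by
    have h : {x : EuclideanSpace ℝ (Fin d) | ∀ i, x i ∈ Set.Ioo (0 : ℝ) 1}
        = ⋂ i, (fun x : EuclideanSpace ℝ (Fin d) => x i) ⁻¹' Set.Ioo (0 : ℝ) 1 := by
      ext x; simp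
    rw [h]
    exact isOpen_iInter_of_finite fun i => isOpen_Ioo.preimage (by fun_prop)

/-- Lebesgue measure on the cube. -/
abbrev cubeMeasure (d : ℕ) : Measure (EuclideanSpace ℝ (Fin d)) :=
  volume.restrict (cube d : Set (EuclideanSpace ℝ (Fin d)))

/-- The real Hilbert space `L²((0,1)^d)`. -/
abbrev L2 (d : ℕ) : Type := Lp ℝ 2 (cubeMeasure d)

/-- Smooth real functions with compact support in the cube. -/
abbrev CubeTest (d : ℕ) : Type := TestFunction (cube d) ℝ (⊤ : ℕ∞)

/-- The `i`-th classical partial derivative. -/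
def partialDeriv {d : ℕ} (φ : EuclideanSpace ℝ (Fin d) → ℝ) (i : Fin d)
    (x : EuclideanSpace ℝ (Fin d)) : ℝ :=
  fderiv ℝ φ x (EuclideanSpace.single i 1)

/-- `w` lies in `H¹₀` of the cube (the `H¹`-closure of the test functions) and has weak
gradient `g`. -/
def HasH10Gradient {d : ℕ} (w : L2 d) (g : Fin d → L2 d) : Prop :=
  ∃ φ : ℕ → CubeTest d,
    Tendsto (fun n => eLpNorm (fun x => φ n x - w x) 2 (cubeMeasure d)) atTop (𝓝 0) ∧
    ∀ i, Tendsto (fun n => eLpNorm (fun x => partialDeriv (φ n) i x - g i x) 2 (cubeMeasure d))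
      atTop (𝓝 0)

/-- `-Λ w = μ w`, where `Λ` is the Laplacian with homogeneous Dirichlet boundary condition. -/
def IsDirichletEigen {d : ℕ} (μ : ℝ) (w : L2 d) : Prop :=
  ∃ g : Fin d → L2 d, HasH10Gradient w g ∧
    ∀ φ : CubeTest d,
      ∑ i, ∫ x, g i x * partialDeriv φ i x ∂(cubeMeasure d)
        = μ * ∫ x, w x * φ x ∂(cubeMeasure d)

/-- `e 0, e 1, …` is an orthonormal basis of `L²` of eigenfunctions of `-Λ`, with the
eigenvalues `lam 0 ≤ lam 1 ≤ …`. -/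
structure IsDirichletEigenbasis {d : ℕ} (e : HilbertBasis ℕ ℝ (L2 d)) (lam : ℕ → ℝ) : Prop where
  mono : Monotone lam
  eigen : ∀ k, IsDirichletEigen (lam k) (e k)

/-- Membership in `Ḣ¹ = D((-Λ)^{1/2})`. -/
def MemHdotOne {d : ℕ} (e : HilbertBasis ℕ ℝ (L2 d)) (lam : ℕ → ℝ) (w : L2 d) : Prop :=
  Summable fun k => lam k * (inner ℝ w (e k)) ^ 2

/-- The squared norm of `Ḣ¹`. -/
def hdotOneNormSq {d : ℕ} (e : HilbertBasis ℕ ℝ (L2 d)) (lam : ℕ → ℝ) (w : L2 d) : ℝ :=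
  ∑' k, lam k * (inner ℝ w (e k)) ^ 2

/-- The trace of an operator on `L²`, computed in the orthonormal basis `e`. -/
def opTrace {d : ℕ} (e : HilbertBasis ℕ ℝ (L2 d)) (Q : L2 d →L[ℝ] L2 d) : ℝ :=
  ∑' k, inner ℝ (Q (e k)) (e k)

/-- The space `U_N` spanned by the first `N` eigenfunctions. -/
def galerkinSpace {d : ℕ} (e : HilbertBasis ℕ ℝ (L2 d)) (N : ℕ) : Submodule ℝ (L2 d) :=
  Submodule.span ℝ ((fun k => e k) '' {k | k < N})

/-- The projection `P_N g = ∑_{k < N} ⟨g, e_k⟩ e_k`, with `⟨g, e_k⟩ = ∫ g e_k`. -/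
def galerkinProj {d : ℕ} (e : HilbertBasis ℕ ℝ (L2 d)) (N : ℕ)
    (g : EuclideanSpace ℝ (Fin d) → ℝ) : L2 d :=
  ∑ k ∈ Finset.range N, (∫ x, g x * e k x ∂(cubeMeasure d)) • e k

/-- The discrete Laplacian `Λ_N w = -∑_{k < N} λ_k ⟨w, e_k⟩ e_k`. -/
def galerkinLaplacian {d : ℕ} (e : HilbertBasis ℕ ℝ (L2 d)) (lam : ℕ → ℝ) (N : ℕ)
    (w : L2 d) : L2 d :=
  -∑ k ∈ Finset.range N, (lam k * inner ℝ w (e k)) • e k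

/-- The nonlinearity `f(z) = c₃ z³ + c₂ z² + c₁ z + c₀`. -/
def cubic (c₀ c₁ c₂ c₃ : ℝ) (z : ℝ) : ℝ := c₃ * z ^ 3 + c₂ * z ^ 2 + c₁ * z + c₀

/-- The primitive of the nonlinearity `f` that vanishes at `0`. -/
def primitive (f : ℝ → ℝ) (z : ℝ) : ℝ := ∫ y in (0 : ℝ)..z, f y

/-- The energy `V₁(u,v) = ½‖u‖²_{Ḣ¹} + ½‖v‖²_{L²} + F(u) + C₁`, with `F(u)` the integral over the
cube of the primitive of `f` at `u`. -/
def energy {d : ℕ} (e : HilbertBasis ℕ ℝ (L2 d)) (lam : ℕ → ℝ) (f : ℝ → ℝ) (C₁ : ℝ)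
    (u v : L2 d) : ℝ :=
  1 / 2 * hdotOneNormSq e lam u + 1 / 2 * ‖v‖ ^ 2
    + (∫ x, primitive f (u x) ∂(cubeMeasure d)) + C₁

/-- One deterministic step of the averaged vector field method, from `(u, v)` to `(u', v')`
with step size `h`. -/
structure AVFStep {d : ℕ} (e : HilbertBasis ℕ ℝ (L2 d)) (lam : ℕ → ℝ) (f : ℝ → ℝ)
    (N : ℕ) (h : ℝ) (u v u' v' : L2 d) : Prop where
  position : u' = u + h • ((1 / 2 : ℝ) • (v' + v))
  velocity : v' = v + h • galerkinLaplacian e lam N ((1 / 2 : ℝ) • (u' + u))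
    - h • galerkinProj e N (fun x => ∫ θ in (0 : ℝ)..1, f (u x + θ * (u' x - u x)))

/-- For step sizes up to `h₀`, the implicit step is uniquely solvable in every `U_N`. -/
def StepSizeAdmissible {d : ℕ} (e : HilbertBasis ℕ ℝ (L2 d)) (lam : ℕ → ℝ) (f : ℝ → ℝ)
    (h₀ : ℝ) : Prop :=
  ∀ N : ℕ, 1 ≤ N → ∀ h : ℝ, 0 < h → h ≤ h₀ →
    ∀ u ∈ galerkinSpace e N, ∀ v ∈ galerkinSpace e N,
      ∃! p : L2 d × L2 d, AVFStep e lam f N h u v p.1 p.2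

/-- `W` is a Wiener process in `L²` with covariance operator `S ∘ S`:
`W(t) = ∑ₖ βₖ(t) S bₖ` almost surely for each `t`, for an orthonormal basis `b` and mutually
independent Brownian motions `βₖ`. -/
def IsWienerProcess {d : ℕ} (S : L2 d →L[ℝ] L2 d) {Ω : Type*} [MeasurableSpace Ω]
    (P : Measure Ω) (W : ℝ≥0 → Ω → L2 d) : Prop :=
  ∃ (b : HilbertBasis ℕ ℝ (L2 d)) (β : ℕ → ℝ≥0 → Ω → ℝ),
    (∀ k, IsBrownianReal (β k) P) ∧
    iIndepFun (fun k ω (t : ℝ≥0) => β k t ω) P ∧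
    ∀ t, ∀ᵐ ω ∂P, Tendsto (fun n => ∑ k ∈ Finset.range n, β k t ω • S (b k)) atTop (𝓝 (W t ω))

/-- The grid point `t_m = m h`. -/
def gridTime (h : ℝ) (m : ℕ) : ℝ≥0 := (m * h).toNNReal

/-- `(u_m, v_m)`, `0 ≤ m ≤ M`, is a solution of the full discretization (spectral Galerkin in
space, splitting averaged vector field method in time) with `M` steps of size `h`, where `vbar`
holds the intermediate velocities. -/
structure IsFullDiscretization {d : ℕ} (e : HilbertBasis ℕ ℝ (L2 d)) (lam : ℕ → ℝ) (f : ℝ → ℝ)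
    (u₀ v₀ : L2 d) {Ω : Type*} [MeasurableSpace Ω] (P : Measure Ω) (W : ℝ≥0 → Ω → L2 d)
    (N M : ℕ) (h : ℝ) (u v vbar : ℕ → Ω → L2 d) : Prop where
  init_u : ∀ᵐ ω ∂P, u 0 ω = galerkinProj e N u₀
  init_v : ∀ᵐ ω ∂P, v 0 ω = galerkinProj e N v₀
  step : ∀ m < M, ∀ᵐ ω ∂P, AVFStep e lam f N h (u m ω) (v m ω) (u (m + 1) ω) (vbar (m + 1) ω)
  noise : ∀ m < M, ∀ᵐ ω ∂P, v (m + 1) ω =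
    vbar (m + 1) ω + galerkinProj e N (W (gridTime h (m + 1)) ω - W (gridTime h m) ω : L2 d)

/-- The `L⁶` norm on the cube. -/
def normL6 {d : ℕ} (w : L2 d) : ℝ := (eLpNorm w 6 (cubeMeasure d)).toReal

end StochWave

end

/-! The averaged vector field step is a discrete gradient method: the average of `f` along the
segment from `u` to `u'`, paired with `u' - u`, is exactly the increment of the integral of `Φ`
(`mul_cubicAvg`). Hence the deterministic half of each step conserves `V₁` (`CoordStep.energy_eq`),
and only the Gaussian kick of the velocity changes it.

For a centred Gaussian kick `Z` whose covariance has trace `hσ`, and `a h σ < 1`, the expectation of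
`exp (a/2 ‖v + Z‖²)` is at most `(1 - a h σ)^(-1/2) exp (a ‖v‖² / (2 (1 - a h σ)))`. With `a = exp
(-α (t + h))` and `α ≥ trace Q ≥ σ`, the new weight is at most `exp (-α t)` and the prefactor is at
most the exponential of the drift integral over `[t, t + h]`. Induction on the steps gives (iii) for
truncated noise, and Fatou's lemma gives it for the full series. Passing to coordinates in `U_N`
makes all of this finite-dimensional; Bessel's inequality bounds the trace of the projected noise
uniformly in `N`.

For (ii), a Gagliardo–Nirenberg inequality bounds `‖u‖_{L⁶}⁶` by a multiple of `‖u‖² ‖∇u‖⁴`. By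
Young's inequality and the quartic growth of `Φ`, `‖u‖_{L⁶}²` is at most `ε` times the potential
energy plus a constant, for every `ε > 0`. Jensen's inequality reduces the exponential of the sum to
single times, where (iii) applies with `α = trace Q`.

For (i), the increment of the position is a critical point of a functional that is coercive when `h²
K < 4`, where `-K` bounds `f'` from below; monotonicity gives uniqueness. For an arbitrary
admissible step size, continuity of the solution map comes from its closed graph and the energy
bound. -/

namespace StochWave

/-! ### Exponential square moments of Gaussian perturbations. -/

section Gaussian

/-- The Gaussian integral of the exponential of a quadratic polynomial. -/
lemma lintegral_exp_quadratic_gaussianReal {h : ℝ≥0} (hh : h ≠ 0) {p r : ℝ}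
    (hp : 2 * p * h < 1) :
    ∫⁻ x, ENNReal.ofReal (Real.exp (p * x ^ 2 + r * x)) ∂(gaussianReal 0 h) =
      ENNReal.ofReal ((√(1 - 2 * p * h))⁻¹ * Real.exp (r ^ 2 * h / (2 * (1 - 2 * p * h)))) := by
  have hh0 : (0 : ℝ) < h := by positivity
  set γ : ℝ := 1 - 2 * p * h with hγ
  have hγ0 : 0 < γ := by linarith
  -- Completing the square turns the integrand into a constant times the density of the Gaussian
  -- with mean `r h / γ` and variance `h / γ`.
  let h' : ℝ≥0 := ⟨h / γ, by positivity⟩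
  have hh' : (h' : ℝ) = h / γ := rfl
  have hh'0 : h' ≠ 0 := by
    intro h0
    have : (h' : ℝ) = 0 := by rw [h0]; rfl
    rw [hh'] at this
    have : (0 : ℝ) < h / γ := by positivity
    linarith
  rw [gaussianReal_of_var_ne_zero _ hh,
    lintegral_withDensity_eq_lintegral_mul _ (measurable_gaussianPDF _ _) (by fun_prop)]
  have key : ∀ x : ℝ, gaussianPDF 0 h x * ENNReal.ofReal (Real.exp (p * x ^ 2 + r * x)) =
      ENNReal.ofReal ((√γ)⁻¹ * Real.exp (r ^ 2 * h / (2 * γ))) *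
        gaussianPDF (r * (h / γ)) h' x := by
    intro x
    rw [gaussianPDF, gaussianPDF, ← ENNReal.ofReal_mul (gaussianPDFReal_nonneg _ _ _),
      ← ENNReal.ofReal_mul (by positivity)]
    congr 1
    rw [gaussianPDFReal, gaussianPDFReal, hh']
    have e1 : √(2 * Real.pi * (h / γ)) = √(2 * Real.pi * h) * (√γ)⁻¹ := by
      rw [show 2 * Real.pi * (h / γ) = (2 * Real.pi * h) * γ⁻¹ by field_simp,
        Real.sqrt_mul (by positivity), Real.sqrt_inv]
    rw [e1, mul_assoc, ← Real.exp_add]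
    have e2 : -(x - 0) ^ 2 / (2 * (h : ℝ)) + (p * x ^ 2 + r * x) =
        r ^ 2 * h / (2 * γ) + -(x - r * (h / γ)) ^ 2 / (2 * (h / γ)) := by
      have hpe : p = (1 - γ) / (2 * h) := by rw [hγ]; field_simp; ring
      rw [hpe]
      field_simp
      ring
    rw [e2, Real.exp_add]
    have : 0 < √γ := Real.sqrt_pos.2 hγ0
    have : 0 < √(2 * Real.pi * h) := Real.sqrt_pos.2 (by positivity)
    field_simp
  simp only [Pi.mul_apply]
  simp_rw [key]
  rw [lintegral_const_mul _ (measurable_gaussianPDF _ _), lintegral_gaussianPDF_eq_one _ hh'0,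
    mul_one]

variable {E : Type*} [NormedAddCommGroup E] [InnerProductSpace ℝ E]

/-- Exponential square moment of a vector perturbed by a scalar Gaussian in a fixed direction. -/
lemma lintegral_exp_normSq_add_smul_le {h : ℝ≥0} (hh : h ≠ 0) {a : ℝ} (v s : E)
    (has : a * h * ‖s‖ ^ 2 < 1) :
    ∫⁻ x, ENNReal.ofReal (Real.exp (a / 2 * ‖v + x • s‖ ^ 2)) ∂(gaussianReal 0 h) ≤
      ENNReal.ofReal ((√(1 - a * h * ‖s‖ ^ 2))⁻¹ *
        Real.exp (a / (1 - a * h * ‖s‖ ^ 2) / 2 * ‖v‖ ^ 2)) := by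
  have hh0 : (0 : ℝ) < h := by positivity
  have e1 : ∀ x : ℝ, Real.exp (a / 2 * ‖v + x • s‖ ^ 2) =
      Real.exp (a / 2 * ‖v‖ ^ 2) *
        Real.exp ((a / 2 * ‖s‖ ^ 2) * x ^ 2 + (a * inner ℝ v s) * x) := by
    intro x
    rw [← Real.exp_add, norm_add_sq_real, norm_smul, inner_smul_right, mul_pow]
    congr 1
    simp only [Real.norm_eq_abs, sq_abs]
    ring
  simp_rw [e1, ENNReal.ofReal_mul (Real.exp_nonneg _)]
  rw [lintegral_const_mul _ (by fun_prop),
    lintegral_exp_quadratic_gaussianReal hh (by linarith), ← ENNReal.ofReal_mul (by positivity)]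
  apply ENNReal.ofReal_le_ofReal
  have e2 : 1 - 2 * (a / 2 * ‖s‖ ^ 2) * h = 1 - a * h * ‖s‖ ^ 2 := by ring
  rw [e2]
  set γ : ℝ := 1 - a * h * ‖s‖ ^ 2 with hγ
  have hγ0 : 0 < γ := by linarith
  rw [mul_left_comm, ← Real.exp_add]
  gcongr
  -- The only loss in the estimate. It makes the exponent a multiple of `‖v‖²` again, with `1 + a h
  -- ‖s‖² / γ = 1 / γ`, so that the bound can be iterated over directions.
  have hCS : (inner ℝ v s) ^ 2 ≤ ‖v‖ ^ 2 * ‖s‖ ^ 2 := by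
    have := abs_real_inner_le_norm v s
    rw [← mul_pow, ← sq_abs (inner ℝ v s)]
    gcongr
  have e3 : a / γ / 2 * ‖v‖ ^ 2 =
      a / 2 * ‖v‖ ^ 2 + a ^ 2 * (‖v‖ ^ 2 * ‖s‖ ^ 2) * h / (2 * γ) := by
    field_simp
    rw [hγ]; ring
  rw [e3, mul_pow]
  gcongr

variable {Ω : Type*} [MeasurableSpace Ω] {P : Measure Ω} [IsProbabilityMeasure P]

/-- Integration of a function of two independent variables as an iterated integral. -/
lemma lintegral_comp_indepFun {α β : Type*} [MeasurableSpace α] [MeasurableSpace β]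
    {A : Ω → α} {B : Ω → β} (hAB : IndepFun A B P) (hA : Measurable A) (hB : Measurable B)
    {F : α × β → ℝ≥0∞} (hF : Measurable F) :
    ∫⁻ ω, F (A ω, B ω) ∂P = ∫⁻ ω, ∫⁻ ω', F (A ω, B ω') ∂P ∂P := by
  have := (indepFun_iff_map_prod_eq_prod_map_map hA.aemeasurable hB.aemeasurable).1 hAB
  have : IsProbabilityMeasure (P.map B) := Measure.isProbabilityMeasure_map hB.aemeasurable
  calc ∫⁻ ω, F (A ω, B ω) ∂P = ∫⁻ z, F z ∂(P.map fun ω => (A ω, B ω)) := by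
        rw [lintegral_map hF (hA.prodMk hB)]
    _ = ∫⁻ x, ∫⁻ y, F (x, y) ∂(P.map B) ∂(P.map A) := by
        rw [‹P.map (fun ω => (A ω, B ω)) = _›, lintegral_prod _ hF.aemeasurable]
    _ = ∫⁻ ω, ∫⁻ y, F (A ω, y) ∂(P.map B) ∂P := by
        rw [lintegral_map hF.lintegral_prod_right' hA]
    _ = _ := by
        refine lintegral_congr fun ω => ?_
        rw [lintegral_map (by fun_prop) hB]

/-- Exponential square moment of a vector perturbed by a finite combination of independent
Gaussians. -/
lemma lintegral_exp_normSq_add_sum_le [MeasurableSpace E] [BorelSpace E]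
    [SecondCountableTopology E]
    {h : ℝ≥0} (hh : h ≠ 0) {η : ℕ → Ω → ℝ}
    (hη : ∀ k, Measurable (η k)) (hind : iIndepFun η P)
    (hlaw : ∀ k, P.map (η k) = gaussianReal 0 h) (s : ℕ → E) (K : ℕ) :
    ∀ (a : ℝ), 0 ≤ a → ∀ v : E, a * h * ∑ k ∈ Finset.range K, ‖s k‖ ^ 2 < 1 →
    ∫⁻ ω, ENNReal.ofReal
        (Real.exp (a / 2 * ‖v + ∑ k ∈ Finset.range K, η k ω • s k‖ ^ 2)) ∂P ≤
      ENNReal.ofReal ((√(1 - a * h * ∑ k ∈ Finset.range K, ‖s k‖ ^ 2))⁻¹ *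
        Real.exp (a / (1 - a * h * ∑ k ∈ Finset.range K, ‖s k‖ ^ 2) / 2 * ‖v‖ ^ 2)) := by
  have hh0 : (0 : ℝ) < h := by positivity
  induction K with
  | zero => intro a ha v _; simp
  | succ K ih =>
    intro a ha v hlt
    rw [Finset.sum_range_succ] at hlt
    set τ : ℝ := ∑ k ∈ Finset.range K, ‖s k‖ ^ 2 with hτ
    have hτ0 : 0 ≤ τ := Finset.sum_nonneg fun _ _ => by positivity
    have h1 : 0 ≤ a * h * τ := by positivity
    have h2 : 0 ≤ a * h * ‖s K‖ ^ 2 := by positivity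
    have hlt' : a * h * ‖s K‖ ^ 2 < 1 := by nlinarith
    set γ : ℝ := 1 - a * h * ‖s K‖ ^ 2 with hγ
    have hγ0 : 0 < γ := by linarith
    have hAB := hind.indepFun_finset (Finset.range K) {K} (by simp) hη
    have hA : Measurable fun ω => ∑ k ∈ Finset.range K, η k ω • s k := by fun_prop
    have hI : IndepFun (fun ω => ∑ k ∈ Finset.range K, η k ω • s k) (η K) P := by
      have hev : Measurable fun y : ({K} : Finset ℕ) → ℝ => y ⟨K, by simp⟩ :=
        measurable_pi_apply _
      have := hAB.comp (φ := fun y : Finset.range K → ℝ => ∑ i, y i • s i)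
        (ψ := fun y : ({K} : Finset ℕ) → ℝ => y ⟨K, by simp⟩) (by fun_prop) hev
      convert this using 1
      · ext1 ω
        simp only [Function.comp]
        rw [← Finset.sum_coe_sort (Finset.range K)]
      · rfl
    have e1 := lintegral_comp_indepFun hI hA (hη K)
      (F := fun z : E × ℝ => ENNReal.ofReal (Real.exp (a / 2 * ‖v + (z.1 + z.2 • s K)‖ ^ 2)))
      (by fun_prop)
    simp only [] at e1
    simp_rw [Finset.sum_range_succ, ← hτ]
    rw [e1]
    have e2 : ∀ ω, ∫⁻ ω', ENNReal.ofReal (Real.exp (a / 2 *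
        ‖v + (∑ k ∈ Finset.range K, η k ω • s k + η K ω' • s K)‖ ^ 2)) ∂P ≤
        ENNReal.ofReal (√γ)⁻¹ * ENNReal.ofReal
          (Real.exp (a / γ / 2 * ‖v + ∑ k ∈ Finset.range K, η k ω • s k‖ ^ 2)) := by
      intro ω
      rw [← ENNReal.ofReal_mul (by positivity)]
      refine le_trans (le_of_eq ?_) (lintegral_exp_normSq_add_smul_le hh _ (s K) hlt')
      rw [← hlaw K, lintegral_map (by fun_prop) (hη K)]
      simp_rw [add_assoc]
    -- Integrating out one Gaussian replaces `a` by `a / γ`. By this identity the factors `γ`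
    -- cancel, and only the total of the `‖s k‖²` remains.
    have hγ' : 1 - a / γ * h * τ = (1 - a * h * (τ + ‖s K‖ ^ 2)) / γ := by
      field_simp; rw [hγ]; ring
    refine (lintegral_mono e2).trans ?_
    rw [lintegral_const_mul _ (by fun_prop)]
    have hpos : 0 < 1 - a * h * (τ + ‖s K‖ ^ 2) := by linarith
    have h3 := ih (a / γ) (by positivity) v (by
      have : 0 < 1 - a / γ * h * τ := by rw [hγ']; positivity
      linarith)
    refine (mul_le_mul_right h3 _).trans (le_of_eq ?_)
    rw [← ENNReal.ofReal_mul (by positivity), hγ', Real.sqrt_div hpos.le]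
    congr 1
    have : 0 < √γ := Real.sqrt_pos.2 hγ0
    have : 0 < √(1 - a * h * (τ + ‖s K‖ ^ 2)) := Real.sqrt_pos.2 hpos
    field_simp

end Gaussian

/-! ### Scalar inequalities matching the discount factor to the Gaussian loss. -/

section Scalar

variable {α τ h t : ℝ}

/-- As `τ ≤ α` and `s ≤ t + h`, the right side is at least `1 - α s exp (-α s)`, and `(1 + α s) exp
(-α s) ≤ 1`. This is where it matters that `α` dominates the trace; no smallness of `h` is required.
-/
lemma exp_neg_le_one_sub (hτ : 0 ≤ τ) (hα : τ ≤ α) (ht : 0 ≤ t) {s : ℝ} (hs : 0 ≤ s)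
    (hsh : s ≤ h) :
    Real.exp (-α * s) ≤ 1 - Real.exp (-α * (t + h)) * s * τ := by
  have hα0 : 0 ≤ α := hτ.trans hα
  have h1 : Real.exp (-α * (t + h)) ≤ Real.exp (-α * s) :=
    Real.exp_le_exp.2 (by nlinarith)
  have h2 : Real.exp (-α * (t + h)) * s * τ ≤ Real.exp (-α * s) * s * α := by gcongr
  have h3 : Real.exp (-α * s) * (α * s + 1) ≤ Real.exp (-α * s) * Real.exp (α * s) :=
    mul_le_mul_of_nonneg_left (Real.add_one_le_exp _) (Real.exp_nonneg _)
  rw [← Real.exp_add, show -α * s + α * s = 0 by ring, Real.exp_zero] at h3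
  nlinarith

lemma exp_mul_lt_one (hτ : 0 ≤ τ) (hα : τ ≤ α) (ht : 0 ≤ t) (hh : 0 ≤ h) :
    Real.exp (-α * (t + h)) * h * τ < 1 := by
  have := exp_neg_le_one_sub hτ hα ht hh le_rfl
  have := Real.exp_pos (-α * h)
  linarith

/-- The discount over one time step absorbs the growth of the exponent caused by one Gaussian kick.
-/
lemma exp_div_one_sub_le (hτ : 0 ≤ τ) (hα : τ ≤ α) (ht : 0 ≤ t) (hh : 0 ≤ h) :
    Real.exp (-α * (t + h)) / (1 - Real.exp (-α * (t + h)) * h * τ) ≤ Real.exp (-α * t) := by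
  have h1 := exp_neg_le_one_sub hτ hα ht hh le_rfl
  have h2 := Real.exp_pos (-α * h)
  rw [div_le_iff₀ (by linarith)]
  calc Real.exp (-α * (t + h)) = Real.exp (-α * t) * Real.exp (-α * h) := by
        rw [← Real.exp_add]; ring_nf
    _ ≤ _ := by gcongr

/-- The logarithm of the left side is the integral over `s ∈ [0, h]` of `½ τ a / (1 - a s τ)`. By
`exp_neg_le_one_sub` the integrand is at most `½ τ exp (-α (t + h - s))`, and reversing time gives
the right side. -/
lemma inv_sqrt_one_sub_le (hτ : 0 ≤ τ) (hα : τ ≤ α) (ht : 0 ≤ t) (hh : 0 ≤ h) :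
    (√(1 - Real.exp (-α * (t + h)) * h * τ))⁻¹ ≤
      Real.exp (∫ s in t..(t + h), 1 / 2 * τ * Real.exp (-α * s)) := by
  set a := Real.exp (-α * (t + h)) with ha
  have hpos : ∀ s, 0 ≤ s → s ≤ h → 0 < 1 - a * s * τ := fun s hs hsh =>
    (Real.exp_pos _).trans_le (exp_neg_le_one_sub hτ hα ht hs hsh)
  have hL : ∀ s ∈ Set.uIcc 0 h, HasDerivAt (fun s => -(1 / 2) * Real.log (1 - a * s * τ))
      (1 / 2 * (a * τ / (1 - a * s * τ))) s := by
    intro s hs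
    rw [Set.uIcc_of_le hh] at hs
    have h1 : HasDerivAt (fun s => 1 - a * s * τ) (-(a * τ)) s := by
      have := (((hasDerivAt_id s).const_mul a).mul_const τ).const_sub 1
      simpa using this
    have := (h1.log (hpos s hs.1 hs.2).ne').const_mul (-(1 / 2 : ℝ))
    convert! this using 1
    ring
  have hcont : ContinuousOn (fun s => 1 / 2 * (a * τ / (1 - a * s * τ))) (Set.uIcc 0 h) := by
    rw [Set.uIcc_of_le hh]
    refine ContinuousOn.mul continuousOn_const (ContinuousOn.div continuousOn_const
      (by fun_prop) fun s hs => (hpos s hs.1 hs.2).ne')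
  have hFTC := intervalIntegral.integral_eq_sub_of_hasDerivAt hL hcont.intervalIntegrable
  have hmono : ∫ s in (0 : ℝ)..h, 1 / 2 * (a * τ / (1 - a * s * τ)) ≤
      ∫ s in (0 : ℝ)..h, 1 / 2 * τ * Real.exp (-α * ((t + h) - s)) := by
    refine intervalIntegral.integral_mono_on hh hcont.intervalIntegrable
      (Continuous.intervalIntegrable (by fun_prop) _ _) fun s hs => ?_
    have h1 := exp_neg_le_one_sub hτ hα ht hs.1 hs.2
    rw [← ha] at h1
    have h2 := hpos s hs.1 hs.2
    have h3 : a / (1 - a * s * τ) ≤ Real.exp (-α * ((t + h) - s)) := by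
      rw [div_le_iff₀ h2]
      calc a = Real.exp (-α * ((t + h) - s)) * Real.exp (-α * s) := by
            rw [← Real.exp_add, ha]; ring_nf
        _ ≤ _ := by gcongr
    calc 1 / 2 * (a * τ / (1 - a * s * τ)) = 1 / 2 * τ * (a / (1 - a * s * τ)) := by ring
      _ ≤ _ := by gcongr
  rw [intervalIntegral.integral_comp_sub_left (fun s => 1 / 2 * τ * Real.exp (-α * s)),
    hFTC] at hmono
  simp only [mul_zero, zero_mul, sub_zero, Real.log_one] at hmono
  rw [show t + h - h = t by ring] at hmono
  refine le_trans (le_of_eq ?_) (Real.exp_le_exp.2 hmono)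
  rw [← Real.exp_log (Real.sqrt_pos.2 (hpos h hh le_rfl)), Real.log_sqrt (hpos h hh le_rfl).le,
    ← Real.exp_neg]
  congr 1
  ring

end Scalar

/-! ### Exponential energy moments of an energy-conserving map with Gaussian kicks. -/

section Trajectory

variable {E : Type*} [NormedAddCommGroup E]

/-- The trajectory of the splitting scheme: a deterministic map followed by a kick `ζ m` of the
velocity. -/
def trajectory (step : E × E → E × E) (x₀ : E × E) (ζ : ℕ → E) : ℕ → E × E
  | 0 => x₀
  | m + 1 => ((step (trajectory step x₀ ζ m)).1, (step (trajectory step x₀ ζ m)).2 + ζ m)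

/-- Causality: the state after `m` steps ignores the kicks with index at least `m`, hence is
independent of kick `m`. -/
lemma trajectory_congr (step : E × E → E × E) (x₀ : E × E) {ζ ζ' : ℕ → E} {m : ℕ}
    (h : ∀ j < m, ζ j = ζ' j) : trajectory step x₀ ζ m = trajectory step x₀ ζ' m := by
  induction m with
  | zero => rfl
  | succ m ih =>
    simp only [trajectory]
    rw [ih fun j hj => h j (by omega), h m (by omega)]

/-- Continuity in the product topology serves twice: for measurability of the state, and for the
limit from truncated to full noise. -/
lemma continuous_trajectory {step : E × E → E × E} (hstep : Continuous step) (x₀ : E × E) (m : ℕ) :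
    Continuous fun ζ : ℕ → E => trajectory step x₀ ζ m := by
  induction m with
  | zero => exact continuous_const
  | succ m ih =>
    simp only [trajectory]
    fun_prop

variable [InnerProductSpace ℝ E] [MeasurableSpace E] [BorelSpace E] [SecondCountableTopology E]
  {Ω : Type*} [MeasurableSpace Ω] {P : Measure Ω} [IsProbabilityMeasure P]

/-- Exponential moment of the energy along the splitting scheme driven by finitely many
independent Gaussians per step. -/
lemma lintegral_exp_energy_trajectory_le_of_finite {step : E × E → E × E} (hstep : Continuous step)
    {U : E → ℝ} (hU : Continuous U) (hU0 : ∀ x, 0 ≤ U x)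
    (hcons : ∀ p, U (step p).1 + 1 / 2 * ‖(step p).2‖ ^ 2 = U p.1 + 1 / 2 * ‖p.2‖ ^ 2)
    {h : ℝ≥0} (hh : h ≠ 0) {η : ℕ × ℕ → Ω → ℝ} (hη : ∀ p, Measurable (η p))
    (hind : iIndepFun η P) (hlaw : ∀ p, P.map (η p) = gaussianReal 0 h)
    {s : ℕ → E} {τ α : ℝ} {K : ℕ} (hs : ∑ k ∈ Finset.range K, ‖s k‖ ^ 2 ≤ τ) (hα : τ ≤ α)
    (x₀ : E × E) (m : ℕ) :
    ∫⁻ ω, ENNReal.ofReal (Real.exp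
      ((U (trajectory step x₀ (fun j => ∑ k ∈ Finset.range K, η (k, j) ω • s k) m).1 +
        1 / 2 * ‖(trajectory step x₀ (fun j => ∑ k ∈ Finset.range K, η (k, j) ω • s k) m).2‖ ^ 2) *
          Real.exp (-α * (m * h)))) ∂P ≤
      ENNReal.ofReal (Real.exp (U x₀.1 + 1 / 2 * ‖x₀.2‖ ^ 2 +
        ∫ s in (0 : ℝ)..(m * h), 1 / 2 * τ * Real.exp (-α * s))) := by
  have hh0 : (0 : ℝ) < h := by positivity
  set σ : ℝ := ∑ k ∈ Finset.range K, ‖s k‖ ^ 2 with hσ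
  have hσ0 : 0 ≤ σ := Finset.sum_nonneg fun _ _ => by positivity
  induction m with
  | zero => simp [trajectory]
  | succ m ih =>
    set t : ℝ := m * h with ht
    have ht0 : 0 ≤ t := by positivity
    have hsucc : ((m + 1 : ℕ) : ℝ) * h = t + h := by push_cast; ring
    rw [hsucc]
    set Z : ℕ → Ω → E := fun j ω => ∑ k ∈ Finset.range K, η (k, j) ω • s k with hZ
    have hZm : ∀ j, Measurable (Z j) := fun j => by simp only [hZ]; fun_prop
    set X : Ω → E × E := fun ω => trajectory step x₀ (fun j => Z j ω) m with hX
    have hXm : Measurable X :=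
      (continuous_trajectory hstep x₀ m).measurable.comp (measurable_pi_iff.2 hZm)
    -- `X` depends on the variables `η (k, j)` with `j < m` and `Z m` on those with `j = m`:
    -- disjoint finite blocks of an independent family. Extension by zero lets functions of a block
    -- be written as functions of full sequences.
    have hI : IndepFun X (Z m) P := by
      classical
      have h1 := hind.indepFun_finset (Finset.range K ×ˢ Finset.range m)
        (Finset.range K ×ˢ {m}) (by
          rw [Finset.disjoint_left]
          rintro ⟨k, j⟩ h1 h2
          simp only [Finset.mem_product, Finset.mem_range, Finset.mem_singleton] at h1 h2
          omega) hη
      have h2 := h1.comp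
        (φ := fun y => trajectory step x₀ (fun j => ∑ k ∈ Finset.range K,
          (if hm : (k, j) ∈ Finset.range K ×ˢ Finset.range m then y ⟨(k, j), hm⟩ else 0) • s k) m)
        (ψ := fun y => ∑ k ∈ Finset.range K,
          (if hm : (k, m) ∈ Finset.range K ×ˢ ({m} : Finset ℕ) then y ⟨(k, m), hm⟩ else 0) • s k)
        (by
          refine (continuous_trajectory hstep x₀ m).measurable.comp (measurable_pi_iff.2 fun j => ?_)
          refine Finset.measurable_fun_sum _ fun k _ => Measurable.smul_const ?_ _
          split_ifs with hm
          · exact measurable_pi_apply _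
          · exact measurable_const)
        (by
          refine Finset.measurable_fun_sum _ fun k _ => Measurable.smul_const ?_ _
          split_ifs with hm
          · exact measurable_pi_apply _
          · exact measurable_const)
      convert h2 using 1
      · ext1 ω
        simp only [Function.comp, hX]
        refine trajectory_congr _ _ fun j hj => Finset.sum_congr rfl fun k hk => ?_
        rw [dif_pos (by simp [hj, Finset.mem_range.1 hk])]
      · ext1 ω
        refine Finset.sum_congr rfl fun k hk => ?_
        rw [dif_pos (by simp [Finset.mem_range.1 hk])]
    have hstepm : Measurable step := hstep.measurable
    have hUm : Measurable U := hU.measurable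
    set a := Real.exp (-α * (t + h)) with ha
    have e1 := lintegral_comp_indepFun hI hXm (hZm m)
      (F := fun z : (E × E) × E => ENNReal.ofReal (Real.exp
        ((U (step z.1).1 + 1 / 2 * ‖(step z.1).2 + z.2‖ ^ 2) * a))) (by fun_prop)
    simp only [trajectory]
    refine (le_of_eq e1).trans ?_
    have hlt : a * h * σ < 1 := exp_mul_lt_one hσ0 (hs.trans hα) ht0 hh0.le
    have ha1 : a / (1 - a * h * σ) ≤ Real.exp (-α * t) :=
      exp_div_one_sub_le hσ0 (hs.trans hα) ht0 hh0.le
    have ha2 : a ≤ Real.exp (-α * t) := by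
      refine Real.exp_le_exp.2 ?_
      have : 0 ≤ α := hσ0.trans (hs.trans hα)
      nlinarith
    have hI' : Real.exp (∫ s in t..(t + h), 1 / 2 * σ * Real.exp (-α * s)) ≤
        Real.exp (∫ s in t..(t + h), 1 / 2 * τ * Real.exp (-α * s)) := by
      refine Real.exp_le_exp.2 (intervalIntegral.integral_mono_on (by linarith)
        (Continuous.intervalIntegrable (by fun_prop) _ _)
        (Continuous.intervalIntegrable (by fun_prop) _ _) fun s _ => by gcongr)
    -- One step conditionally on the past. The Gaussian bound raises the weight of the kinetic term
    -- to at most `exp (-α t)`; since `U ≥ 0`, the weight `a` of the potential may be raised to the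
    -- same value. Conservation then returns the energy before the step.
    have e2 : ∀ ω, ∫⁻ ω', ENNReal.ofReal (Real.exp
        ((U (step (X ω)).1 + 1 / 2 * ‖(step (X ω)).2 + Z m ω'‖ ^ 2) * a)) ∂P ≤
        ENNReal.ofReal (Real.exp (∫ s in t..(t + h), 1 / 2 * τ * Real.exp (-α * s))) *
        ENNReal.ofReal (Real.exp ((U (X ω).1 + 1 / 2 * ‖(X ω).2‖ ^ 2) * Real.exp (-α * t))) := by
      intro ω
      have h1 := lintegral_exp_normSq_add_sum_le hh (fun k => hη (k, m))
        (hind.precomp (g := fun k => (k, m)) fun k k' hk => by simpa using hk)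
        (fun k => hlaw (k, m)) s K a (Real.exp_nonneg _) (step (X ω)).2 hlt
      have h2 : ∀ ω', ENNReal.ofReal (Real.exp
          ((U (step (X ω)).1 + 1 / 2 * ‖(step (X ω)).2 + Z m ω'‖ ^ 2) * a)) =
          ENNReal.ofReal (Real.exp (U (step (X ω)).1 * a)) *
          ENNReal.ofReal (Real.exp (a / 2 * ‖(step (X ω)).2 + Z m ω'‖ ^ 2)) := by
        intro ω'
        rw [← ENNReal.ofReal_mul (Real.exp_nonneg _), ← Real.exp_add]
        ring_nf
      simp_rw [h2]
      rw [lintegral_const_mul _ (by fun_prop)]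
      refine (mul_le_mul_right h1 _).trans ?_
      rw [← ENNReal.ofReal_mul (Real.exp_nonneg _), ← ENNReal.ofReal_mul (Real.exp_nonneg _)]
      refine ENNReal.ofReal_le_ofReal ?_
      rw [mul_left_comm, ← Real.exp_add]
      refine mul_le_mul ((inv_sqrt_one_sub_le hσ0 (hs.trans hα) ht0 hh0.le).trans hI')
        (Real.exp_le_exp.2 ?_) (Real.exp_nonneg _) (Real.exp_nonneg _)
      rw [← hcons, add_mul]
      refine add_le_add (mul_le_mul_of_nonneg_left ha2 (hU0 _)) ?_
      rw [← hσ]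
      nlinarith [sq_nonneg ‖(step (X ω)).2‖]
    refine (lintegral_mono e2).trans ?_
    rw [lintegral_const_mul _ (by fun_prop)]
    refine (mul_le_mul_right ih _).trans (le_of_eq ?_)
    rw [← ENNReal.ofReal_mul (Real.exp_nonneg _), ← Real.exp_add]
    congr 2
    rw [← intervalIntegral.integral_add_adjacent_intervals (a := 0) (b := t) (c := t + h)
      (Continuous.intervalIntegrable (by fun_prop) _ _)
      (Continuous.intervalIntegrable (by fun_prop) _ _)]
    ring

/-- Exponential moment of the energy along the splitting scheme driven by a Gaussian series. -/
lemma lintegral_exp_energy_trajectory_le {step : E × E → E × E} (hstep : Continuous step)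
    {U : E → ℝ} (hU : Continuous U) (hU0 : ∀ x, 0 ≤ U x)
    (hcons : ∀ p, U (step p).1 + 1 / 2 * ‖(step p).2‖ ^ 2 = U p.1 + 1 / 2 * ‖p.2‖ ^ 2)
    {h : ℝ≥0} (hh : h ≠ 0) {η : ℕ × ℕ → Ω → ℝ} (hη : ∀ p, Measurable (η p))
    (hind : iIndepFun η P) (hlaw : ∀ p, P.map (η p) = gaussianReal 0 h)
    {s : ℕ → E} {τ α : ℝ} (hs : ∀ K, ∑ k ∈ Finset.range K, ‖s k‖ ^ 2 ≤ τ) (hα : τ ≤ α)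
    {ζ : ℕ → Ω → E} (hζ : ∀ᵐ ω ∂P, ∀ j,
      Tendsto (fun K => ∑ k ∈ Finset.range K, η (k, j) ω • s k) atTop (𝓝 (ζ j ω)))
    (x₀ : E × E) (m : ℕ) :
    ∫⁻ ω, ENNReal.ofReal (Real.exp
      ((U (trajectory step x₀ (fun j => ζ j ω) m).1 +
        1 / 2 * ‖(trajectory step x₀ (fun j => ζ j ω) m).2‖ ^ 2) *
          Real.exp (-α * (m * h)))) ∂P ≤
      ENNReal.ofReal (Real.exp (U x₀.1 + 1 / 2 * ‖x₀.2‖ ^ 2 +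
        ∫ s in (0 : ℝ)..(m * h), 1 / 2 * τ * Real.exp (-α * s))) := by
  have hG : Continuous fun z : ℕ → E => ENNReal.ofReal (Real.exp
      ((U (trajectory step x₀ z m).1 + 1 / 2 * ‖(trajectory step x₀ z m).2‖ ^ 2) *
        Real.exp (-α * (m * h)))) := by
    have := continuous_trajectory hstep x₀ m
    exact ENNReal.continuous_ofReal.comp (by fun_prop)
  set G := fun z : ℕ → E => ENNReal.ofReal (Real.exp
      ((U (trajectory step x₀ z m).1 + 1 / 2 * ‖(trajectory step x₀ z m).2‖ ^ 2) *
        Real.exp (-α * (m * h)))) with hGdef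
  -- The bound for truncated noise does not depend on the truncation, so Fatou's lemma suffices and
  -- no uniform integrability is needed.
  calc ∫⁻ ω, G (fun j => ζ j ω) ∂P
      = ∫⁻ ω, liminf (fun K => G fun j => ∑ k ∈ Finset.range K, η (k, j) ω • s k) atTop ∂P := by
        refine lintegral_congr_ae ?_
        filter_upwards [hζ] with ω hω
        exact ((hG.tendsto _).comp (tendsto_pi_nhds.2 hω)).liminf_eq.symm
    _ ≤ liminf (fun K => ∫⁻ ω, G (fun j => ∑ k ∈ Finset.range K, η (k, j) ω • s k) ∂P) atTop :=
        lintegral_liminf_le fun K => hG.measurable.comp (by fun_prop)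
    _ ≤ _ := by
        refine (liminf_le_liminf (Eventually.of_forall fun K =>
          lintegral_exp_energy_trajectory_le_of_finite hstep hU hU0 hcons hh hη hind hlaw
            (hs K) hα x₀ m)).trans ?_
        simp

end Trajectory

/-! ### Sobolev and Gagliardo–Nirenberg inequalities for test functions. -/

section Sobolev

variable {d : ℕ}

lemma volume_cube : volume (cube d : Set (EuclideanSpace ℝ (Fin d))) = 1 := by
  have h1 : (cube d : Set (EuclideanSpace ℝ (Fin d))) =
      (WithLp.ofLp : EuclideanSpace ℝ (Fin d) → Fin d → ℝ) ⁻¹'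
        (Set.univ.pi fun _ => Set.Ioo (0 : ℝ) 1) := by
    ext x
    change (∀ i, x i ∈ Set.Ioo (0 : ℝ) 1) ↔ _
    simp [Set.mem_pi]
  rw [h1, (PiLp.volume_preserving_ofLp (Fin d)).measure_preimage
    (MeasurableSet.univ_pi fun _ => measurableSet_Ioo).nullMeasurableSet, Real.volume_pi_Ioo]
  simp

instance instIsProbabilityMeasureCube : IsProbabilityMeasure (cubeMeasure d) :=
  ⟨by rw [cubeMeasure, Measure.restrict_apply_univ, volume_cube]⟩

lemma sq_lintegral_mul_le {X : Type*} [MeasurableSpace X] {μ : Measure X} {f g : X → ℝ≥0∞}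
    (hf : AEMeasurable f μ) (hg : AEMeasurable g μ) :
    (∫⁻ x, f x * g x ∂μ) ^ 2 ≤ (∫⁻ x, f x ^ 2 ∂μ) * ∫⁻ x, g x ^ 2 ∂μ := by
  have h := ENNReal.lintegral_mul_le_Lp_mul_Lq μ Real.HolderConjugate.two_two hf hg
  calc (∫⁻ x, f x * g x ∂μ) ^ 2
      ≤ ((∫⁻ a, f a ^ (2 : ℝ) ∂μ) ^ (1 / (2 : ℝ)) * (∫⁻ a, g a ^ (2 : ℝ) ∂μ) ^ (1 / (2 : ℝ))) ^ 2 := by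
        gcongr; exact h
    _ = _ := by
        rw [mul_pow, ← ENNReal.rpow_natCast, ← ENNReal.rpow_natCast, ← ENNReal.rpow_mul,
          ← ENNReal.rpow_mul]
        norm_num

/-- Sobolev inequality `W^{1,1} ⊆ L²` for compactly supported functions in dimension at most two. -/
lemma exists_lintegral_sq_le_sq_lintegral_fderiv (hd : d = 1 ∨ d = 2) :
    ∃ C : ℝ≥0, ∀ ψ : EuclideanSpace ℝ (Fin d) → ℝ, ContDiff ℝ 1 ψ → HasCompactSupport ψ →
      tsupport ψ ⊆ cube d →
      ∫⁻ x, ‖ψ x‖ₑ ^ 2 ∂(cubeMeasure d) ≤ C * (∫⁻ x, ‖fderiv ℝ ψ x‖ₑ ∂(cubeMeasure d)) ^ 2 := by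
  have hsupp : ∀ ψ : EuclideanSpace ℝ (Fin d) → ℝ, tsupport ψ ⊆ cube d →
      ∫⁻ x, ‖fderiv ℝ ψ x‖ₑ ∂(cubeMeasure d) = ∫⁻ x, ‖fderiv ℝ ψ x‖ₑ := by
    intro ψ hψ
    refine setLIntegral_eq_of_support_subset (subset_trans ?_
      ((support_fderiv_subset ℝ (f := ψ)).trans hψ))
    exact fun x hx h0 => hx (by simp only [h0]; rw [← ofReal_norm, norm_zero, ENNReal.ofReal_zero])
  rcases hd with rfl | rfl
  -- In dimension one `|ψ|` is bounded everywhere by the integral of `|ψ'|`, and the cube has unit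
  -- mass.
  · refine ⟨1, fun ψ h1 h2 h3 => ?_⟩
    rw [hsupp ψ h3]
    let L : ℝ ≃ₗᵢ[ℝ] EuclideanSpace ℝ (Fin 1) := (OrthonormalBasis.singleton (Fin 1) ℝ).repr
    have hL := LinearIsometryEquiv.measurePreserving L
    have hbound : ∀ x, ‖ψ x‖ₑ ≤ ∫⁻ x, ‖fderiv ℝ ψ x‖ₑ := by
      intro x
      have hc1 : ContDiff ℝ 1 (ψ ∘ L) := h1.comp L.contDiff
      have hc2 : HasCompactSupport (ψ ∘ L) := h2.comp_homeomorph L.toHomeomorph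
      have := hc2.enorm_le_lintegral_Ici_deriv hc1 (L.symm x)
      simp only [Function.comp, LinearIsometryEquiv.apply_symm_apply] at this
      refine this.trans ((setLIntegral_le_lintegral _ _).trans ?_)
      rw [← hL.lintegral_comp_emb L.toHomeomorph.measurableEmbedding]
      refine lintegral_mono fun t => ?_
      have hder : deriv (ψ ∘ L) t = fderiv ℝ ψ (L t) (L 1) := by
        have := ((h1.differentiable one_ne_zero (L t)).hasFDerivAt).comp_hasDerivAt t
          (L.toContinuousLinearEquiv.toContinuousLinearMap.hasDerivAt (x := t))
        exact this.deriv
      change ‖deriv (ψ ∘ L) t‖ₑ ≤ _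
      rw [hder]
      have h5 : ‖fderiv ℝ ψ (L t) (L 1)‖ ≤ ‖fderiv ℝ ψ (L t)‖ := by
        have := (fderiv ℝ ψ (L t)).le_opNorm (L 1)
        simpa using this
      exact enorm_le_iff_norm_le.2 h5
    calc ∫⁻ x, ‖ψ x‖ₑ ^ 2 ∂(cubeMeasure 1)
        ≤ ∫⁻ x, (∫⁻ x, ‖fderiv ℝ ψ x‖ₑ) ^ 2 ∂(cubeMeasure 1) :=
          lintegral_mono fun x => by gcongr; exact hbound x
      _ = _ := by simp
  -- In dimension two this is the endpoint Sobolev inequality, whose exponent is the conjugate of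
  -- the dimension, again `2`.
  · refine ⟨lintegralPowLePowLIntegralFDerivConst (volume : Measure (EuclideanSpace ℝ (Fin 2))) 2,
      fun ψ h1 h2 h3 => ?_⟩
    rw [hsupp ψ h3]
    have := lintegral_pow_le_pow_lintegral_fderiv
      (volume : Measure (EuclideanSpace ℝ (Fin 2))) h1 h2 (p := 2) (by
        simpa using Real.HolderConjugate.two_two)
    simp only [ENNReal.rpow_ofNat] at this
    exact (setLIntegral_le_lintegral _ _).trans this

lemma norm_fderiv_sq_le (φ : EuclideanSpace ℝ (Fin d) → ℝ) (x : EuclideanSpace ℝ (Fin d)) :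
    ‖fderiv ℝ φ x‖ ^ 2 ≤ ∑ i, partialDeriv φ i x ^ 2 := by
  have hle : ‖fderiv ℝ φ x‖ ≤ √(∑ i, partialDeriv φ i x ^ 2) := by
    refine ContinuousLinearMap.opNorm_le_bound _ (Real.sqrt_nonneg _) fun y => ?_
    have hy : fderiv ℝ φ x y = ∑ i, partialDeriv φ i x * y i := by
      conv_lhs => rw [← (EuclideanSpace.basisFun (Fin d) ℝ).sum_repr y]
      simp [partialDeriv, map_sum, mul_comm]
    rw [hy, Real.norm_eq_abs, EuclideanSpace.norm_eq, ← Real.sqrt_mul (by positivity)]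
    refine Real.abs_le_sqrt ?_
    refine (Finset.sum_mul_sq_le_sq_mul_sq _ _ _).trans (le_of_eq ?_)
    simp
  calc ‖fderiv ℝ φ x‖ ^ 2 ≤ (√(∑ i, partialDeriv φ i x ^ 2)) ^ 2 := by gcongr
    _ = _ := Real.sq_sqrt (by positivity)

lemma continuous_partialDeriv (φ : CubeTest d) (i : Fin d) : Continuous (partialDeriv φ i) :=
  (φ.contDiff.continuous_fderiv (by simp)).clm_apply continuous_const

/-- A Gagliardo–Nirenberg inequality for test functions on the cube. -/
lemma exists_lintegral_pow_six_le_of_test (hd : d = 1 ∨ d = 2) :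
    ∃ C : ℝ≥0, ∀ φ : CubeTest d,
      ∫⁻ x, ‖φ x‖ₑ ^ 6 ∂(cubeMeasure d) ≤ C * (∫⁻ x, ‖φ x‖ₑ ^ 2 ∂(cubeMeasure d)) *
        (∑ i, ∫⁻ x, ‖partialDeriv φ i x‖ₑ ^ 2 ∂(cubeMeasure d)) ^ 2 := by
  obtain ⟨C, hC⟩ := exists_lintegral_sq_le_sq_lintegral_fderiv hd
  refine ⟨36 * C ^ 2, fun φ => ?_⟩
  set μ := cubeMeasure d
  have hφ : ContDiff ℝ 1 φ := φ.contDiff.of_le (by simp)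
  have hdiff : Differentiable ℝ φ := hφ.differentiable one_ne_zero
  have hmφ : Measurable φ := φ.continuous.measurable
  have hmD : Measurable (fun x => fderiv ℝ φ x) := (hφ.continuous_fderiv one_ne_zero).measurable
  -- Applied to `φ²` and then to `φ³`: with Cauchy–Schwarz on `φ ∇φ` and `φ² ∇φ`, this bounds the
  -- `L⁴` integral by the `L²` one and the `L⁶` integral by the `L⁴` one, at the cost of one factor
  -- `D` each time.
  have hpow : ∀ n : ℕ, n ≠ 0 → ∫⁻ x, ‖φ x ^ n‖ₑ ^ 2 ∂μ ≤
      C * (∫⁻ x, ‖fderiv ℝ (fun x => φ x ^ n) x‖ₑ ∂μ) ^ 2 := by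
    intro n hn
    have hts : tsupport (fun x => φ x ^ n) ⊆ tsupport φ :=
      closure_mono fun x hx => by
        simp only [Function.mem_support] at hx ⊢
        exact fun h0 => hx (by rw [h0, zero_pow hn])
    exact hC _ (hφ.pow n) 
      (IsCompact.of_isClosed_subset φ.hasCompactSupport (isClosed_tsupport _) hts)
      (hts.trans φ.tsupport_subset)
  have hfd : ∀ n : ℕ, ∀ x, ‖fderiv ℝ (fun x => φ x ^ n) x‖ₑ =
      n * (‖φ x‖ₑ ^ (n - 1) * ‖fderiv ℝ φ x‖ₑ) := by
    intro n x
    rw [fderiv_fun_pow n (hdiff x), enorm_smul]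
    simp [enorm_mul, enorm_pow, mul_assoc]
  have hCS : ∀ f : EuclideanSpace ℝ (Fin d) → ℝ≥0∞, Measurable f → ∀ n : ℕ,
      (∫⁻ x, n * (f x * ‖fderiv ℝ φ x‖ₑ) ∂μ) ^ 2 ≤
        n ^ 2 * ((∫⁻ x, f x ^ 2 ∂μ) * ∫⁻ x, ‖fderiv ℝ φ x‖ₑ ^ 2 ∂μ) := by
    intro f hf n
    rw [lintegral_const_mul _ (by fun_prop), mul_pow]
    gcongr
    exact sq_lintegral_mul_le (by fun_prop) (by fun_prop)
  have hB : ∫⁻ x, ‖fderiv ℝ φ x‖ₑ ^ 2 ∂μ ≤ ∑ i, ∫⁻ x, ‖partialDeriv φ i x‖ₑ ^ 2 ∂μ := by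
    rw [← lintegral_finsetSum _ fun i _ => by
      have := (continuous_partialDeriv φ i).measurable; fun_prop]
    refine lintegral_mono fun x => ?_
    have := ENNReal.ofReal_le_ofReal (norm_fderiv_sq_le φ x)
    rw [ENNReal.ofReal_sum_of_nonneg fun i _ => sq_nonneg _] at this
    calc ‖fderiv ℝ φ x‖ₑ ^ 2 = ENNReal.ofReal (‖fderiv ℝ φ x‖ ^ 2) := by
          rw [ENNReal.ofReal_pow (norm_nonneg _), ofReal_norm]
      _ ≤ _ := this
      _ = _ := Finset.sum_congr rfl fun i _ => by
          rw [← sq_abs, ENNReal.ofReal_pow (abs_nonneg _), ← Real.norm_eq_abs, ofReal_norm]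
  set A := ∫⁻ x, ‖φ x‖ₑ ^ 2 ∂μ
  set D := ∫⁻ x, ‖fderiv ℝ φ x‖ₑ ^ 2 ∂μ
  have h4 : ∫⁻ x, ‖φ x‖ₑ ^ 4 ∂μ ≤ C * (4 * (A * D)) := by
    have h1 := hpow 2 two_ne_zero
    simp_rw [hfd 2, enorm_pow, ← pow_mul] at h1
    refine h1.trans ?_
    gcongr
    refine (hCS _ (by fun_prop) 2).trans (le_of_eq ?_)
    norm_num [A, D]
  have h6 : ∫⁻ x, ‖φ x‖ₑ ^ 6 ∂μ ≤ C * (9 * ((∫⁻ x, ‖φ x‖ₑ ^ 4 ∂μ) * D)) := by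
    have h1 := hpow 3 three_ne_zero
    simp_rw [hfd 3, enorm_pow, ← pow_mul] at h1
    refine h1.trans ?_
    gcongr
    refine (hCS _ (by fun_prop) 3).trans (le_of_eq ?_)
    simp_rw [← pow_mul]
    norm_num [D]
  calc ∫⁻ x, ‖φ x‖ₑ ^ 6 ∂μ ≤ C * (9 * ((C * (4 * (A * D))) * D)) := h6.trans (by gcongr)
    _ = (36 * C ^ 2 : ℝ≥0) * A * D ^ 2 := by push_cast; ring
    _ ≤ _ := by gcongr

end Sobolev

/-! ### Weak gradients in `H¹₀` and passage to the limit from test functions. -/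

section Gradient

variable {d : ℕ}

lemma inner_eq_integral (f g : L2 d) : inner ℝ f g = ∫ x, f x * g x ∂(cubeMeasure d) := by
  rw [L2.inner_def]
  simp [mul_comm]

lemma memLp_test (φ : CubeTest d) (p : ℝ≥0∞) : MemLp φ p (cubeMeasure d) :=
  φ.continuous.memLp_of_hasCompactSupport φ.hasCompactSupport

lemma memLp_partialDeriv (φ : CubeTest d) (i : Fin d) (p : ℝ≥0∞) :
    MemLp (partialDeriv φ i) p (cubeMeasure d) :=
  (continuous_partialDeriv φ i).memLp_of_hasCompactSupport
    (φ.hasCompactSupport.fderiv_apply (𝕜 := ℝ) (EuclideanSpace.single i 1))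

lemma eLpNorm_two_sq {X : Type*} [MeasurableSpace X] (μ : Measure X) (f : X → ℝ) :
    eLpNorm f 2 μ ^ 2 = ∫⁻ x, ‖f x‖ₑ ^ 2 ∂μ := by
  have := eLpNorm_nnreal_pow_eq_lintegral (μ := μ) (f := f) (p := 2) two_ne_zero
  simpa using this

lemma lintegral_enorm_sq_eq (f : L2 d) :
    ∫⁻ x, ‖f x‖ₑ ^ 2 ∂(cubeMeasure d) = ENNReal.ofReal (‖f‖ ^ 2) := by
  rw [← eLpNorm_two_sq, ENNReal.ofReal_pow (norm_nonneg _), Lp.norm_def,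
    ENNReal.ofReal_toReal (Lp.eLpNorm_ne_top f)]

/-- The test functions approximating an element of `H¹₀`, as a convergent sequence in `L²`. -/
lemma HasH10Gradient.exists_tendsto {w : L2 d} {g : Fin d → L2 d} (h : HasH10Gradient w g) :
    ∃ φ : ℕ → CubeTest d,
      Tendsto (fun n => (memLp_test (φ n) 2).toLp) atTop (𝓝 w) ∧
      ∀ i, Tendsto (fun n => (memLp_partialDeriv (φ n) i 2).toLp) atTop (𝓝 (g i)) := by
  obtain ⟨φ, h1, h2⟩ := h
  refine ⟨φ, ?_, fun i => ?_⟩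
  · have := (Lp.tendsto_Lp_iff_tendsto_eLpNorm'' (fi := atTop) (fun n => ⇑(φ n))
      (fun n => memLp_test (φ n) 2) w (Lp.memLp w)).2 h1
    simpa using this
  · have := (Lp.tendsto_Lp_iff_tendsto_eLpNorm'' (fi := atTop) (fun n => partialDeriv (φ n) i)
      (fun n => memLp_partialDeriv (φ n) i 2) (g i) (Lp.memLp (g i))).2 (h2 i)
    simpa using this

lemma hasH10Gradient_of_tendsto {w : L2 d} {g : Fin d → L2 d} {φ : ℕ → CubeTest d}
    (h1 : Tendsto (fun n => (memLp_test (φ n) 2).toLp) atTop (𝓝 w))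
    (h2 : ∀ i, Tendsto (fun n => (memLp_partialDeriv (φ n) i 2).toLp) atTop (𝓝 (g i))) :
    HasH10Gradient w g := by
  refine ⟨φ, ?_, fun i => ?_⟩
  · exact (Lp.tendsto_Lp_iff_tendsto_eLpNorm'' (fi := atTop) (fun n => ⇑(φ n))
      (fun n => memLp_test (φ n) 2) w (Lp.memLp w)).1 (by simpa using h1)
  · exact (Lp.tendsto_Lp_iff_tendsto_eLpNorm'' (fi := atTop) (fun n => partialDeriv (φ n) i)
      (fun n => memLp_partialDeriv (φ n) i 2) (g i) (Lp.memLp (g i))).1 (by simpa using h2 i)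

lemma differentiable_test (φ : CubeTest d) : Differentiable ℝ φ :=
  φ.contDiff.differentiable (by simp)

lemma HasH10Gradient.add_smul {w w' : L2 d} {g g' : Fin d → L2 d} (h : HasH10Gradient w g)
    (h' : HasH10Gradient w' g') (c : ℝ) :
    HasH10Gradient (w + c • w') (fun i => g i + c • g' i) := by
  obtain ⟨φ, h1, h2⟩ := h.exists_tendsto
  obtain ⟨φ', h1', h2'⟩ := h'.exists_tendsto
  have hpd : ∀ n i, partialDeriv (φ n + c • φ' n : CubeTest d) i =
      partialDeriv (φ n) i + c • partialDeriv (φ' n) i := by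
    intro n i
    ext x
    have : ⇑(φ n + c • φ' n : CubeTest d) = ⇑(φ n) + c • ⇑(φ' n) := rfl
    simp only [partialDeriv, this, Pi.add_apply, Pi.smul_apply]
    rw [fderiv_add (differentiable_test _ x) ((differentiable_test _ x).const_smul c),
      fderiv_const_smul (differentiable_test _ x)]
    rfl
  refine hasH10Gradient_of_tendsto (φ := fun n => φ n + c • φ' n) ?_ fun i => ?_
  · exact h1.add (h1'.const_smul c)
  · refine ((h2 i).add ((h2' i).const_smul c)).congr fun n => ?_
    rw [← MemLp.toLp_const_smul, ← MemLp.toLp_add]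
    exact (MemLp.toLp_congr _ _ (by rw [hpd])).symm

lemma hasH10Gradient_zero : HasH10Gradient (0 : L2 d) (fun _ => 0) := by
  refine ⟨fun _ => 0, ?_, fun i => ?_⟩
  · refine tendsto_const_nhds.congr fun n => ?_
    rw [eq_comm]
    refine (eLpNorm_congr_ae (g := 0) ?_).trans (by simp)
    filter_upwards [Lp.coeFn_zero ℝ 2 (cubeMeasure d)] with x hx
    rw [hx]; simp
  · refine tendsto_const_nhds.congr fun n => ?_
    rw [eq_comm]
    refine (eLpNorm_congr_ae (g := 0) ?_).trans (by simp)
    filter_upwards [Lp.coeFn_zero ℝ 2 (cubeMeasure d)] with x hx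
    rw [hx]
    have : ⇑(0 : CubeTest d) = fun _ => (0 : ℝ) := rfl
    simp [partialDeriv, this]

lemma HasH10Gradient.sum {ι : Type*} (s : Finset ι) {w : ι → L2 d} {g : ι → Fin d → L2 d}
    (h : ∀ k, HasH10Gradient (w k) (g k)) (c : ι → ℝ) :
    HasH10Gradient (∑ k ∈ s, c k • w k) (fun i => ∑ k ∈ s, c k • g k i) := by
  classical
  induction s using Finset.induction_on with
  | empty => simpa using hasH10Gradient_zero
  | insert a s ha ih =>
    simp_rw [Finset.sum_insert ha]
    simp_rw [add_comm (c a • _)]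
    exact ih.add_smul (h a) (c a)

/-- The weak eigenvalue equation tested against elements of `H¹₀`. -/
lemma sum_inner_gradient_eq {μ : ℝ} {w : L2 d} {g : Fin d → L2 d}
    (heig : ∀ φ : CubeTest d,
      ∑ i, ∫ x, g i x * partialDeriv φ i x ∂(cubeMeasure d)
        = μ * ∫ x, w x * φ x ∂(cubeMeasure d))
    {w' : L2 d} {g' : Fin d → L2 d} (h' : HasH10Gradient w' g') :
    ∑ i, inner ℝ (g i) (g' i) = μ * inner ℝ w w' := by
  obtain ⟨φ, h1, h2⟩ := h'.exists_tendsto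
  have hl : Tendsto (fun n => ∑ i, inner ℝ (g i) ((memLp_partialDeriv (φ n) i 2).toLp)) atTop
      (𝓝 (∑ i, inner ℝ (g i) (g' i))) :=
    tendsto_finsetSum _ fun i _ => tendsto_const_nhds.inner (h2 i)
  have hr : Tendsto (fun n => μ * inner ℝ w ((memLp_test (φ n) 2).toLp)) atTop
      (𝓝 (μ * inner ℝ w w')) := (tendsto_const_nhds.inner h1).const_mul μ
  refine tendsto_nhds_unique hl (hr.congr fun n => ?_)
  simp_rw [inner_eq_integral]
  have e1 : ∫ x, w x * ((memLp_test (φ n) 2).toLp : L2 d) x ∂(cubeMeasure d) =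
      ∫ x, w x * φ n x ∂(cubeMeasure d) := by
    refine integral_congr_ae ?_
    filter_upwards [(memLp_test (φ n) 2).coeFn_toLp] with x hx
    rw [hx]
  rw [e1, ← heig (φ n)]
  refine Finset.sum_congr rfl fun i _ => integral_congr_ae ?_
  filter_upwards [(memLp_partialDeriv (φ n) i 2).coeFn_toLp] with x hx
  rw [hx]

/-- A Gagliardo–Nirenberg inequality in `H¹₀` of the cube. -/
lemma exists_lintegral_pow_six_le (hd : d = 1 ∨ d = 2) :
    ∃ C : ℝ≥0, ∀ (w : L2 d) (g : Fin d → L2 d), HasH10Gradient w g →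
      ∫⁻ x, ‖w x‖ₑ ^ 6 ∂(cubeMeasure d) ≤
        ENNReal.ofReal (C * ‖w‖ ^ 2 * (∑ i, ‖g i‖ ^ 2) ^ 2) := by
  obtain ⟨C, hC⟩ := exists_lintegral_pow_six_le_of_test hd
  refine ⟨C, fun w g h => ?_⟩
  obtain ⟨φ, h1, h2⟩ := h.exists_tendsto
  -- Convergence is known only in `L²`; an almost everywhere convergent subsequence lets Fatou's
  -- lemma carry the `L⁶` bound to the limit.
  obtain ⟨φ', h1', h2', hae⟩ : ∃ φ' : ℕ → CubeTest d,
      Tendsto (fun n => (memLp_test (φ' n) 2).toLp) atTop (𝓝 w) ∧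
      (∀ i, Tendsto (fun n => (memLp_partialDeriv (φ' n) i 2).toLp) atTop (𝓝 (g i))) ∧
      ∀ᵐ x ∂(cubeMeasure d), Tendsto (fun n => φ' n x) atTop (𝓝 (w x)) := by
    have hm : TendstoInMeasure (cubeMeasure d) (fun n => ⇑(φ n)) atTop w := by
      refine tendstoInMeasure_of_tendsto_eLpNorm (p := 2) two_ne_zero
        (fun n => (memLp_test (φ n) 2).1) (Lp.memLp w).1 ?_
      exact (Lp.tendsto_Lp_iff_tendsto_eLpNorm'' (fi := atTop) (fun n => ⇑(φ n))
        (fun n => memLp_test (φ n) 2) w (Lp.memLp w)).1 (by simpa using h1)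
    obtain ⟨ns, hns, hae⟩ := hm.exists_seq_tendsto_ae
    exact ⟨fun n => φ (ns n), h1.comp hns.tendsto_atTop, fun i => (h2 i).comp hns.tendsto_atTop,
      hae⟩
  have hbound : ∀ n, ∫⁻ x, ‖φ' n x‖ₑ ^ 6 ∂(cubeMeasure d) ≤
      ENNReal.ofReal (C * ‖(memLp_test (φ' n) 2).toLp‖ ^ 2 *
        (∑ i, ‖(memLp_partialDeriv (φ' n) i 2).toLp‖ ^ 2) ^ 2) := by
    intro n
    refine (hC (φ' n)).trans (le_of_eq ?_)
    rw [ENNReal.ofReal_mul (by positivity), ENNReal.ofReal_mul (by positivity),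
      ENNReal.ofReal_pow (Finset.sum_nonneg fun _ _ => by positivity),
      ENNReal.ofReal_sum_of_nonneg fun _ _ => by positivity]
    simp_rw [← lintegral_enorm_sq_eq]
    congr 1
    · congr 1
      · simp
      · refine lintegral_congr_ae ?_
        filter_upwards [(memLp_test (φ' n) 2).coeFn_toLp] with x hx
        rw [hx]
    · congr 1
      refine Finset.sum_congr rfl fun i _ => lintegral_congr_ae ?_
      filter_upwards [(memLp_partialDeriv (φ' n) i 2).coeFn_toLp] with x hx
      rw [hx]
  have hlim : Tendsto (fun n => ENNReal.ofReal (C * ‖(memLp_test (φ' n) 2).toLp‖ ^ 2 *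
        (∑ i, ‖(memLp_partialDeriv (φ' n) i 2).toLp‖ ^ 2) ^ 2)) atTop
      (𝓝 (ENNReal.ofReal (C * ‖w‖ ^ 2 * (∑ i, ‖g i‖ ^ 2) ^ 2))) := by
    refine ENNReal.tendsto_ofReal (((h1'.norm.pow 2).const_mul _).mul
      ((tendsto_finsetSum _ fun i _ => (h2' i).norm.pow 2).pow 2))
  calc ∫⁻ x, ‖w x‖ₑ ^ 6 ∂(cubeMeasure d)
      = ∫⁻ x, liminf (fun n => ‖φ' n x‖ₑ ^ 6) atTop ∂(cubeMeasure d) := by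
        refine lintegral_congr_ae ?_
        filter_upwards [hae] with x hx
        exact (ENNReal.Tendsto.pow hx.enorm).liminf_eq.symm
    _ ≤ liminf (fun n => ∫⁻ x, ‖φ' n x‖ₑ ^ 6 ∂(cubeMeasure d)) atTop := by
        refine lintegral_liminf_le fun n => ?_
        have := (φ' n).continuous.measurable
        fun_prop
    _ ≤ _ := by
        rw [← hlim.liminf_eq]
        exact liminf_le_liminf (Eventually.of_forall hbound)

end Gradient

/-! ### Isometric coordinates on `U_N`. -/

section Coordinates

variable {d : ℕ} (e : HilbertBasis ℕ ℝ (L2 d)) (N : ℕ)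

/-- The element of `U_N` with given coordinates. -/
noncomputable def embed : EuclideanSpace ℝ (Fin N) →ₗ[ℝ] L2 d where
  toFun x := ∑ i : Fin N, x i • e i
  map_add' x y := by simp [add_smul, Finset.sum_add_distrib]
  map_smul' c x := by simp [mul_smul, Finset.smul_sum]

/-- The first `N` coordinates of an element of `L²`. -/
noncomputable def coords : L2 d →L[ℝ] EuclideanSpace ℝ (Fin N) :=
  (PiLp.continuousLinearEquiv 2 ℝ (fun _ : Fin N => ℝ)).symm.toContinuousLinearMap ∘L
    ContinuousLinearMap.pi fun i : Fin N => innerSL ℝ (e i)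

/-- Pointwise values of the element of `U_N` with given coordinates. -/
noncomputable def evalCoord (x : EuclideanSpace ℝ (Fin N)) (y : EuclideanSpace ℝ (Fin d)) : ℝ :=
  ∑ i : Fin N, x i * e i y

variable {e N}

lemma embed_apply (x : EuclideanSpace ℝ (Fin N)) : embed e N x = ∑ i : Fin N, x i • e i := rfl

lemma coords_apply (w : L2 d) (i : Fin N) : coords e N w i = inner ℝ (e i) w := rfl

lemma inner_basis_embed (x : EuclideanSpace ℝ (Fin N)) (i : Fin N) :
    inner ℝ (e i) (embed e N x) = x i := by
  classical
  rw [embed_apply, inner_sum]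
  simp_rw [inner_smul_right, orthonormal_iff_ite.1 e.orthonormal, Fin.val_inj]
  simp

lemma inner_basis_embed_of_le (x : EuclideanSpace ℝ (Fin N)) {k : ℕ} (hk : N ≤ k) :
    inner ℝ (e k) (embed e N x) = 0 := by
  rw [embed_apply, inner_sum]
  refine Finset.sum_eq_zero fun i _ => ?_
  rw [inner_smul_right, e.orthonormal.inner_eq_zero (by have := i.2; omega), mul_zero]

lemma coords_embed (x : EuclideanSpace ℝ (Fin N)) : coords e N (embed e N x) = x := by
  ext i
  rw [coords_apply, inner_basis_embed]

lemma inner_embed (x : EuclideanSpace ℝ (Fin N)) (w : L2 d) :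
    inner ℝ (embed e N x) w = inner ℝ x (coords e N w) := by
  rw [embed_apply, sum_inner, PiLp.inner_apply]
  simp [inner_smul_left, coords_apply, mul_comm]

lemma norm_embed (x : EuclideanSpace ℝ (Fin N)) : ‖embed e N x‖ = ‖x‖ := by
  have h : ‖embed e N x‖ ^ 2 = ‖x‖ ^ 2 := by
    rw [← real_inner_self_eq_norm_sq, inner_embed, coords_embed, real_inner_self_eq_norm_sq]
  exact (sq_eq_sq₀ (norm_nonneg _) (norm_nonneg _)).1 h

lemma embed_injective : Function.Injective (embed e N) := fun x y h => by
  rw [← coords_embed (e := e) x, h, coords_embed]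

/-- Replaces the class in `L²` by a representative that is linear in `x` at every point, so that
polynomial identities can be used pointwise under the integral. -/
lemma coeFn_embed (x : EuclideanSpace ℝ (Fin N)) :
    embed e N x =ᵐ[cubeMeasure d] evalCoord e N x := by
  have h1 : ⇑(embed e N x) =ᵐ[cubeMeasure d] ∑ i : Fin N, ⇑(x i • e i : L2 d) := by
    rw [embed_apply]
    exact Lp.coeFn_fun_finsetSum _ _ |>.trans (by simp [Finset.sum_fn])
  have h2 : ∀ᵐ y ∂(cubeMeasure d), ∀ i : Fin N, (x i • e i : L2 d) y = x i * e i y := by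
    rw [ae_all_iff]
    intro i
    filter_upwards [Lp.coeFn_smul (x i) (e i)] with y hy
    rw [hy]; rfl
  filter_upwards [h1, h2] with y hy1 hy2
  rw [hy1, Finset.sum_apply, evalCoord]
  exact Finset.sum_congr rfl fun i _ => hy2 i

lemma evalCoord_add (x w : EuclideanSpace ℝ (Fin N)) (y : EuclideanSpace ℝ (Fin d)) :
    evalCoord e N (x + w) y = evalCoord e N x y + evalCoord e N w y := by
  simp [evalCoord, add_mul, Finset.sum_add_distrib]

lemma evalCoord_smul (c : ℝ) (x : EuclideanSpace ℝ (Fin N)) (y : EuclideanSpace ℝ (Fin d)) :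
    evalCoord e N (c • x) y = c * evalCoord e N x y := by
  simp [evalCoord, Finset.mul_sum, mul_assoc]

lemma evalCoord_sub (x w : EuclideanSpace ℝ (Fin N)) (y : EuclideanSpace ℝ (Fin d)) :
    evalCoord e N (x - w) y = evalCoord e N x y - evalCoord e N w y := by
  simp [evalCoord, sub_mul, Finset.sum_sub_distrib]

lemma evalCoord_single (i : Fin N) (y : EuclideanSpace ℝ (Fin d)) :
    evalCoord e N (EuclideanSpace.single i 1) y = e i y := by
  simp [evalCoord]

lemma galerkinProj_eq (g : EuclideanSpace ℝ (Fin d) → ℝ) :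
    galerkinProj e N g =
      embed e N (WithLp.toLp 2 fun i : Fin N => ∫ x, g x * e i x ∂(cubeMeasure d)) := by
  rw [galerkinProj, Finset.sum_range]
  rfl

lemma galerkinProj_coe (w : L2 d) : galerkinProj e N w = embed e N (coords e N w) := by
  rw [galerkinProj_eq]
  congr 1

lemma galerkinLaplacian_embed (lam : ℕ → ℝ) (x : EuclideanSpace ℝ (Fin N)) :
    galerkinLaplacian e lam N (embed e N x) =
      embed e N (WithLp.toLp 2 fun i : Fin N => -(lam i * x i)) := by
  rw [galerkinLaplacian, Finset.sum_range, ← Finset.sum_neg_distrib]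
  refine (Finset.sum_congr rfl fun i _ => ?_).trans (embed_apply _).symm
  rw [real_inner_comm, inner_basis_embed, neg_smul]

lemma mem_galerkinSpace_iff {w : L2 d} : w ∈ galerkinSpace e N ↔ ∃ x, embed e N x = w := by
  constructor
  · intro hw
    have : galerkinSpace e N ≤ LinearMap.range (embed e N) := by
      refine Submodule.span_le.2 ?_
      rintro _ ⟨k, hk, rfl⟩
      refine ⟨EuclideanSpace.single ⟨k, hk⟩ 1, ?_⟩
      rw [embed_apply]
      simp [ite_smul]
    exact this hw
  · rintro ⟨x, rfl⟩
    rw [embed_apply]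
    exact Submodule.sum_mem _ fun i _ =>
      Submodule.smul_mem _ _ (Submodule.subset_span ⟨i, i.2, rfl⟩)

lemma hdotOneNormSq_embed (lam : ℕ → ℝ) (x : EuclideanSpace ℝ (Fin N)) :
    hdotOneNormSq e lam (embed e N x) = ∑ i : Fin N, lam i * x i ^ 2 := by
  rw [hdotOneNormSq, tsum_eq_sum (s := Finset.range N), Finset.sum_range]
  · refine Finset.sum_congr rfl fun i _ => ?_
    rw [real_inner_comm, inner_basis_embed]
  · intro k hk
    rw [real_inner_comm, inner_basis_embed_of_le _ (by simpa using hk)]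
    simp

end Coordinates

/-! ### Dirichlet energy and sixth-power integrability in `U_N`. -/

section Eigen

variable {d : ℕ} {e : HilbertBasis ℕ ℝ (L2 d)} {lam : ℕ → ℝ}

/-- The elements of `U_N` lie in `H¹₀`, and their Dirichlet energy is their squared `Ḣ¹` norm. -/
lemma IsDirichletEigenbasis.exists_gradient_embed (he : IsDirichletEigenbasis e lam) {N : ℕ}
    (x : EuclideanSpace ℝ (Fin N)) :
    ∃ g : Fin d → L2 d, HasH10Gradient (embed e N x) g ∧
      ∑ i, ‖g i‖ ^ 2 = ∑ k : Fin N, lam k * x k ^ 2 := by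
  choose g hg heig using he.eigen
  have h1 : HasH10Gradient (embed e N x) (fun i => ∑ k : Fin N, x k • g k i) := by
    rw [embed_apply]
    exact HasH10Gradient.sum Finset.univ (w := fun k : Fin N => e k) (g := fun k : Fin N => g k)
      (fun k => hg k) fun k => x k
  refine ⟨_, h1, ?_⟩
  -- Each eigenvalue equation is tested against the whole sum; orthonormality in `L²` then
  -- diagonalizes the energy.
  have h2 := fun k : Fin N => sum_inner_gradient_eq (heig k) h1
  simp_rw [inner_basis_embed] at h2
  calc ∑ i, ‖∑ k : Fin N, x k • g k i‖ ^ 2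
      = ∑ i, ∑ k : Fin N, x k * inner ℝ (g k i) (∑ k : Fin N, x k • g k i) := by
        refine Finset.sum_congr rfl fun i _ => ?_
        rw [← real_inner_self_eq_norm_sq, sum_inner]
        simp_rw [inner_smul_left]
        rfl
    _ = ∑ k : Fin N, x k * ∑ i, inner ℝ (g k i) (∑ k : Fin N, x k • g k i) := by
        rw [Finset.sum_comm]
        simp_rw [Finset.mul_sum]
    _ = _ := Finset.sum_congr rfl fun k _ => by rw [h2]; ring

/-- Testing the eigenvalue equation with the eigenfunction itself shows that the eigenvalue is a
Dirichlet energy. -/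
lemma IsDirichletEigenbasis.lam_nonneg (he : IsDirichletEigenbasis e lam) (k : ℕ) : 0 ≤ lam k := by
  obtain ⟨g, hg, heig⟩ := he.eigen k
  have h := sum_inner_gradient_eq heig hg
  rw [real_inner_self_eq_norm_sq, e.orthonormal.1 k] at h
  simp_rw [real_inner_self_eq_norm_sq] at h
  have : 0 ≤ ∑ i, ‖g i‖ ^ 2 := Finset.sum_nonneg fun _ _ => by positivity
  linarith

/-- A Gagliardo–Nirenberg inequality in `U_N`, uniform in `N`. -/
lemma IsDirichletEigenbasis.exists_lintegral_pow_six_embed_le (he : IsDirichletEigenbasis e lam)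
    (hd : d = 1 ∨ d = 2) :
    ∃ C : ℝ≥0, ∀ (N : ℕ) (x : EuclideanSpace ℝ (Fin N)),
      ∫⁻ y, ‖embed e N x y‖ₑ ^ 6 ∂(cubeMeasure d) ≤
        ENNReal.ofReal (C * ‖x‖ ^ 2 * (∑ k : Fin N, lam k * x k ^ 2) ^ 2) := by
  obtain ⟨C, hC⟩ := exists_lintegral_pow_six_le hd
  refine ⟨C, fun N x => ?_⟩
  obtain ⟨g, hg, hsum⟩ := he.exists_gradient_embed x
  have := hC _ _ hg
  rwa [hsum, norm_embed] at this

lemma eLpNorm_six_pow {X : Type*} [MeasurableSpace X] (μ : Measure X) (f : X → ℝ) :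
    eLpNorm f 6 μ ^ 6 = ∫⁻ x, ‖f x‖ₑ ^ 6 ∂μ := by
  have := eLpNorm_nnreal_pow_eq_lintegral (μ := μ) (f := f) (p := 6) (by norm_num)
  simpa using this

lemma IsDirichletEigenbasis.memLp_six_embed (he : IsDirichletEigenbasis e lam)
    (hd : d = 1 ∨ d = 2) {N : ℕ} (x : EuclideanSpace ℝ (Fin N)) :
    MemLp (embed e N x) 6 (cubeMeasure d) := by
  obtain ⟨C, hC⟩ := he.exists_lintegral_pow_six_embed_le hd
  refine ⟨(Lp.memLp _).1, ?_⟩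
  have h1 := (hC N x).trans_lt ENNReal.ofReal_lt_top
  rw [← eLpNorm_six_pow] at h1
  exact (ENNReal.pow_lt_top_iff.1 h1).resolve_right (by norm_num)

/-- Beyond orthonormality and `lam_nonneg`, this is all that solvability and energy conservation
need to know about the eigenfunctions. -/
lemma IsDirichletEigenbasis.memLp_six (he : IsDirichletEigenbasis e lam)
    (hd : d = 1 ∨ d = 2) (k : ℕ) : MemLp (e k) 6 (cubeMeasure d) := by
  have h := he.memLp_six_embed hd (EuclideanSpace.single (⟨k, by omega⟩ : Fin (k + 1)) 1)
  refine (memLp_congr_ae (coeFn_embed _)).1 h |>.ae_eq (Eventually.of_forall fun y => ?_)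
  rw [evalCoord_single]

end Eigen

/-! ### Integrals of functions of quartic growth of elements of `U_N`, finite and continuous because
the `e k` lie in `L⁴`. -/

section Growth

/-- Continuous functions of three real variables with growth of order at most `n`. -/
structure HasGrowth (n : ℕ) (q : ℝ × ℝ × ℝ → ℝ) : Prop where
  continuous : Continuous q
  bound : ∃ C : ℝ, 0 ≤ C ∧ ∀ p, |q p| ≤ C * (1 + ‖p‖) ^ n

namespace HasGrowth

variable {m n : ℕ} {q r : ℝ × ℝ × ℝ → ℝ}

lemma mono (h : HasGrowth m q) (hmn : m ≤ n) : HasGrowth n q := by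
  obtain ⟨C, hC, hb⟩ := h.bound
  refine ⟨h.continuous, C, hC, fun p => (hb p).trans ?_⟩
  have : (1 : ℝ) ≤ 1 + ‖p‖ := by linarith [norm_nonneg p]
  gcongr

lemma const (n : ℕ) (c : ℝ) : HasGrowth n fun _ => c := by
  refine ⟨continuous_const, |c|, abs_nonneg _, fun p => ?_⟩
  have : (1 : ℝ) ≤ (1 + ‖p‖) ^ n := one_le_pow₀ (by linarith [norm_nonneg p])
  nlinarith [abs_nonneg c]

lemma fst : HasGrowth 1 fun p => p.1 :=
  ⟨by fun_prop, 1, zero_le_one, fun p => by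
    have : ‖p.1‖ ≤ ‖p‖ := norm_fst_le p
    rw [Real.norm_eq_abs] at this
    linarith⟩

lemma snd : HasGrowth 1 fun p => p.2.1 :=
  ⟨by fun_prop, 1, zero_le_one, fun p => by
    have : ‖p.2.1‖ ≤ ‖p‖ := (norm_fst_le p.2).trans (norm_snd_le p)
    rw [Real.norm_eq_abs] at this
    linarith⟩

lemma trd : HasGrowth 1 fun p => p.2.2 :=
  ⟨by fun_prop, 1, zero_le_one, fun p => by
    have : ‖p.2.2‖ ≤ ‖p‖ := (norm_snd_le p.2).trans (norm_snd_le p)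
    rw [Real.norm_eq_abs] at this
    linarith⟩

lemma add (hq : HasGrowth n q) (hr : HasGrowth n r) : HasGrowth n fun p => q p + r p := by
  obtain ⟨C, hC, hb⟩ := hq.bound
  obtain ⟨D, hD, hb'⟩ := hr.bound
  refine ⟨hq.continuous.add hr.continuous, C + D, by positivity, fun p => ?_⟩
  refine (abs_add_le _ _).trans ?_
  rw [add_mul]
  exact add_le_add (hb p) (hb' p)

lemma mul (hq : HasGrowth m q) (hr : HasGrowth n r) (s : ℕ) (hs : m + n ≤ s) :
    HasGrowth s fun p => q p * r p := by
  refine HasGrowth.mono ?_ hs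
  obtain ⟨C, hC, hb⟩ := hq.bound
  obtain ⟨D, hD, hb'⟩ := hr.bound
  refine ⟨hq.continuous.mul hr.continuous, C * D, by positivity, fun p => ?_⟩
  rw [abs_mul, pow_add]
  calc |q p| * |r p| ≤ (C * (1 + ‖p‖) ^ m) * (D * (1 + ‖p‖) ^ n) := by
        gcongr
        · exact hb p
        · exact hb' p
    _ = _ := by ring

lemma const_mul (c : ℝ) (hq : HasGrowth n q) : HasGrowth n fun p => c * q p :=
  (const 0 c).mul hq n (by simp)

lemma pow (hq : HasGrowth 1 q) (k : ℕ) : HasGrowth k fun p => q p ^ k := by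
  induction k with
  | zero => simpa using const 0 1
  | succ k ih =>
    simp_rw [pow_succ]
    exact ih.mul hq _ le_rfl

end HasGrowth

variable {d : ℕ} {e : HilbertBasis ℕ ℝ (L2 d)} {lam : ℕ → ℝ} {N : ℕ}

lemma measurable_evalCoord (x : EuclideanSpace ℝ (Fin N)) : Measurable (evalCoord e N x) := by
  have : ∀ i : Fin N, Measurable (e i : EuclideanSpace ℝ (Fin d) → ℝ) :=
    fun i => (Lp.stronglyMeasurable _).measurable
  unfold evalCoord
  fun_prop

lemma abs_evalCoord_le (x : EuclideanSpace ℝ (Fin N)) (y : EuclideanSpace ℝ (Fin d)) :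
    |evalCoord e N x y| ≤ ‖x‖ * ∑ i : Fin N, |e i y| := by
  rw [evalCoord, Finset.mul_sum]
  refine (Finset.abs_sum_le_sum_abs _ _).trans (Finset.sum_le_sum fun i _ => ?_)
  rw [abs_mul]
  gcongr
  exact PiLp.norm_apply_le x i

/-- The values at a point of three elements of `U_N`. -/
noncomputable def evalTriple (e : HilbertBasis ℕ ℝ (L2 d)) (N : ℕ)
    (p : EuclideanSpace ℝ (Fin N) × EuclideanSpace ℝ (Fin N) × EuclideanSpace ℝ (Fin N))
    (y : EuclideanSpace ℝ (Fin d)) : ℝ × ℝ × ℝ :=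
  (evalCoord e N p.1 y, evalCoord e N p.2.1 y, evalCoord e N p.2.2 y)

lemma measurable_evalTriple
    (p : EuclideanSpace ℝ (Fin N) × EuclideanSpace ℝ (Fin N) × EuclideanSpace ℝ (Fin N)) :
    Measurable (evalTriple e N p) :=
  (measurable_evalCoord _).prodMk ((measurable_evalCoord _).prodMk (measurable_evalCoord _))

lemma norm_evalTriple_le
    (p : EuclideanSpace ℝ (Fin N) × EuclideanSpace ℝ (Fin N) × EuclideanSpace ℝ (Fin N))
    (y : EuclideanSpace ℝ (Fin d)) :
    ‖evalTriple e N p y‖ ≤ ‖p‖ * ∑ i : Fin N, |e i y| := by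
  have h0 : 0 ≤ ∑ i : Fin N, |e i y| := Finset.sum_nonneg fun _ _ => abs_nonneg _
  refine norm_prod_le_iff.2 ⟨?_, norm_prod_le_iff.2 ⟨?_, ?_⟩⟩
  · refine (abs_evalCoord_le _ _).trans ?_
    gcongr
    exact norm_fst_le p
  · refine (abs_evalCoord_le _ _).trans ?_
    gcongr
    exact (norm_fst_le p.2).trans (norm_snd_le p)
  · refine (abs_evalCoord_le _ _).trans ?_
    gcongr
    exact (norm_snd_le p.2).trans (norm_snd_le p)

lemma integrable_one_add_mul_pow {X : Type*} [MeasurableSpace X] {μ : Measure X}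
    [IsFiniteMeasure μ] {B : X → ℝ} (hB : MemLp B 4 μ) (R : ℝ) :
    Integrable (fun y => (1 + R * B y) ^ 4) μ := by
  have h1 : MemLp (fun y => 1 + R * B y) ((4 : ℕ) : ℝ≥0∞) μ := by
    rw [Nat.cast_ofNat]
    exact MemLp.add (memLp_const (1 : ℝ)) (hB.const_mul R)
  have h2 := h1.integrable_norm_pow (by norm_num)
  exact h2.congr (Eventually.of_forall fun y => Even.pow_abs (n := 4) (by decide) _)

lemma integrable_one_add_sum_pow (hL : ∀ k, MemLp (e k) 6 (cubeMeasure d)) (N : ℕ) (R : ℝ) :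
    Integrable (fun y => (1 + R * ∑ i : Fin N, |e i y|) ^ 4) (cubeMeasure d) := by
  have h0 : ∀ i : Fin N, MemLp (fun y => |e i y|) 4 (cubeMeasure d) := fun i =>
    MemLp.abs (MemLp.mono_exponent (hL i) (by norm_num))
  exact integrable_one_add_mul_pow (memLp_finsetSum Finset.univ fun i _ => h0 i) R

lemma HasGrowth.abs_comp_evalTriple_le {q : ℝ × ℝ × ℝ → ℝ} {C : ℝ} (hC : 0 ≤ C)
    (hb : ∀ p, |q p| ≤ C * (1 + ‖p‖) ^ 4) {R : ℝ}
    {p : EuclideanSpace ℝ (Fin N) × EuclideanSpace ℝ (Fin N) × EuclideanSpace ℝ (Fin N)}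
    (hp : ‖p‖ ≤ R) (y : EuclideanSpace ℝ (Fin d)) :
    ‖q (evalTriple e N p y)‖ ≤ C * (1 + R * ∑ i : Fin N, |e i y|) ^ 4 := by
  have h0 : 0 ≤ ∑ i : Fin N, |e i y| := Finset.sum_nonneg fun _ _ => abs_nonneg _
  refine (hb _).trans ?_
  gcongr
  exact (norm_evalTriple_le p y).trans (by gcongr)

lemma HasGrowth.integrable (hL : ∀ k, MemLp (e k) 6 (cubeMeasure d)) {q : ℝ × ℝ × ℝ → ℝ}
    (hq : HasGrowth 4 q)
    (p : EuclideanSpace ℝ (Fin N) × EuclideanSpace ℝ (Fin N) × EuclideanSpace ℝ (Fin N)) :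
    Integrable (fun y => q (evalTriple e N p y)) (cubeMeasure d) := by
  obtain ⟨C, hC, hb⟩ := hq.bound
  refine ((integrable_one_add_sum_pow hL N ‖p‖).const_mul C).mono'
    (hq.continuous.measurable.comp (measurable_evalTriple p)).aestronglyMeasurable
    (Eventually.of_forall fun y => HasGrowth.abs_comp_evalTriple_le hC hb le_rfl y)

lemma HasGrowth.continuous_integral (hL : ∀ k, MemLp (e k) 6 (cubeMeasure d))
    {q : ℝ × ℝ × ℝ → ℝ} (hq : HasGrowth 4 q) :
    Continuous fun p : EuclideanSpace ℝ (Fin N) × EuclideanSpace ℝ (Fin N) ×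
      EuclideanSpace ℝ (Fin N) => ∫ y, q (evalTriple e N p y) ∂(cubeMeasure d) := by
  obtain ⟨C, hC, hb⟩ := hq.bound
  rw [continuous_iff_continuousAt]
  intro p₀
  refine continuousAt_of_dominated (bound := fun y =>
    C * (1 + (‖p₀‖ + 1) * ∑ i : Fin N, |e i y|) ^ 4) ?_ ?_ ?_ ?_
  · exact Eventually.of_forall fun p =>
      (hq.continuous.measurable.comp (measurable_evalTriple p)).aestronglyMeasurable
  · have : ∀ᶠ p in 𝓝 p₀, ‖p‖ < ‖p₀‖ + 1 :=
      continuous_norm.continuousAt.eventually_lt continuousAt_const (by simp)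
    filter_upwards [this] with p hp
    exact Eventually.of_forall fun y => HasGrowth.abs_comp_evalTriple_le hC hb hp.le y
  · exact (integrable_one_add_sum_pow hL N _).const_mul C
  · refine Eventually.of_forall fun y => Continuous.continuousAt (hq.continuous.comp ?_)
    unfold evalTriple evalCoord
    fun_prop

lemma integral_evalCoord_sq (x : EuclideanSpace ℝ (Fin N)) :
    ∫ y, evalCoord e N x y ^ 2 ∂(cubeMeasure d) = ‖x‖ ^ 2 := by
  rw [← norm_embed (e := e), ← real_inner_self_eq_norm_sq, inner_eq_integral]
  refine integral_congr_ae ?_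
  filter_upwards [coeFn_embed (e := e) x] with y hy
  rw [hy]; ring

end Growth

/-! ### Algebra of the averaged cubic. -/

section Cubic

/-- The average of the cubic over the segment from `a` to `a + b`. -/
noncomputable def cubicAvg (c₀ c₁ c₂ c₃ a b : ℝ) : ℝ :=
  c₃ * (a ^ 3 + 3 / 2 * a ^ 2 * b + a * b ^ 2 + b ^ 3 / 4) + c₂ * (a ^ 2 + a * b + b ^ 2 / 3) +
    c₁ * (a + b / 2) + c₀

/-- The primitive in `b` of `cubicAvg`. -/
noncomputable def cubicAvgPrim (c₀ c₁ c₂ c₃ a b : ℝ) : ℝ :=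
  c₃ * (a ^ 3 * b + 3 / 4 * a ^ 2 * b ^ 2 + a * b ^ 3 / 3 + b ^ 4 / 16) +
    c₂ * (a ^ 2 * b + a * b ^ 2 / 2 + b ^ 3 / 9) + c₁ * (a * b + b ^ 2 / 4) + c₀ * b

variable (c₀ c₁ c₂ c₃ : ℝ)

lemma integral_cubic (a b : ℝ) :
    ∫ y in a..b, cubic c₀ c₁ c₂ c₃ y =
      (c₃ * b ^ 4 / 4 + c₂ * b ^ 3 / 3 + c₁ * b ^ 2 / 2 + c₀ * b) -
      (c₃ * a ^ 4 / 4 + c₂ * a ^ 3 / 3 + c₁ * a ^ 2 / 2 + c₀ * a) := by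
  refine intervalIntegral.integral_eq_sub_of_hasDerivAt
    (f := fun z => c₃ * z ^ 4 / 4 + c₂ * z ^ 3 / 3 + c₁ * z ^ 2 / 2 + c₀ * z) (fun x _ => ?_)
    (Continuous.intervalIntegrable (by unfold cubic; fun_prop) _ _)
  have h := (((((hasDerivAt_pow 4 x).const_mul c₃).div_const 4).add
    (((hasDerivAt_pow 3 x).const_mul c₂).div_const 3)).add
    (((hasDerivAt_pow 2 x).const_mul c₁).div_const 2)).add ((hasDerivAt_id x).const_mul c₀)
  refine h.congr_deriv ?_
  simp only [cubic]
  norm_num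
  ring

lemma primitive_cubic (z : ℝ) :
    primitive (cubic c₀ c₁ c₂ c₃) z = c₃ * z ^ 4 / 4 + c₂ * z ^ 3 / 3 + c₁ * z ^ 2 / 2 + c₀ * z := by
  rw [primitive, integral_cubic]
  ring

lemma integral_cubic_segment (a b : ℝ) :
    ∫ θ in (0 : ℝ)..1, cubic c₀ c₁ c₂ c₃ (a + θ * b) = cubicAvg c₀ c₁ c₂ c₃ a b := by
  -- Along the segment the cubic is a cubic in `θ` with the Taylor coefficients at `a`, so
  -- `integral_cubic` applies.
  have h : ∀ θ : ℝ, cubic c₀ c₁ c₂ c₃ (a + θ * b) =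
      cubic (cubic c₀ c₁ c₂ c₃ a) ((3 * c₃ * a ^ 2 + 2 * c₂ * a + c₁) * b)
        ((3 * c₃ * a + c₂) * b ^ 2) (c₃ * b ^ 3) θ := by
    intro θ; simp only [cubic]; ring
  simp_rw [h]
  rw [integral_cubic]
  simp only [cubic, cubicAvg]
  ring

/-- The discrete gradient identity, the source of exact energy conservation. -/
lemma mul_cubicAvg (a b : ℝ) :
    cubicAvg c₀ c₁ c₂ c₃ a b * b = primitive (cubic c₀ c₁ c₂ c₃) (a + b) -
      primitive (cubic c₀ c₁ c₂ c₃) a := by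
  simp only [primitive_cubic, cubicAvg]
  ring

variable {c₃}

/-- A lower bound for the derivative of the cubic. -/
noncomputable def cubicSlope (c₁ c₂ c₃ : ℝ) : ℝ := c₂ ^ 2 / (3 * c₃) + |c₁|

lemma cubicSlope_nonneg (hc₃ : 0 < c₃) : 0 ≤ cubicSlope c₁ c₂ c₃ := by
  unfold cubicSlope; positivity

/-- Completing the square gives `f' ≥ -cubicSlope`. The derivative of the average in `b` is the
integral of `θ f' (a + θ b)` over `[0, 1]`, whence the factor `1/2`. The proof replaces this by an
explicit sum of squares. -/
lemma cubicAvg_monotone (hc₃ : 0 < c₃) (a b b' : ℝ) :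
    -(cubicSlope c₁ c₂ c₃ / 2) * (b - b') ^ 2 ≤
      (cubicAvg c₀ c₁ c₂ c₃ a b - cubicAvg c₀ c₁ c₂ c₃ a b') * (b - b') := by
  set D := c₂ / c₃ with hD
  have hc₂ : c₂ = c₃ * D := by rw [hD]; field_simp
  have hK : cubicSlope c₁ c₂ c₃ = c₃ * D ^ 2 / 3 + |c₁| := by
    rw [cubicSlope, hc₂]; field_simp
  have hc : 0 ≤ c₁ + |c₁| := by linarith [neg_abs_le c₁]
  have key : (cubicAvg c₀ c₁ c₂ c₃ a b - cubicAvg c₀ c₁ c₂ c₃ a b') * (b - b') +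
      cubicSlope c₁ c₂ c₃ / 2 * (b - b') ^ 2 = (b - b') ^ 2 / 2 * (c₃ *
        (3 * (a + (b + b') / 3 + D / 3) ^ 2 + (b + b') ^ 2 / 24 + (b - b') ^ 2 / 8) +
          (c₁ + |c₁|)) := by
    rw [hK, hc₂]; simp only [cubicAvg]; ring
  have : 0 ≤ (b - b') ^ 2 / 2 * (c₃ *
        (3 * (a + (b + b') / 3 + D / 3) ^ 2 + (b + b') ^ 2 / 24 + (b - b') ^ 2 / 8) +
          (c₁ + |c₁|)) := by positivity
  linarith

/-- The integrated form of `cubicAvg_monotone`, a convexity bound at `b = 0` up to a quadratic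
error. It yields coercivity. -/
lemma le_cubicAvgPrim (hc₃ : 0 < c₃) (a b : ℝ) :
    cubic c₀ c₁ c₂ c₃ a * b - cubicSlope c₁ c₂ c₃ / 4 * b ^ 2 ≤
      cubicAvgPrim c₀ c₁ c₂ c₃ a b := by
  set D := c₂ / c₃ with hD
  have hc₂ : c₂ = c₃ * D := by rw [hD]; field_simp
  have hK : cubicSlope c₁ c₂ c₃ = c₃ * D ^ 2 / 3 + |c₁| := by
    rw [cubicSlope, hc₂]; field_simp
  have hc : 0 ≤ c₁ + |c₁| := by linarith [neg_abs_le c₁]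
  have key : cubicAvgPrim c₀ c₁ c₂ c₃ a b -
      (cubic c₀ c₁ c₂ c₃ a * b - cubicSlope c₁ c₂ c₃ / 4 * b ^ 2) = b ^ 2 / 4 * (c₃ *
        (3 * (a + 2 * b / 9 + D / 3) ^ 2 + 11 / 108 * b ^ 2) + (c₁ + |c₁|)) := by
    rw [hK, hc₂]; simp only [cubicAvgPrim, cubic]; ring
  have : 0 ≤ b ^ 2 / 4 * (c₃ *
        (3 * (a + 2 * b / 9 + D / 3) ^ 2 + 11 / 108 * b ^ 2) + (c₁ + |c₁|)) := by positivity
  linarith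

variable (c₃)

/-- An exact Taylor expansion in `t`: the linear coefficient is the first variation, and of the
others only integrability matters. -/
lemma cubicAvgPrim_add (a b c t : ℝ) :
    cubicAvgPrim c₀ c₁ c₂ c₃ a (b + t * c) = cubicAvgPrim c₀ c₁ c₂ c₃ a b +
      t * (cubicAvg c₀ c₁ c₂ c₃ a b * c) +
      t ^ 2 * (c₃ * (3 / 4 * a ^ 2 * c ^ 2 + a * b * c ^ 2 + 3 / 8 * b ^ 2 * c ^ 2) +
        c₂ * (a * c ^ 2 / 2 + b * c ^ 2 / 3) + c₁ * (c ^ 2 / 4)) +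
      t ^ 3 * (c₃ * (a * c ^ 3 / 3 + b * c ^ 3 / 4) + c₂ * (c ^ 3 / 9)) +
      t ^ 4 * (c₃ * (c ^ 4 / 16)) := by
  simp only [cubicAvgPrim, cubicAvg]
  ring

lemma hasGrowth_monomial (i j k : ℕ) (h : i + j + k ≤ 4) (c : ℝ) :
    HasGrowth 4 fun p => c * (p.1 ^ i * p.2.1 ^ j * p.2.2 ^ k) :=
  ((((HasGrowth.fst.pow i).mul (HasGrowth.snd.pow j) _ le_rfl).mul (HasGrowth.trd.pow k) _ h)
    ).const_mul c

end Cubic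

/-! ### The implicit step in coordinates and its variational structure. -/

section AVF

variable {d : ℕ} {e : HilbertBasis ℕ ℝ (L2 d)} {lam : ℕ → ℝ} {N : ℕ} {c₀ c₁ c₂ c₃ : ℝ}

lemma HasGrowth.congr {n : ℕ} {q r : ℝ × ℝ × ℝ → ℝ} (h : HasGrowth n q) (hqr : ∀ p, q p = r p) :
    HasGrowth n r := by
  rwa [← funext hqr]

/-- Multiplication of the coordinates by the eigenvalues. -/
noncomputable def diagLam (lam : ℕ → ℝ) (N : ℕ) :
    EuclideanSpace ℝ (Fin N) →ₗ[ℝ] EuclideanSpace ℝ (Fin N) where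
  toFun x := WithLp.toLp 2 fun i : Fin N => lam i * x i
  map_add' x y := by ext i; simp [mul_add]
  map_smul' c x := by ext i; simp [mul_left_comm]

lemma diagLam_apply (x : EuclideanSpace ℝ (Fin N)) (i : Fin N) :
    diagLam lam N x i = lam i * x i := rfl

lemma inner_diagLam (x y : EuclideanSpace ℝ (Fin N)) :
    inner ℝ (diagLam lam N x) y = ∑ i : Fin N, lam i * x i * y i := by
  rw [PiLp.inner_apply]
  simp [diagLam_apply, mul_comm]

lemma inner_diagLam_comm (x y : EuclideanSpace ℝ (Fin N)) :
    inner ℝ (diagLam lam N x) y = inner ℝ (diagLam lam N y) x := by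
  rw [inner_diagLam, inner_diagLam]
  exact Finset.sum_congr rfl fun i _ => by ring

lemma inner_diagLam_self_nonneg (hlam : ∀ k, 0 ≤ lam k) (x : EuclideanSpace ℝ (Fin N)) :
    0 ≤ inner ℝ (diagLam lam N x) x := by
  rw [inner_diagLam]
  refine Finset.sum_nonneg fun i _ => ?_
  rw [mul_assoc]
  exact mul_nonneg (hlam i) (mul_self_nonneg _)

/-- The coordinates of the projected averaged nonlinearity on the segment from `x` to `x + w`. -/
noncomputable def avgForce (e : HilbertBasis ℕ ℝ (L2 d)) (N : ℕ) (c₀ c₁ c₂ c₃ : ℝ)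
    (x w : EuclideanSpace ℝ (Fin N)) : EuclideanSpace ℝ (Fin N) :=
  WithLp.toLp 2 fun i : Fin N =>
    ∫ y, cubicAvg c₀ c₁ c₂ c₃ (evalCoord e N x y) (evalCoord e N w y) * e i y ∂(cubeMeasure d)

lemma hasGrowth_cubicAvg_mul :
    HasGrowth 4 fun p => cubicAvg c₀ c₁ c₂ c₃ p.1 p.2.1 * p.2.2 := by
  refine HasGrowth.congr
    (((((((((hasGrowth_monomial 3 0 1 (by norm_num) c₃).add
    (hasGrowth_monomial 2 1 1 (by norm_num) (c₃ * 3 / 2))).add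
    (hasGrowth_monomial 1 2 1 (by norm_num) c₃)).add
    (hasGrowth_monomial 0 3 1 (by norm_num) (c₃ / 4))).add
    (hasGrowth_monomial 2 0 1 (by norm_num) c₂)).add
    (hasGrowth_monomial 1 1 1 (by norm_num) c₂)).add
    (hasGrowth_monomial 0 2 1 (by norm_num) (c₂ / 3))).add
    ((hasGrowth_monomial 1 0 1 (by norm_num) c₁).add
    (hasGrowth_monomial 0 1 1 (by norm_num) (c₁ / 2)))).add
    (hasGrowth_monomial 0 0 1 (by norm_num) c₀)) fun p => ?_
  simp only [cubicAvg]
  ring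

lemma hasGrowth_cubicAvgPrim :
    HasGrowth 4 fun p => cubicAvgPrim c₀ c₁ c₂ c₃ p.1 p.2.1 := by
  refine HasGrowth.congr
    ((((((((((hasGrowth_monomial 3 1 0 (by norm_num) c₃).add
    (hasGrowth_monomial 2 2 0 (by norm_num) (c₃ * 3 / 4))).add
    (hasGrowth_monomial 1 3 0 (by norm_num) (c₃ / 3))).add
    (hasGrowth_monomial 0 4 0 (by norm_num) (c₃ / 16))).add
    (hasGrowth_monomial 2 1 0 (by norm_num) c₂)).add
    (hasGrowth_monomial 1 2 0 (by norm_num) (c₂ / 2))).add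
    (hasGrowth_monomial 0 3 0 (by norm_num) (c₂ / 9))).add
    (hasGrowth_monomial 1 1 0 (by norm_num) c₁)).add
    (hasGrowth_monomial 0 2 0 (by norm_num) (c₁ / 4))).add
    (hasGrowth_monomial 0 1 0 (by norm_num) c₀)) fun p => ?_
  simp only [cubicAvgPrim]
  ring

lemma hasGrowth_primitive : HasGrowth 4 fun p => primitive (cubic c₀ c₁ c₂ c₃) p.1 := by
  refine HasGrowth.congr
    ((((hasGrowth_monomial 4 0 0 (by norm_num) (c₃ / 4)).add
    (hasGrowth_monomial 3 0 0 (by norm_num) (c₂ / 3))).add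
    (hasGrowth_monomial 2 0 0 (by norm_num) (c₁ / 2))).add
    (hasGrowth_monomial 1 0 0 (by norm_num) c₀)) fun p => ?_
  rw [primitive_cubic]
  ring

lemma integrable_primitive_evalCoord (hL : ∀ k, MemLp (e k) 6 (cubeMeasure d))
    (x : EuclideanSpace ℝ (Fin N)) :
    Integrable (fun y => primitive (cubic c₀ c₁ c₂ c₃) (evalCoord e N x y)) (cubeMeasure d) :=
  hasGrowth_primitive.integrable hL (x, 0, 0)

lemma inner_avgForce (hL : ∀ k, MemLp (e k) 6 (cubeMeasure d)) (x w z : EuclideanSpace ℝ (Fin N)) :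
    inner ℝ (avgForce e N c₀ c₁ c₂ c₃ x w) z =
      ∫ y, cubicAvg c₀ c₁ c₂ c₃ (evalCoord e N x y) (evalCoord e N w y) * evalCoord e N z y
        ∂(cubeMeasure d) := by
  have hint : ∀ i : Fin N, Integrable (fun y => cubicAvg c₀ c₁ c₂ c₃ (evalCoord e N x y)
      (evalCoord e N w y) * e i y) (cubeMeasure d) := by
    intro i
    refine ((hasGrowth_cubicAvg_mul (c₀ := c₀) (c₁ := c₁) (c₂ := c₂) (c₃ := c₃)).integrable hL (x, w, EuclideanSpace.single i 1)).congr
      (Eventually.of_forall fun y => ?_)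
    simp only [evalTriple, evalCoord_single]
  rw [PiLp.inner_apply]
  calc ∑ i : Fin N, inner ℝ (avgForce e N c₀ c₁ c₂ c₃ x w i) (z i)
      = ∑ i : Fin N, ∫ y, z i * (cubicAvg c₀ c₁ c₂ c₃ (evalCoord e N x y)
          (evalCoord e N w y) * e i y) ∂(cubeMeasure d) := by
        refine Finset.sum_congr rfl fun i _ => ?_
        rw [integral_const_mul]
        rfl
    _ = _ := by
        rw [← integral_finsetSum _ fun i _ => (hint i).const_mul _]
        refine integral_congr_ae (Eventually.of_forall fun y => ?_)
        simp only [evalCoord, Finset.mul_sum]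
        exact Finset.sum_congr rfl fun i _ => by ring

lemma continuous_avgForce (hL : ∀ k, MemLp (e k) 6 (cubeMeasure d)) :
    Continuous fun p : EuclideanSpace ℝ (Fin N) × EuclideanSpace ℝ (Fin N) =>
      avgForce e N c₀ c₁ c₂ c₃ p.1 p.2 := by
  refine (PiLp.continuous_toLp 2 _).comp (continuous_pi fun i => ?_)
  have h := (hasGrowth_cubicAvg_mul (c₀ := c₀) (c₁ := c₁) (c₂ := c₂) (c₃ := c₃)).continuous_integral
    (N := N) hL
  have h2 : Continuous fun p : EuclideanSpace ℝ (Fin N) × EuclideanSpace ℝ (Fin N) =>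
    (p.1, p.2, (EuclideanSpace.single i 1 : EuclideanSpace ℝ (Fin N))) := by fun_prop
  refine (h.comp h2).congr fun p => ?_
  simp only [Function.comp, evalTriple, evalCoord_single]

lemma galerkinProj_avg (x x' : EuclideanSpace ℝ (Fin N)) :
    galerkinProj e N (fun y => ∫ θ in (0 : ℝ)..1, cubic c₀ c₁ c₂ c₃
      (embed e N x y + θ * (embed e N x' y - embed e N x y))) =
      embed e N (avgForce e N c₀ c₁ c₂ c₃ x (x' - x)) := by
  rw [galerkinProj_eq]
  congr 1
  ext i
  refine integral_congr_ae ?_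
  filter_upwards [coeFn_embed (e := e) x, coeFn_embed (e := e) x'] with y h1 h2
  rw [h1, h2, integral_cubic_segment, evalCoord_sub]

/-- The implicit step in coordinates. -/
def CoordStep (e : HilbertBasis ℕ ℝ (L2 d)) (lam : ℕ → ℝ) (N : ℕ) (c₀ c₁ c₂ c₃ h : ℝ)
    (p q : EuclideanSpace ℝ (Fin N) × EuclideanSpace ℝ (Fin N)) : Prop :=
  q.1 = p.1 + (h / 2) • (q.2 + p.2) ∧
  q.2 = p.2 - (h / 2) • diagLam lam N (q.1 + p.1) - h • avgForce e N c₀ c₁ c₂ c₃ p.1 (q.1 - p.1)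

lemma avfStep_embed_iff {h : ℝ} {x v x' v' : EuclideanSpace ℝ (Fin N)} :
    AVFStep e lam (cubic c₀ c₁ c₂ c₃) N h (embed e N x) (embed e N v) (embed e N x')
      (embed e N v') ↔ CoordStep e lam N c₀ c₁ c₂ c₃ h (x, v) (x', v') := by
  have h1 : embed e N x + h • ((1 / 2 : ℝ) • (embed e N v' + embed e N v)) =
      embed e N (x + (h / 2) • (v' + v)) := by
    simp only [map_add, map_smul, smul_smul]
    congr 2
    ring
  have h2 : embed e N v + h • galerkinLaplacian e lam N
        ((1 / 2 : ℝ) • (embed e N x' + embed e N x)) -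
      h • galerkinProj e N (fun y => ∫ θ in (0 : ℝ)..1, cubic c₀ c₁ c₂ c₃
        (embed e N x y + θ * (embed e N x' y - embed e N x y))) =
      embed e N (v - (h / 2) • diagLam lam N (x' + x) -
        h • avgForce e N c₀ c₁ c₂ c₃ x (x' - x)) := by
    rw [galerkinProj_avg, ← map_add, ← map_smul, galerkinLaplacian_embed, ← map_smul, ← map_smul,
      ← map_add, ← map_sub]
    congr 2
    ext i
    simp [diagLam_apply]
    ring
  constructor
  · rintro ⟨hp, hv⟩
    rw [h1] at hp
    rw [h2] at hv
    exact ⟨embed_injective hp, embed_injective hv⟩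
  · rintro ⟨hp, hv⟩
    simp only at hp hv
    refine ⟨?_, ?_⟩
    · rw [h1]; exact congrArg _ hp
    · rw [h2]; exact congrArg _ hv

lemma AVFStep.exists_embed {h : ℝ} {x v : EuclideanSpace ℝ (Fin N)} {u' v' : L2 d}
    {f : ℝ → ℝ} (hs : AVFStep e lam f N h (embed e N x) (embed e N v) u' v') :
    ∃ x' w', u' = embed e N x' ∧ v' = embed e N w' := by
  have hv : v' ∈ galerkinSpace e N := by
    rw [hs.velocity]
    have hmem : ∀ z, embed e N z ∈ galerkinSpace e N := fun z => mem_galerkinSpace_iff.2 ⟨z, rfl⟩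
    refine Submodule.sub_mem _ (Submodule.add_mem _ (hmem v) (Submodule.smul_mem _ _ ?_))
      (Submodule.smul_mem _ _ ?_)
    · refine Submodule.neg_mem _ (Submodule.sum_mem _ fun k hk => Submodule.smul_mem _ _ ?_)
      exact Submodule.subset_span ⟨k, Finset.mem_range.1 hk, rfl⟩
    · rw [galerkinProj_eq]
      exact hmem _
  obtain ⟨w', rfl⟩ := mem_galerkinSpace_iff.1 hv
  refine ⟨x + h • ((1 / 2 : ℝ) • (w' + v)), w', ?_, rfl⟩
  rw [hs.position]
  simp only [map_add, map_smul]

/-- The step equation for the increment `w` of the position. -/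
lemma coordStep_iff {h : ℝ} (hh : 0 < h) {x v x' v' : EuclideanSpace ℝ (Fin N)} :
    CoordStep e lam N c₀ c₁ c₂ c₃ h (x, v) (x', v') ↔
      v' = (2 / h) • (x' - x) - v ∧
      (2 / h) • (x' - x) - (2 : ℝ) • v + (h / 2) • diagLam lam N (x' - x) +
        h • diagLam lam N x + h • avgForce e N c₀ c₁ c₂ c₃ x (x' - x) = 0 := by
  have hne : h ≠ 0 := hh.ne'
  have e1 : x' = x + (h / 2) • (v' + v) ↔ v' = (2 / h) • (x' - x) - v := by
    constructor
    · intro hx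
      rw [hx, add_sub_cancel_left, smul_smul, show 2 / h * (h / 2) = 1 by field_simp, one_smul,
        add_sub_cancel_right]
    · intro hv
      rw [hv, sub_add_cancel, smul_smul, show h / 2 * (2 / h) = 1 by field_simp, one_smul,
        add_sub_cancel]
  have e2 : (h / 2) • diagLam lam N (x' + x) =
      (h / 2) • diagLam lam N (x' - x) + h • diagLam lam N x := by
    simp only [map_add, map_sub]
    module
  constructor
  · rintro ⟨h1, h2⟩
    simp only at h1 h2
    refine ⟨e1.1 h1, ?_⟩
    rw [e2] at h2
    have h3 := e1.1 h1
    rw [h2] at h3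
    have h4 := sub_eq_zero.2 h3.symm
    rw [← h4]
    module
  · rintro ⟨h1, h2⟩
    refine ⟨e1.2 h1, ?_⟩
    simp only
    rw [e2, ← sub_eq_zero, ← h2]
    nth_rewrite 1 [h1]
    module

/-- Fermat's rule at `t = 0`. It gives the Euler–Lagrange equation without differentiating under the
integral. -/
lemma eq_zero_of_quartic_nonneg {L A B D : ℝ}
    (h : ∀ t : ℝ, 0 ≤ t * L + t ^ 2 * A + t ^ 3 * B + t ^ 4 * D) : L = 0 := by
  have hd : HasDerivAt (fun t : ℝ => t * L + t ^ 2 * A + t ^ 3 * B + t ^ 4 * D) L 0 := by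
    have := ((((hasDerivAt_id (0 : ℝ)).mul_const L).add ((hasDerivAt_pow 2 (0 : ℝ)).mul_const A)).add
      ((hasDerivAt_pow 3 (0 : ℝ)).mul_const B)).add ((hasDerivAt_pow 4 (0 : ℝ)).mul_const D)
    refine this.congr_deriv ?_
    norm_num
  refine IsLocalMin.hasDerivAt_eq_zero (Eventually.of_forall fun t => ?_) hd
  simpa using h t

lemma exists_integral_cubicAvgPrim_add (hL : ∀ k, MemLp (e k) 6 (cubeMeasure d))
    (x w z : EuclideanSpace ℝ (Fin N)) :
    ∃ A B D : ℝ, ∀ t : ℝ,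
      ∫ y, cubicAvgPrim c₀ c₁ c₂ c₃ (evalCoord e N x y) (evalCoord e N (w + t • z) y)
          ∂(cubeMeasure d) =
        ∫ y, cubicAvgPrim c₀ c₁ c₂ c₃ (evalCoord e N x y) (evalCoord e N w y) ∂(cubeMeasure d) +
          t * inner ℝ (avgForce e N c₀ c₁ c₂ c₃ x w) z + t ^ 2 * A + t ^ 3 * B + t ^ 4 * D := by
  have h0 := (hasGrowth_cubicAvgPrim (c₀ := c₀) (c₁ := c₁) (c₂ := c₂) (c₃ := c₃)).integrable
    hL (x, w, z)
  have h1 := (hasGrowth_cubicAvg_mul (c₀ := c₀) (c₁ := c₁) (c₂ := c₂) (c₃ := c₃)).integrable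
    hL (x, w, z)
  have g2 : HasGrowth 4 fun p : ℝ × ℝ × ℝ => c₃ * (3 / 4 * p.1 ^ 2 * p.2.2 ^ 2 +
      p.1 * p.2.1 * p.2.2 ^ 2 + 3 / 8 * p.2.1 ^ 2 * p.2.2 ^ 2) +
        c₂ * (p.1 * p.2.2 ^ 2 / 2 + p.2.1 * p.2.2 ^ 2 / 3) + c₁ * (p.2.2 ^ 2 / 4) := by
    refine HasGrowth.congr
      ((((((hasGrowth_monomial 2 0 2 (by norm_num) (c₃ * 3 / 4)).add
      (hasGrowth_monomial 1 1 2 (by norm_num) c₃)).add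
      (hasGrowth_monomial 0 2 2 (by norm_num) (c₃ * 3 / 8))).add
      (hasGrowth_monomial 1 0 2 (by norm_num) (c₂ / 2))).add
      (hasGrowth_monomial 0 1 2 (by norm_num) (c₂ / 3))).add
      (hasGrowth_monomial 0 0 2 (by norm_num) (c₁ / 4))) fun p => ?_
    ring
  have g3 : HasGrowth 4 fun p : ℝ × ℝ × ℝ => c₃ * (p.1 * p.2.2 ^ 3 / 3 + p.2.1 * p.2.2 ^ 3 / 4) +
      c₂ * (p.2.2 ^ 3 / 9) := by
    refine HasGrowth.congr
      (((hasGrowth_monomial 1 0 3 (by norm_num) (c₃ / 3)).add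
      (hasGrowth_monomial 0 1 3 (by norm_num) (c₃ / 4))).add
      (hasGrowth_monomial 0 0 3 (by norm_num) (c₂ / 9))) fun p => ?_
    ring
  have g4 : HasGrowth 4 fun p : ℝ × ℝ × ℝ => c₃ * (p.2.2 ^ 4 / 16) := by
    refine HasGrowth.congr (hasGrowth_monomial 0 0 4 (by norm_num) (c₃ / 16)) fun p => ?_
    ring
  have h2 := g2.integrable hL (x, w, z)
  have h3 := g3.integrable hL (x, w, z)
  have h4 := g4.integrable hL (x, w, z)
  refine ⟨∫ y, (fun p : ℝ × ℝ × ℝ => c₃ * (3 / 4 * p.1 ^ 2 * p.2.2 ^ 2 +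
      p.1 * p.2.1 * p.2.2 ^ 2 + 3 / 8 * p.2.1 ^ 2 * p.2.2 ^ 2) +
        c₂ * (p.1 * p.2.2 ^ 2 / 2 + p.2.1 * p.2.2 ^ 2 / 3) + c₁ * (p.2.2 ^ 2 / 4))
          (evalTriple e N (x, w, z) y) ∂(cubeMeasure d),
    ∫ y, (fun p : ℝ × ℝ × ℝ => c₃ * (p.1 * p.2.2 ^ 3 / 3 + p.2.1 * p.2.2 ^ 3 / 4) +
      c₂ * (p.2.2 ^ 3 / 9)) (evalTriple e N (x, w, z) y) ∂(cubeMeasure d),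
    ∫ y, c₃ * ((evalTriple e N (x, w, z) y).2.2 ^ 4 / 16) ∂(cubeMeasure d), fun t => ?_⟩
  rw [inner_avgForce hL]
  simp_rw [evalCoord_add, evalCoord_smul, cubicAvgPrim_add]
  simp only [evalTriple] at h0 h1 h2 h3 h4 ⊢
  rw [integral_add, integral_add, integral_add, integral_add, integral_const_mul,
    integral_const_mul, integral_const_mul, integral_const_mul]
  · exact h0
  · exact h1.const_mul t
  · exact h0.add (h1.const_mul t)
  · exact h2.const_mul _
  · exact (h0.add (h1.const_mul t)).add (h2.const_mul _)
  · exact h3.const_mul _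
  · exact ((h0.add (h1.const_mul t)).add (h2.const_mul _)).add (h3.const_mul _)
  · exact h4.const_mul _

end AVF

/-! ### Existence and uniqueness of the implicit step for small step sizes. -/

section Solvability

variable {d : ℕ} {e : HilbertBasis ℕ ℝ (L2 d)} {lam : ℕ → ℝ} {N : ℕ} {c₀ c₁ c₂ c₃ : ℝ}

lemma continuous_diagLam : Continuous (diagLam lam N) :=
  LinearMap.continuous_of_finiteDimensional _

lemma le_integral_cubicAvgPrim (hL : ∀ k, MemLp (e k) 6 (cubeMeasure d)) (hc₃ : 0 < c₃)
    (x w : EuclideanSpace ℝ (Fin N)) :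
    inner ℝ (avgForce e N c₀ c₁ c₂ c₃ x 0) w - cubicSlope c₁ c₂ c₃ / 4 * ‖w‖ ^ 2 ≤
      ∫ y, cubicAvgPrim c₀ c₁ c₂ c₃ (evalCoord e N x y) (evalCoord e N w y)
        ∂(cubeMeasure d) := by
  have h0 : ∀ y, evalCoord e N 0 y = 0 := fun y => by simp [evalCoord]
  have h1 := (hasGrowth_cubicAvg_mul (c₀ := c₀) (c₁ := c₁) (c₂ := c₂) (c₃ := c₃)).integrable
    hL (x, 0, w)
  have h2 := (hasGrowth_monomial 0 2 0 (by norm_num) 1).integrable hL (x, w, 0)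
  have h3 := (hasGrowth_cubicAvgPrim (c₀ := c₀) (c₁ := c₁) (c₂ := c₂) (c₃ := c₃)).integrable
    hL (x, w, 0)
  simp only [evalTriple, pow_zero, one_mul, mul_one] at h1 h2 h3
  rw [inner_avgForce hL, ← integral_evalCoord_sq (e := e), ← integral_const_mul,
    ← integral_sub h1 (h2.const_mul _)]
  refine integral_mono (h1.sub (h2.const_mul _)) h3 fun y => ?_
  refine le_trans (le_of_eq ?_) (le_cubicAvgPrim c₀ c₁ c₂ hc₃ (evalCoord e N x y)
    (evalCoord e N w y))
  simp only [h0]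
  congr 1
  simp [cubicAvg, cubic]

/-- Existence of the increment solving the implicit step, as a minimizer of a coercive
functional. -/
lemma exists_increment (hlam : ∀ k, 0 ≤ lam k) (hL : ∀ k, MemLp (e k) 6 (cubeMeasure d))
    (hc₃ : 0 < c₃) {h : ℝ} (hh : 0 < h) (hK : h ^ 2 * cubicSlope c₁ c₂ c₃ < 4)
    (x v : EuclideanSpace ℝ (Fin N)) :
    ∃ w, (2 / h) • w - (2 : ℝ) • v + (h / 2) • diagLam lam N w +
      h • diagLam lam N x + h • avgForce e N c₀ c₁ c₂ c₃ x w = 0 := by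
  set K := cubicSlope c₁ c₂ c₃
  let I : EuclideanSpace ℝ (Fin N) → ℝ := fun w =>
    ∫ y, cubicAvgPrim c₀ c₁ c₂ c₃ (evalCoord e N x y) (evalCoord e N w y) ∂(cubeMeasure d)
  have hIc : Continuous I := by
    have h1 := (hasGrowth_cubicAvgPrim (c₀ := c₀) (c₁ := c₁) (c₂ := c₂)
      (c₃ := c₃)).continuous_integral (N := N) hL
    exact h1.comp (g := _) (f := fun w : EuclideanSpace ℝ (Fin N) => (x, w, w)) (by fun_prop)
  -- The functional whose gradient at `w` is the left side of the increment equation.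
  let J : EuclideanSpace ℝ (Fin N) → ℝ := fun w =>
    1 / h * ‖w‖ ^ 2 - 2 * inner ℝ v w + h / 4 * inner ℝ (diagLam lam N w) w +
      h * inner ℝ (diagLam lam N x) w + h * I w
  have hJc : Continuous J := by
    have := continuous_diagLam (lam := lam) (N := N)
    fun_prop
  have hJ0 : J 0 = 0 := by
    have : I 0 = 0 := by simp [I, evalCoord, cubicAvgPrim]
    simp [J, this]
  set Y : EuclideanSpace ℝ (Fin N) :=
    h • diagLam lam N x + h • avgForce e N c₀ c₁ c₂ c₃ x 0 - (2 : ℝ) • v with hY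
  -- The coercivity constant: the kinetic term gives `1 / h` and the nonconvexity of `Φ` costs `h K
  -- / 4`. It is positive exactly when `h² K < 4`.
  set κ : ℝ := 1 / h - h * K / 4 with hκ
  have hκ0 : 0 < κ := by
    have : κ = (4 - h ^ 2 * K) / (4 * h) := by rw [hκ]; field_simp
    rw [this]
    exact div_pos (by linarith) (by linarith)
  have hlow : ∀ w, κ * ‖w‖ ^ 2 - ‖Y‖ * ‖w‖ ≤ J w := by
    intro w
    have h1 := le_integral_cubicAvgPrim (c₀ := c₀) (c₁ := c₁) (c₂ := c₂) hL hc₃ x w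
    have h2 := inner_diagLam_self_nonneg (N := N) hlam w
    have h3 := neg_le_of_abs_le (abs_real_inner_le_norm Y w)
    have h4 : inner ℝ Y w = h * inner ℝ (diagLam lam N x) w +
        h * inner ℝ (avgForce e N c₀ c₁ c₂ c₃ x 0) w - 2 * inner ℝ v w := by
      simp [hY, inner_add_left, inner_sub_left, inner_smul_left]
    have h5 : h * (inner ℝ (avgForce e N c₀ c₁ c₂ c₃ x 0) w - K / 4 * ‖w‖ ^ 2) ≤ h * I w :=
      mul_le_mul_of_nonneg_left h1 hh.le
    have h6 : 0 ≤ h / 4 * inner ℝ (diagLam lam N w) w := by positivity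
    simp only [J]
    rw [hκ]
    linarith
  obtain ⟨w, hw⟩ := hJc.exists_forall_le' (x₀ := 0) (by
    filter_upwards [(tendsto_norm_cocompact_atTop (E := EuclideanSpace ℝ (Fin N))
      ).eventually_ge_atTop (‖Y‖ / κ)] with w hw
    rw [hJ0]
    refine le_trans ?_ (hlow w)
    rw [div_le_iff₀ hκ0] at hw
    nlinarith [norm_nonneg w])
  refine ⟨w, ?_⟩
  set Z := (2 / h) • w - (2 : ℝ) • v + (h / 2) • diagLam lam N w +
      h • diagLam lam N x + h • avgForce e N c₀ c₁ c₂ c₃ x w with hZ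
  obtain ⟨A, B, D, hexp⟩ := exists_integral_cubicAvgPrim_add (c₀ := c₀) (c₁ := c₁) (c₂ := c₂)
    (c₃ := c₃) hL x w Z
  -- Varying the minimizer in the direction of the residual `Z` makes the first variation equal to
  -- `⟨Z, Z⟩`.
  have hZ0 : inner ℝ Z Z = 0 := by
    refine eq_zero_of_quartic_nonneg (A := 1 / h * ‖Z‖ ^ 2 + h / 4 * inner ℝ (diagLam lam N Z) Z +
      h * A) (B := h * B) (D := h * D) fun t => ?_
    have h1 := hw (w + t • Z)
    have h2 : J (w + t • Z) = J w + t * ((2 / h) * inner ℝ w Z - 2 * inner ℝ v Z +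
        h / 2 * inner ℝ (diagLam lam N w) Z + h * inner ℝ (diagLam lam N x) Z +
        h * inner ℝ (avgForce e N c₀ c₁ c₂ c₃ x w) Z) +
        t ^ 2 * (1 / h * ‖Z‖ ^ 2 + h / 4 * inner ℝ (diagLam lam N Z) Z + h * A) +
        t ^ 3 * (h * B) + t ^ 4 * (h * D) := by
      have hI : I (w + t • Z) = I w + t * inner ℝ (avgForce e N c₀ c₁ c₂ c₃ x w) Z +
        t ^ 2 * A + t ^ 3 * B + t ^ 4 * D := hexp t
      simp only [J]
      rw [hI, norm_add_sq_real, norm_smul, mul_pow, Real.norm_eq_abs, sq_abs]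
      simp only [map_add, map_smul, inner_add_left, inner_add_right, inner_smul_left,
        inner_smul_right]
      rw [inner_diagLam_comm Z w]
      simp only [RCLike.conj_to_real]
      ring
    have h3 : inner ℝ Z Z = (2 / h) * inner ℝ w Z - 2 * inner ℝ v Z +
        h / 2 * inner ℝ (diagLam lam N w) Z + h * inner ℝ (diagLam lam N x) Z +
        h * inner ℝ (avgForce e N c₀ c₁ c₂ c₃ x w) Z := by
      nth_rewrite 1 [hZ]
      simp only [inner_add_left, inner_sub_left, inner_smul_left, RCLike.conj_to_real]
    rw [h2] at h1
    rw [h3]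
    linarith
  exact inner_self_eq_zero.1 hZ0

lemma inner_avgForce_sub_ge (hL : ∀ k, MemLp (e k) 6 (cubeMeasure d)) (hc₃ : 0 < c₃)
    (x w w' : EuclideanSpace ℝ (Fin N)) :
    -(cubicSlope c₁ c₂ c₃ / 2) * ‖w - w'‖ ^ 2 ≤
      inner ℝ (avgForce e N c₀ c₁ c₂ c₃ x w - avgForce e N c₀ c₁ c₂ c₃ x w') (w - w') := by
  have h1 := (hasGrowth_cubicAvg_mul (c₀ := c₀) (c₁ := c₁) (c₂ := c₂) (c₃ := c₃)).integrable
    hL (x, w, w - w')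
  have h1' := (hasGrowth_cubicAvg_mul (c₀ := c₀) (c₁ := c₁) (c₂ := c₂) (c₃ := c₃)).integrable
    hL (x, w', w - w')
  have h2 := (hasGrowth_monomial 0 2 0 (by norm_num) 1).integrable hL (x, w - w', 0)
  simp only [evalTriple, pow_zero, one_mul, mul_one] at h1 h1' h2
  rw [inner_sub_left, inner_avgForce hL, inner_avgForce hL, ← integral_sub h1 h1',
    ← integral_evalCoord_sq (e := e), ← integral_const_mul]
  refine integral_mono (h2.const_mul _) (h1.sub h1') fun y => ?_
  have := cubicAvg_monotone c₀ c₁ c₂ hc₃ (evalCoord e N x y) (evalCoord e N w y)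
    (evalCoord e N w' y)
  simp only [evalCoord_sub]
  linarith

/-- Strong monotonicity: pairing the difference of the equations with `w - w'` leaves `(2/h - hK/2)
‖w - w'‖² ≤ 0`, and `h² K < 4` makes the coefficient positive. -/
lemma increment_unique (hlam : ∀ k, 0 ≤ lam k) (hL : ∀ k, MemLp (e k) 6 (cubeMeasure d))
    (hc₃ : 0 < c₃) {h : ℝ} (hh : 0 < h) (hK : h ^ 2 * cubicSlope c₁ c₂ c₃ < 4)
    {x v w w' : EuclideanSpace ℝ (Fin N)}
    (hw : (2 / h) • w - (2 : ℝ) • v + (h / 2) • diagLam lam N w +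
      h • diagLam lam N x + h • avgForce e N c₀ c₁ c₂ c₃ x w = 0)
    (hw' : (2 / h) • w' - (2 : ℝ) • v + (h / 2) • diagLam lam N w' +
      h • diagLam lam N x + h • avgForce e N c₀ c₁ c₂ c₃ x w' = 0) : w = w' := by
  set K := cubicSlope c₁ c₂ c₃
  have h1 : (2 / h) • (w - w') + (h / 2) • diagLam lam N (w - w') +
      h • (avgForce e N c₀ c₁ c₂ c₃ x w - avgForce e N c₀ c₁ c₂ c₃ x w') = 0 := by
    rw [map_sub, ← sub_eq_zero.2 (hw.trans hw'.symm)]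
    module
  have h2 := congrArg (fun z => inner ℝ z (w - w')) h1
  simp only [inner_add_left, inner_smul_left, RCLike.conj_to_real, inner_zero_left,
    real_inner_self_eq_norm_sq] at h2
  have h3 := inner_diagLam_self_nonneg (N := N) hlam (w - w')
  have h4 := mul_le_mul_of_nonneg_left
    (inner_avgForce_sub_ge (c₀ := c₀) (c₁ := c₁) (c₂ := c₂) hL hc₃ x w w') hh.le
  have h5 : 0 ≤ h / 2 * inner ℝ (diagLam lam N (w - w')) (w - w') := by positivity
  have h6 : (2 / h - h * K / 2) * ‖w - w'‖ ^ 2 ≤ 0 := by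
    simp only [K] at *
    linarith
  have h7 : 0 < 2 / h - h * K / 2 := by
    have : 2 / h - h * K / 2 = (4 - h ^ 2 * K) / (2 * h) := by
      field_simp
      ring
    rw [this]
    exact div_pos (by linarith) (by linarith)
  have h8 : ‖w - w'‖ ^ 2 ≤ 0 := by nlinarith
  have h9 : ‖w - w'‖ = 0 := by nlinarith [norm_nonneg (w - w')]
  exact sub_eq_zero.1 (norm_eq_zero.1 h9)

/-- Small step sizes are admissible. -/
lemma stepSizeAdmissible_of_sq_lt (hlam : ∀ k, 0 ≤ lam k)
    (hL : ∀ k, MemLp (e k) 6 (cubeMeasure d)) (hc₃ : 0 < c₃) {h₀ : ℝ}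
    (hK : h₀ ^ 2 * cubicSlope c₁ c₂ c₃ < 4) :
    StepSizeAdmissible e lam (cubic c₀ c₁ c₂ c₃) h₀ := by
  intro N _ h hh hle u hu v hv
  obtain ⟨x, rfl⟩ := mem_galerkinSpace_iff.1 hu
  obtain ⟨v, rfl⟩ := mem_galerkinSpace_iff.1 hv
  have hK' : h ^ 2 * cubicSlope c₁ c₂ c₃ < 4 := by
    refine lt_of_le_of_lt ?_ hK
    have := cubicSlope_nonneg c₁ c₂ hc₃
    gcongr
  obtain ⟨w, hw⟩ := exists_increment (c₀ := c₀) hlam hL hc₃ hh hK' x v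
  refine ⟨(embed e N (x + w), embed e N ((2 / h) • w - v)), ?_, ?_⟩
  · simp only
    rw [avfStep_embed_iff, coordStep_iff hh]
    simp only [add_sub_cancel_left]
    exact ⟨trivial, hw⟩
  · rintro ⟨u', v'⟩ hs
    simp only at hs
    obtain ⟨x', w', rfl, rfl⟩ := hs.exists_embed
    rw [avfStep_embed_iff, coordStep_iff hh] at hs
    have := increment_unique hlam hL hc₃ hh hK' hs.2 hw
    rw [hs.1, this, ← this, add_sub_cancel]

/-- Admissible step sizes exist. -/
lemma exists_stepSizeAdmissible (hlam : ∀ k, 0 ≤ lam k)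
    (hL : ∀ k, MemLp (e k) 6 (cubeMeasure d)) (hc₃ : 0 < c₃) :
    ∃ h₀ : ℝ, 0 < h₀ ∧ StepSizeAdmissible e lam (cubic c₀ c₁ c₂ c₃) h₀ := by
  have hK := cubicSlope_nonneg c₁ c₂ hc₃
  -- Any positive value with `h₀² K < 4` would do; this one also covers `K = 0`.
  refine ⟨1 / (1 + cubicSlope c₁ c₂ c₃), by positivity,
    stepSizeAdmissible_of_sq_lt hlam hL hc₃ ?_⟩
  rw [div_pow, div_mul_eq_mul_div, div_lt_iff₀ (by positivity)]
  nlinarith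

end Solvability

/-! ### Energy conservation and continuity of the solution map. -/

section Energy

variable {d : ℕ} {e : HilbertBasis ℕ ℝ (L2 d)} {lam : ℕ → ℝ} {N : ℕ} {c₀ c₁ c₂ c₃ : ℝ}

/-- The potential part of the energy in coordinates. -/
noncomputable def potential (e : HilbertBasis ℕ ℝ (L2 d)) (lam : ℕ → ℝ) (N : ℕ)
    (c₀ c₁ c₂ c₃ C₁ : ℝ) (x : EuclideanSpace ℝ (Fin N)) : ℝ :=
  1 / 2 * inner ℝ (diagLam lam N x) x +
    (∫ y, primitive (cubic c₀ c₁ c₂ c₃) (evalCoord e N x y) ∂(cubeMeasure d)) + C₁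

lemma energy_embed (C₁ : ℝ) (x v : EuclideanSpace ℝ (Fin N)) :
    energy e lam (cubic c₀ c₁ c₂ c₃) C₁ (embed e N x) (embed e N v) =
      potential e lam N c₀ c₁ c₂ c₃ C₁ x + 1 / 2 * ‖v‖ ^ 2 := by
  have h1 : ∫ y, primitive (cubic c₀ c₁ c₂ c₃) (embed e N x y) ∂(cubeMeasure d) =
      ∫ y, primitive (cubic c₀ c₁ c₂ c₃) (evalCoord e N x y) ∂(cubeMeasure d) := by
    refine integral_congr_ae ?_
    filter_upwards [coeFn_embed (e := e) x] with y hy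
    rw [hy]
  have h2 : ∑ i : Fin N, lam i * x i ^ 2 = inner ℝ (diagLam lam N x) x := by
    rw [inner_diagLam]
    exact Finset.sum_congr rfl fun i _ => by ring
  rw [energy, potential, h1, norm_embed, hdotOneNormSq_embed, h2]
  ring

lemma continuous_potential (hL : ∀ k, MemLp (e k) 6 (cubeMeasure d)) (C₁ : ℝ) :
    Continuous (potential e lam N c₀ c₁ c₂ c₃ C₁) := by
  have h1 := (hasGrowth_primitive (c₀ := c₀) (c₁ := c₁) (c₂ := c₂)
    (c₃ := c₃)).continuous_integral (N := N) hL
  have h2 : Continuous fun x : EuclideanSpace ℝ (Fin N) =>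
      ∫ y, primitive (cubic c₀ c₁ c₂ c₃) (evalCoord e N x y) ∂(cubeMeasure d) :=
    h1.comp (g := _) (f := fun x : EuclideanSpace ℝ (Fin N) => (x, x, x)) (by fun_prop)
  have := continuous_diagLam (lam := lam) (N := N)
  unfold potential
  fun_prop

lemma potential_nonneg (hlam : ∀ k, 0 ≤ lam k) (hL : ∀ k, MemLp (e k) 6 (cubeMeasure d)) {C₁ : ℝ}
    (hC₁ : ∀ z, 0 ≤ primitive (cubic c₀ c₁ c₂ c₃) z + C₁) (x : EuclideanSpace ℝ (Fin N)) :
    0 ≤ potential e lam N c₀ c₁ c₂ c₃ C₁ x := by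
  have h1 := inner_diagLam_self_nonneg (N := N) hlam x
  have h2 : 0 ≤ ∫ y, (primitive (cubic c₀ c₁ c₂ c₃) (evalCoord e N x y) + C₁) ∂(cubeMeasure d) :=
    integral_nonneg fun y => hC₁ _
  rw [integral_add (integrable_primitive_evalCoord hL x) (integrable_const _)] at h2
  simp at h2
  unfold potential
  linarith

/-- The averaged vector field step conserves the energy. -/
lemma CoordStep.energy_eq (hL : ∀ k, MemLp (e k) 6 (cubeMeasure d)) {h : ℝ} (hh : 0 < h) {C₁ : ℝ}
    {p q : EuclideanSpace ℝ (Fin N) × EuclideanSpace ℝ (Fin N)}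
    (hs : CoordStep e lam N c₀ c₁ c₂ c₃ h p q) :
    potential e lam N c₀ c₁ c₂ c₃ C₁ q.1 + 1 / 2 * ‖q.2‖ ^ 2 =
      potential e lam N c₀ c₁ c₂ c₃ C₁ p.1 + 1 / 2 * ‖p.2‖ ^ 2 := by
  obtain ⟨x, v⟩ := p
  obtain ⟨x', v'⟩ := q
  obtain ⟨h1, h2⟩ := hs
  simp only at h1 h2 ⊢
  set w := x' - x with hw
  have hx' : x' = x + w := by rw [hw]; abel
  have hsum : v' + v = (2 / h) • w := by
    rw [hw]
    nth_rewrite 1 [h1]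
    rw [add_sub_cancel_left, smul_smul, show 2 / h * (h / 2) = 1 by field_simp, one_smul]
  have hdiff : v' - v = -((h / 2) • diagLam lam N (x' + x)) -
      h • avgForce e N c₀ c₁ c₂ c₃ x w := by
    nth_rewrite 1 [h2]; abel
  -- The position equation turns `v' + v` into `(2/h) w`, and the velocity equation turns `v' - v`
  -- into the force; their pairing is minus twice the increment of the potential.
  have hkin : ‖v'‖ ^ 2 - ‖v‖ ^ 2 = inner ℝ (v' - v) (v' + v) := by
    rw [inner_sub_left, inner_add_right, inner_add_right, real_inner_self_eq_norm_sq,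
      real_inner_self_eq_norm_sq, real_inner_comm v v']
    ring
  rw [hdiff, hsum] at hkin
  have hF : inner ℝ (avgForce e N c₀ c₁ c₂ c₃ x w) w =
      (∫ y, primitive (cubic c₀ c₁ c₂ c₃) (evalCoord e N x' y) ∂(cubeMeasure d)) -
      ∫ y, primitive (cubic c₀ c₁ c₂ c₃) (evalCoord e N x y) ∂(cubeMeasure d) := by
    rw [inner_avgForce hL, ← integral_sub (integrable_primitive_evalCoord hL x')
      (integrable_primitive_evalCoord hL x)]
    refine integral_congr_ae (Eventually.of_forall fun y => ?_)
    simp only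
    rw [mul_cubicAvg, hx', evalCoord_add]
  have hD : inner ℝ (diagLam lam N (x' + x)) w =
      inner ℝ (diagLam lam N x') x' - inner ℝ (diagLam lam N x) x := by
    rw [hw, map_add, inner_add_left, inner_sub_right, inner_sub_right,
      inner_diagLam_comm x x']
    ring
  simp only [inner_sub_left, inner_neg_left, inner_smul_left, inner_smul_right,
    RCLike.conj_to_real] at hkin
  rw [hF, hD] at hkin
  unfold potential
  field_simp at hkin
  linarith

lemma isClosed_coordStep (hL : ∀ k, MemLp (e k) 6 (cubeMeasure d)) (h : ℝ) :
    IsClosed {z : (EuclideanSpace ℝ (Fin N) × EuclideanSpace ℝ (Fin N)) ×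
      (EuclideanSpace ℝ (Fin N) × EuclideanSpace ℝ (Fin N)) |
        CoordStep e lam N c₀ c₁ c₂ c₃ h z.1 z.2} := by
  have h1 := continuous_diagLam (lam := lam) (N := N)
  have h2 : Continuous fun z : (EuclideanSpace ℝ (Fin N) × EuclideanSpace ℝ (Fin N)) ×
      (EuclideanSpace ℝ (Fin N) × EuclideanSpace ℝ (Fin N)) =>
        avgForce e N c₀ c₁ c₂ c₃ z.1.1 (z.2.1 - z.1.1) :=
    (continuous_avgForce hL).comp (g := _)
      (f := fun z : (EuclideanSpace ℝ (Fin N) × EuclideanSpace ℝ (Fin N)) ×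
        (EuclideanSpace ℝ (Fin N) × EuclideanSpace ℝ (Fin N)) => (z.1.1, z.2.1 - z.1.1))
      (by fun_prop)
  exact (isClosed_eq (by fun_prop) (by fun_prop)).inter (isClosed_eq (by fun_prop) (by fun_prop))

/-- A map with closed graph that is locally bounded by a continuous function is continuous. -/
lemma continuous_of_isClosed_graph {X Y : Type*} [TopologicalSpace X] [NormedAddCommGroup Y]
    [ProperSpace Y] {f : X → Y} (hf : IsClosed {z : X × Y | f z.1 = z.2}) {B : X → ℝ}
    (hB : Continuous B) (hfB : ∀ x, ‖f x‖ ≤ B x) : Continuous f := by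
  rw [continuous_iff_continuousAt]
  intro x
  refine (isCompact_closedBall (0 : Y) (B x + 1)).tendsto_nhds_of_unique_mapClusterPt ?_ ?_
  · have : ∀ᶠ x' in 𝓝 x, B x' < B x + 1 :=
      hB.continuousAt.eventually_lt continuousAt_const (by simp)
    filter_upwards [this] with x' hx'
    simpa using (hfB x').trans hx'.le
  · intro y _ hy
    have hmem : (x, y) ∈ closure {z : X × Y | f z.1 = z.2} := by
      rw [mem_closure_iff_nhds]
      intro t ht
      obtain ⟨U, hU, V, hV, hUV⟩ := mem_nhds_prod_iff.1 ht
      obtain ⟨x', hx', hx''⟩ := ((mapClusterPt_iff_frequently.1 hy V hV).and_eventually hU).exists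
      exact ⟨(x', f x'), hUV ⟨hx'', hx'⟩, rfl⟩
    rw [hf.closure_eq] at hmem
    exact hmem.symm

/-- For an admissible step size the solution map of the implicit step is continuous. -/
lemma exists_continuous_step (hlam : ∀ k, 0 ≤ lam k) (hL : ∀ k, MemLp (e k) 6 (cubeMeasure d))
    {C₁ : ℝ} (hC₁ : ∀ z, 0 ≤ primitive (cubic c₀ c₁ c₂ c₃) z + C₁) {h₀ h : ℝ}
    (hadm : StepSizeAdmissible e lam (cubic c₀ c₁ c₂ c₃) h₀) (hN : 1 ≤ N) (hh : 0 < h)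
    (hle : h ≤ h₀) :
    ∃ step : EuclideanSpace ℝ (Fin N) × EuclideanSpace ℝ (Fin N) →
        EuclideanSpace ℝ (Fin N) × EuclideanSpace ℝ (Fin N),
      Continuous step ∧ ∀ p q, CoordStep e lam N c₀ c₁ c₂ c₃ h p q ↔ step p = q := by
  have hex : ∀ p, ∃ q, ∀ q', CoordStep e lam N c₀ c₁ c₂ c₃ h p q' ↔ q = q' := by
    rintro ⟨x, v⟩
    obtain ⟨⟨u', v'⟩, hs, huniq⟩ := hadm N hN h hh hle (embed e N x)
      (mem_galerkinSpace_iff.2 ⟨x, rfl⟩) (embed e N v) (mem_galerkinSpace_iff.2 ⟨v, rfl⟩)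
    simp only at hs huniq
    obtain ⟨x', w', rfl, rfl⟩ := hs.exists_embed
    refine ⟨(x', w'), ?_⟩
    rintro ⟨x'', w''⟩
    constructor
    · intro h'
      have := huniq (embed e N x'', embed e N w'') (avfStep_embed_iff.2 h')
      simp only [Prod.mk.injEq] at this
      rw [embed_injective this.1, embed_injective this.2]
    · rintro ⟨⟩
      exact avfStep_embed_iff.1 hs
  choose step hstep using hex
  refine ⟨step, ?_, hstep⟩
  set V : EuclideanSpace ℝ (Fin N) × EuclideanSpace ℝ (Fin N) → ℝ := fun p =>
    potential e lam N c₀ c₁ c₂ c₃ C₁ p.1 + 1 / 2 * ‖p.2‖ ^ 2 with hV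
  have hVc : Continuous V := by
    have := continuous_potential (lam := lam) (N := N) (c₀ := c₀) (c₁ := c₁) (c₂ := c₂)
      (c₃ := c₃) hL C₁
    fun_prop
  -- Conservation of the energy, with nonnegative potential, bounds the new velocity by `√(2 V p)`;
  -- the position equation then bounds the new position.
  refine continuous_of_isClosed_graph (B := fun p =>
    ‖p.1‖ + (h / 2) * (√(2 * V p) + ‖p.2‖) + √(2 * V p)) ?_ (by fun_prop) fun p => ?_
  · have := isClosed_coordStep (e := e) (lam := lam) (N := N) (c₀ := c₀) (c₁ := c₁) (c₂ := c₂)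
      (c₃ := c₃) hL h
    simpa only [hstep] using this
  · have hs : CoordStep e lam N c₀ c₁ c₂ c₃ h p (step p) := (hstep p _).2 rfl
    have hE := hs.energy_eq hL hh (C₁ := C₁)
    have hpot := potential_nonneg (N := N) hlam hL hC₁ (step p).1
    have hv : ‖(step p).2‖ ≤ √(2 * V p) := by
      refine Real.le_sqrt_of_sq_le ?_
      simp only [hV]
      linarith
    have hx : ‖(step p).1‖ ≤ ‖p.1‖ + (h / 2) * (√(2 * V p) + ‖p.2‖) := by
      rw [hs.1]
      refine (norm_add_le _ _).trans ?_
      rw [norm_smul, Real.norm_of_nonneg (by positivity)]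
      gcongr
      exact (norm_add_le _ _).trans (by gcongr)
    have h0 : 0 ≤ √(2 * V p) := Real.sqrt_nonneg _
    refine norm_prod_le_iff.2 ⟨hx.trans (by linarith), hv.trans ?_⟩
    have : 0 ≤ ‖p.1‖ + (h / 2) * (√(2 * V p) + ‖p.2‖) := by positivity
    linarith

end Energy

/-! ### Increments of the Wiener process and the trace of the projected noise. -/

section Noise

variable {d : ℕ} {e : HilbertBasis ℕ ℝ (L2 d)} {N : ℕ}

lemma opTrace_eq_tsum {Q S : L2 d →L[ℝ] L2 d} (hS : S.IsPositive) (hSQ : S ∘L S = Q) :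
    opTrace e Q = ∑' k, ‖S (e k)‖ ^ 2 := by
  rw [opTrace]
  refine tsum_congr fun k => ?_
  rw [← hSQ, ContinuousLinearMap.comp_apply, hS.isSelfAdjoint.isSymmetric.apply_clm,
    real_inner_self_eq_norm_sq]

/-- Symmetry of `S` moves it onto the `e i`, and Bessel's inequality in `b` removes the truncation.
The basis `b` of the noise need not be `e`, and the bound is uniform in `N` and `K`. -/
lemma sum_norm_coords_sq_le {S : L2 d →L[ℝ] L2 d} (hS : S.IsPositive)
    (hHS : Summable fun k => ‖S (e k)‖ ^ 2) (b : HilbertBasis ℕ ℝ (L2 d)) (K : ℕ) :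
    ∑ k ∈ Finset.range K, ‖coords e N (S (b k))‖ ^ 2 ≤ ∑' k, ‖S (e k)‖ ^ 2 := by
  calc ∑ k ∈ Finset.range K, ‖coords e N (S (b k))‖ ^ 2
      = ∑ i : Fin N, ∑ k ∈ Finset.range K, ‖inner ℝ (b k) (S (e i))‖ ^ 2 := by
        rw [Finset.sum_comm]
        refine Finset.sum_congr rfl fun k _ => ?_
        rw [EuclideanSpace.norm_sq_eq]
        refine Finset.sum_congr rfl fun i _ => ?_
        rw [coords_apply, ← hS.isSelfAdjoint.isSymmetric.apply_clm, real_inner_comm]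
    _ ≤ ∑ i : Fin N, ‖S (e i)‖ ^ 2 :=
        Finset.sum_le_sum fun i _ => b.orthonormal.sum_inner_products_le _
    _ = ∑ k ∈ Finset.range N, ‖S (e k)‖ ^ 2 := (Finset.sum_range fun k => ‖S (e k)‖ ^ 2).symm
    _ ≤ _ := hHS.sum_le_tsum _ fun _ _ => by positivity

lemma monotone_gridTime {h : ℝ} (hh : 0 ≤ h) : Monotone (gridTime h) := fun m n hmn => by
  unfold gridTime
  gcongr

lemma nndist_gridTime {h : ℝ} (hh : 0 ≤ h) (j : ℕ) :
    nndist (gridTime h (j + 1) : ℝ) (gridTime h j : ℝ) = h.toNNReal := by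
  have h1 : (gridTime h (j + 1) : ℝ) = (j + 1) * h := by
    rw [gridTime, Real.coe_toNNReal _ (by positivity)]; push_cast; rfl
  have h2 : (gridTime h j : ℝ) = j * h := by
    rw [gridTime, Real.coe_toNNReal _ (by positivity)]
  rw [h1, h2]
  apply NNReal.coe_injective
  rw [coe_nndist, Real.dist_eq, Real.coe_toNNReal _ hh]
  rw [show ((j : ℝ) + 1) * h - j * h = h by ring, abs_of_nonneg hh]

/-- The increments of a Wiener process on the grid are series of independent Gaussians. -/
lemma IsWienerProcess.exists_gaussian_increments {S : L2 d →L[ℝ] L2 d} {Ω : Type*}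
    [MeasurableSpace Ω] {P : Measure Ω} {W : ℝ≥0 → Ω → L2 d}
    (hW : IsWienerProcess S P W) {h : ℝ} (hh : 0 ≤ h) :
    ∃ (b : HilbertBasis ℕ ℝ (L2 d)) (η : ℕ × ℕ → Ω → ℝ), (∀ p, Measurable (η p)) ∧
      iIndepFun η P ∧ (∀ p, P.map (η p) = gaussianReal 0 h.toNNReal) ∧
      ∀ᵐ ω ∂P, ∀ j, Tendsto (fun K => ∑ k ∈ Finset.range K, η (k, j) ω • S (b k)) atTop
        (𝓝 (W (gridTime h (j + 1)) ω - W (gridTime h j) ω)) := by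
  obtain ⟨b, β, hβ, hind, hlim⟩ := hW
  set t := gridTime h with ht
  let ξ : ℕ → ℕ → Ω → ℝ := fun k j ω => β k (t (j + 1)) ω - β k (t j) ω
  have hξ : ∀ k j, AEMeasurable (ξ k j) P := fun k j =>
    ((hβ k).aemeasurable _).sub ((hβ k).aemeasurable _)
  -- Brownian increments are only almost everywhere measurable here, so measurable versions are
  -- used.
  let η : ℕ → ℕ → Ω → ℝ := fun k j => (hξ k j).mk (ξ k j)
  have hη : ∀ k j, Measurable (η k j) := fun k j => (hξ k j).measurable_mk
  have hae : ∀ k j, ξ k j =ᵐ[P] η k j := fun k j => (hξ k j).ae_eq_mk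
  have hind1 : iIndepFun (fun k ω => (η k · ω)) P := by
    have h1 := hind.comp (fun _ (p : ℝ≥0 → ℝ) (j : ℕ) => p (t (j + 1)) - p (t j))
      (fun _ => by fun_prop)
    refine (iIndepFun_congr fun k => ?_).1 h1
    have : ∀ᵐ ω ∂P, ∀ j, ξ k j ω = η k j ω := ae_all_iff.2 fun j => hae k j
    filter_upwards [this] with ω hω
    exact funext hω
  have hind2 : ∀ k, iIndepFun (η k) P := fun k =>
    (iIndepFun_congr (hae k)).1 ((hβ k).hasIndepIncrements.nat (monotone_gridTime hh))
  -- Independence of the sequences across `k`, and of the increments in time for each `k`, combine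
  -- into joint independence over all pairs.
  refine ⟨b, fun p => η p.1 p.2, fun p => hη _ _, iIndepFun_uncurry' hη hind1 hind2, ?_, ?_⟩
  · rintro ⟨k, j⟩
    have h1 := ((hβ k).hasLaw_sub (t (j + 1)) (t j)).map_eq
    simp only
    rw [← Measure.map_congr (hae k j)]
    refine h1.trans ?_
    congr 1
    exact nndist_gridTime hh j
  · have h1 : ∀ᵐ ω ∂P, ∀ k j, ξ k j ω = η k j ω := ae_all_iff.2 fun k => ae_all_iff.2 fun j => hae k j
    have h2 : ∀ᵐ ω ∂P, ∀ j, Tendsto (fun n => ∑ k ∈ Finset.range n, β k (t j) ω • S (b k)) atTop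
      (𝓝 (W (t j) ω)) := ae_all_iff.2 fun j => hlim (t j)
    filter_upwards [h1, h2] with ω hω1 hω2 j
    refine ((hω2 (j + 1)).sub (hω2 j)).congr fun K => ?_
    rw [← Finset.sum_sub_distrib]
    refine Finset.sum_congr rfl fun k _ => ?_
    rw [← sub_smul, ← hω1 k j]

end Noise

/-! ### The full discretization as a trajectory in coordinates. -/

section Discretization

variable {d : ℕ} {e : HilbertBasis ℕ ℝ (L2 d)} {lam : ℕ → ℝ} {N : ℕ} {c₀ c₁ c₂ c₃ : ℝ}
  {u₀ v₀ : L2 d}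

/-- A solution of the full discretization is almost surely a trajectory in coordinates. -/
lemma IsFullDiscretization.ae_eq_trajectory {Ω : Type*} [MeasurableSpace Ω] {P : Measure Ω}
    {W : ℝ≥0 → Ω → L2 d} {M : ℕ} {h : ℝ} {u v vbar : ℕ → Ω → L2 d}
    (hdisc : IsFullDiscretization e lam (cubic c₀ c₁ c₂ c₃) u₀ v₀ P W N M h u v vbar)
    {step : EuclideanSpace ℝ (Fin N) × EuclideanSpace ℝ (Fin N) →
        EuclideanSpace ℝ (Fin N) × EuclideanSpace ℝ (Fin N)}
    (hstep : ∀ p q, CoordStep e lam N c₀ c₁ c₂ c₃ h p q ↔ step p = q) {m : ℕ} (hm : m ≤ M) :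
    ∀ᵐ ω ∂P,
      u m ω = embed e N (trajectory step (coords e N u₀, coords e N v₀) (fun j => coords e N
        (W (gridTime h (j + 1)) ω - W (gridTime h j) ω)) m).1 ∧
      v m ω = embed e N (trajectory step (coords e N u₀, coords e N v₀) (fun j => coords e N
        (W (gridTime h (j + 1)) ω - W (gridTime h j) ω)) m).2 := by
  induction m with
  | zero =>
    filter_upwards [hdisc.init_u, hdisc.init_v] with ω h1 h2
    rw [h1, h2, galerkinProj_coe, galerkinProj_coe]
    exact ⟨rfl, rfl⟩
  | succ m ih =>
    filter_upwards [ih (by omega), hdisc.step m (by omega), hdisc.noise m (by omega)]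
      with ω h1 h2 h3
    rw [h1.1, h1.2] at h2
    obtain ⟨x', w', hx', hw'⟩ := h2.exists_embed
    rw [hx', hw', avfStep_embed_iff, hstep] at h2
    rw [h3, hx', hw', galerkinProj_coe, ← map_add]
    simp only [trajectory]
    rw [h2]
    exact ⟨rfl, rfl⟩

/-- Exponential moments of the energy of the full discretization, in coordinates. -/
lemma exists_coords_exp_moment (hlam : ∀ k, 0 ≤ lam k)
    (hL : ∀ k, MemLp (e k) 6 (cubeMeasure d)) {Q S : L2 d →L[ℝ] L2 d} (hS : S.IsPositive)
    (hSQ : S ∘L S = Q) (hHS : Summable fun k => ‖S (e k)‖ ^ 2)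
    {C₁ : ℝ} (hC₁ : ∀ z, 0 ≤ primitive (cubic c₀ c₁ c₂ c₃) z + C₁) {α : ℝ} (hα : opTrace e Q ≤ α)
    {h₀ : ℝ} (hadm : StepSizeAdmissible e lam (cubic c₀ c₁ c₂ c₃) h₀)
    {Ω : Type*} [MeasurableSpace Ω] {P : Measure Ω} [IsProbabilityMeasure P]
    {W : ℝ≥0 → Ω → L2 d} (hW : IsWienerProcess S P W) {M : ℕ} (hN : 1 ≤ N) {h : ℝ} (hh : 0 < h)
    (hle : h ≤ h₀) {u v vbar : ℕ → Ω → L2 d}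
    (hdisc : IsFullDiscretization e lam (cubic c₀ c₁ c₂ c₃) u₀ v₀ P W N M h u v vbar) :
    ∃ X : ℕ → Ω → EuclideanSpace ℝ (Fin N) × EuclideanSpace ℝ (Fin N),
      (∀ m, AEMeasurable (X m) P) ∧
      (∀ m ≤ M, ∀ᵐ ω ∂P, u m ω = embed e N (X m ω).1 ∧ v m ω = embed e N (X m ω).2) ∧
      ∀ m, ∫⁻ ω, ENNReal.ofReal (Real.exp ((potential e lam N c₀ c₁ c₂ c₃ C₁ (X m ω).1 +
          1 / 2 * ‖(X m ω).2‖ ^ 2) * Real.exp (-α * (m * h)))) ∂P ≤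
        ENNReal.ofReal (Real.exp (potential e lam N c₀ c₁ c₂ c₃ C₁ (coords e N u₀) +
          1 / 2 * ‖coords e N v₀‖ ^ 2 +
          ∫ s in (0 : ℝ)..(m * h), 1 / 2 * opTrace e Q * Real.exp (-α * s))) := by
  obtain ⟨step, hcont, hstep⟩ := exists_continuous_step hlam hL hC₁ hadm hN hh hle
  obtain ⟨b, η, hη, hind, hlaw, hlim⟩ := hW.exists_gaussian_increments hh.le
  set ζ : ℕ → Ω → EuclideanSpace ℝ (Fin N) := fun j ω =>
    coords e N (W (gridTime h (j + 1)) ω - W (gridTime h j) ω) with hζ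
  have hζlim : ∀ᵐ ω ∂P, ∀ j, Tendsto
      (fun K => ∑ k ∈ Finset.range K, η (k, j) ω • coords e N (S (b k))) atTop (𝓝 (ζ j ω)) := by
    filter_upwards [hlim] with ω hω j
    refine (((coords e N).continuous.tendsto _).comp (hω j)).congr fun K => ?_
    simp only [Function.comp, map_sum, map_smul]
  -- `W` is not assumed measurable; its projected increments inherit measurability from the Gaussian
  -- series.
  have hζm : ∀ j, AEMeasurable (ζ j) P := fun j =>
    aemeasurable_of_tendsto_metrizable_ae atTop
      (f := fun K ω => ∑ k ∈ Finset.range K, η (k, j) ω • coords e N (S (b k)))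
      (fun K => Measurable.aemeasurable (by fun_prop)) (by
        filter_upwards [hζlim] with ω hω using hω j)
  have hh0 : h.toNNReal ≠ 0 := by simpa using hh
  refine ⟨fun m ω => trajectory step (coords e N u₀, coords e N v₀) (fun j => ζ j ω) m,
    fun m => (continuous_trajectory hcont _ m).measurable.comp_aemeasurable
      (aemeasurable_pi_iff.2 hζm),
    fun m hm => hdisc.ae_eq_trajectory hstep hm, fun m => ?_⟩
  have hmain := lintegral_exp_energy_trajectory_le hcont
    (continuous_potential (lam := lam) (N := N) (c₀ := c₀) (c₁ := c₁) (c₂ := c₂) (c₃ := c₃) hL C₁)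
    (potential_nonneg hlam hL hC₁) (fun p => ((hstep p _).2 rfl).energy_eq hL hh)
    hh0 hη hind hlaw (τ := opTrace e Q)
    (fun K => by
      rw [opTrace_eq_tsum hS hSQ]
      exact sum_norm_coords_sq_le hS hHS b K) hα hζlim (coords e N u₀, coords e N v₀) m
  rw [Real.coe_toNNReal _ hh.le] at hmain
  exact hmain

/-- Solutions of the scheme need not be measurable. A nonnegative measurable version carries the
bound, and integrability comes with it. -/
lemma integrable_and_integral_le {Ω : Type*} [MeasurableSpace Ω] {P : Measure Ω} {F G : Ω → ℝ}
    (hFG : F =ᵐ[P] G) (hG : AEMeasurable G P) (hG0 : ∀ ω, 0 ≤ G ω) {B : ℝ} (hB : 0 ≤ B)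
    (hle : ∫⁻ ω, ENNReal.ofReal (G ω) ∂P ≤ ENNReal.ofReal B) :
    Integrable F P ∧ ∫ ω, F ω ∂P ≤ B := by
  constructor
  · refine Integrable.congr ?_ hFG.symm
    refine ⟨hG.aestronglyMeasurable, ?_⟩
    rw [hasFiniteIntegral_iff_ofReal (Eventually.of_forall hG0)]
    exact hle.trans_lt ENNReal.ofReal_lt_top
  · rw [integral_congr_ae hFG, integral_eq_lintegral_of_nonneg_ae (Eventually.of_forall hG0)
      hG.aestronglyMeasurable]
    exact ENNReal.toReal_le_of_le_ofReal hB hle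

end Discretization

/-! ### Control of the `L⁶` norm and of the initial energy, uniform in `N`. -/

section SixNorm

variable {d : ℕ} {e : HilbertBasis ℕ ℝ (L2 d)} {lam : ℕ → ℝ} {N : ℕ} {c₀ c₁ c₂ c₃ : ℝ}

lemma normL6_pow_six (w : L2 d) :
    normL6 w ^ 6 = (∫⁻ y, ‖w y‖ₑ ^ 6 ∂(cubeMeasure d)).toReal := by
  rw [normL6, ← ENNReal.toReal_pow, eLpNorm_six_pow]

lemma measurable_normL6_embed :
    Measurable fun x : EuclideanSpace ℝ (Fin N) => normL6 (embed e N x) := by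
  have h1 : ∀ x : EuclideanSpace ℝ (Fin N), normL6 (embed e N x) =
      ((∫⁻ y, ‖evalCoord e N x y‖ₑ ^ (6 : ℝ≥0∞).toReal ∂(cubeMeasure d)) ^
        (1 / (6 : ℝ≥0∞).toReal)).toReal := by
    intro x
    rw [normL6, eLpNorm_congr_ae (coeFn_embed x),
      eLpNorm_eq_lintegral_rpow_enorm_toReal (by norm_num) (by norm_num)]
  simp_rw [h1]
  have h2 : Measurable fun z : EuclideanSpace ℝ (Fin N) × EuclideanSpace ℝ (Fin d) =>
      evalCoord e N z.1 z.2 := by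
    have : ∀ i : Fin N, Measurable (e i : EuclideanSpace ℝ (Fin d) → ℝ) :=
      fun i => (Lp.stronglyMeasurable _).measurable
    unfold evalCoord
    refine Finset.measurable_fun_sum _ fun i _ => Measurable.mul (by fun_prop)
      ((this i).comp measurable_snd)
  have h3 : Measurable fun z : EuclideanSpace ℝ (Fin N) × EuclideanSpace ℝ (Fin d) =>
      ‖evalCoord e N z.1 z.2‖ₑ ^ (6 : ℝ≥0∞).toReal := by fun_prop
  exact (h3.lintegral_prod_right'.pow_const _).ennreal_toReal

/-- A Gagliardo–Nirenberg inequality in coordinates. -/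
lemma IsDirichletEigenbasis.exists_normL6_pow_six_le (he : IsDirichletEigenbasis e lam)
    (hd : d = 1 ∨ d = 2) :
    ∃ C : ℝ, 0 ≤ C ∧ ∀ (N : ℕ) (x : EuclideanSpace ℝ (Fin N)),
      normL6 (embed e N x) ^ 6 ≤ C * ‖x‖ ^ 2 * inner ℝ (diagLam lam N x) x ^ 2 := by
  obtain ⟨C, hC⟩ := he.exists_lintegral_pow_six_embed_le hd
  refine ⟨C, C.2, fun N x => ?_⟩
  have h1 : ∑ i : Fin N, lam i * x i ^ 2 = inner ℝ (diagLam lam N x) x := by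
    rw [inner_diagLam]
    exact Finset.sum_congr rfl fun i _ => by ring
  rw [normL6_pow_six, ← h1]
  exact ENNReal.toReal_le_of_le_ofReal (by positivity) (hC N x)

/-- Young's inequality: the cube of the right side contains the term `3 (δ G)² (C / (3 δ²)) A = C A
G²`. Used with `n` the squared `L⁶` norm. -/
lemma le_add_of_cube_le {n A G C δ : ℝ} (hA : 0 ≤ A) (hG : 0 ≤ G) (hδ : 0 < δ)
    (hC : 0 ≤ C) (h : n ^ 3 ≤ C * A * G ^ 2) : n ≤ δ * G + C / (3 * δ ^ 2) * A := by
  by_contra! hlt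
  set D := C / (3 * δ ^ 2) with hD
  have hD0 : 0 ≤ D := by positivity
  have hCD : C = 3 * δ ^ 2 * D := by rw [hD]; field_simp
  have h1 : (δ * G + D * A) ^ 3 < n ^ 3 := by
    have : 0 ≤ δ * G + D * A := by positivity
    gcongr
  have h2 : C * A * G ^ 2 ≤ (δ * G + D * A) ^ 3 := by
    rw [hCD]
    have h3 : 0 ≤ (δ * G) ^ 3 := by positivity
    have h4 : 0 ≤ (δ * G) * (D * A) ^ 2 := by positivity
    have h5 : 0 ≤ (D * A) ^ 3 := by positivity
    nlinarith
  linarith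

lemma exists_mul_sq_le_primitive (hc₃ : 0 < c₃) (K : ℝ) :
    ∃ C : ℝ, ∀ z : ℝ, K * z ^ 2 ≤ primitive (cubic c₀ c₁ c₂ c₃) z + C := by
  -- `B` collects all quadratic terms: the given ones, and the costs `c₂² / c₃` and `1` of absorbing
  -- the cubic and the linear term of `Φ`.
  set B : ℝ := (K - c₁ / 2 + 1 + c₂ ^ 2 / c₃) with hB
  refine ⟨B ^ 2 / c₃ * 2 + c₀ ^ 2, fun z => ?_⟩
  rw [primitive_cubic]
  have h1 : -(c₂ ^ 2 / c₃ * z ^ 2) - c₃ / 36 * z ^ 4 ≤ c₂ * z ^ 3 / 3 := by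
    have : 0 ≤ (c₂ * z + c₃ / 6 * z ^ 2) ^ 2 / c₃ := by positivity
    have e1 : (c₂ * z + c₃ / 6 * z ^ 2) ^ 2 / c₃ =
        c₂ ^ 2 / c₃ * z ^ 2 + c₂ * z ^ 3 / 3 + c₃ / 36 * z ^ 4 := by field_simp; ring
    linarith
  have h2 : -z ^ 2 - c₀ ^ 2 / 4 ≤ c₀ * z := by nlinarith [sq_nonneg (z + c₀ / 2)]
  have h3 : B * z ^ 2 ≤ c₃ / 8 * z ^ 4 + B ^ 2 / c₃ * 2 := by
    have : 0 ≤ (c₃ / 4 * z ^ 2 - B) ^ 2 / c₃ := by positivity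
    have e1 : (c₃ / 4 * z ^ 2 - B) ^ 2 / c₃ =
        c₃ / 16 * z ^ 4 - B / 2 * z ^ 2 + B ^ 2 / c₃ := by field_simp; ring
    linarith
  have h4 : B * z ^ 2 = K * z ^ 2 - c₁ / 2 * z ^ 2 + z ^ 2 + c₂ ^ 2 / c₃ * z ^ 2 := by
    rw [hB]; ring
  have h5 : 0 ≤ c₃ * z ^ 4 := by positivity
  have h6 := sq_nonneg c₀
  linarith

/-- The crude sixth power is chosen because the `L⁶` norm of the initial data is already controlled.
-/
lemma primitive_le (c₀ c₁ c₂ c₃ z : ℝ) :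
    primitive (cubic c₀ c₁ c₂ c₃) z ≤ (|c₃| + |c₂| + |c₁| + |c₀|) * (1 + z ^ 6) := by
  rw [primitive_cubic]
  have habs : ∀ k : ℕ, k ≤ 6 → |z| ^ k ≤ 1 + z ^ 6 := by
    intro k hk
    have h6 : |z| ^ 6 = z ^ 6 := Even.pow_abs (n := 6) (by decide) z
    rcases le_total |z| 1 with h | h
    · have : |z| ^ k ≤ 1 := pow_le_one₀ (abs_nonneg z) h
      have : 0 ≤ |z| ^ 6 := by positivity
      linarith
    · have : |z| ^ k ≤ |z| ^ 6 := pow_le_pow_right₀ h hk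
      linarith
  have key : ∀ (c : ℝ) (k : ℕ), k ≤ 6 → c * z ^ k ≤ |c| * (1 + z ^ 6) := by
    intro c k hk
    calc c * z ^ k ≤ |c * z ^ k| := le_abs_self _
      _ = |c| * |z| ^ k := by rw [abs_mul, abs_pow]
      _ ≤ _ := by gcongr; exact habs k hk
  have hp : 0 ≤ 1 + z ^ 6 := by
    have : 0 ≤ z ^ 6 := Even.pow_nonneg (n := 6) (by decide) z
    linarith
  have h4 := key c₃ 4 (by norm_num)
  have h3 := key c₂ 3 (by norm_num)
  have h2 := key c₁ 2 (by norm_num)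
  have h1 := key c₀ 1 (by norm_num)
  have p3 : 0 ≤ |c₃| * (1 + z ^ 6) := by positivity
  have p2 : 0 ≤ |c₂| * (1 + z ^ 6) := by positivity
  have p1 : 0 ≤ |c₁| * (1 + z ^ 6) := by positivity
  rw [pow_one] at h1
  linarith

/-- The squared `L⁶` norm is bounded by an arbitrarily small multiple of the potential energy. -/
lemma IsDirichletEigenbasis.exists_normL6_sq_le (he : IsDirichletEigenbasis e lam)
    (hd : d = 1 ∨ d = 2) (hL : ∀ k, MemLp (e k) 6 (cubeMeasure d)) (hc₃ : 0 < c₃) (C₁ : ℝ)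
    {ε : ℝ} (hε : 0 < ε) :
    ∃ D : ℝ, ∀ (N : ℕ) (x : EuclideanSpace ℝ (Fin N)),
      normL6 (embed e N x) ^ 2 ≤ ε * potential e lam N c₀ c₁ c₂ c₃ C₁ x + D := by
  obtain ⟨C, hC0, hC⟩ := he.exists_normL6_pow_six_le hd
  -- Young's inequality is applied with `δ = ε / 2`, as the gradient term enters the potential with
  -- factor `1/2`. The remaining `E ‖x‖²` is absorbed by the quartic growth of `Φ`.
  set E := C / (3 * (ε / 2) ^ 2) with hE
  obtain ⟨B, hB⟩ := exists_mul_sq_le_primitive (c₀ := c₀) (c₁ := c₁) (c₂ := c₂) hc₃ (E / ε)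
  refine ⟨ε * (B - C₁), fun N x => ?_⟩
  have h1 : normL6 (embed e N x) ^ 2 ≤
      ε / 2 * inner ℝ (diagLam lam N x) x + E * ‖x‖ ^ 2 := by
    refine le_add_of_cube_le (by positivity) (inner_diagLam_self_nonneg he.lam_nonneg x)
      (by positivity) hC0 ?_
    rw [← pow_mul]
    exact hC N x
  have h2 : E / ε * ‖x‖ ^ 2 ≤
      (∫ y, primitive (cubic c₀ c₁ c₂ c₃) (evalCoord e N x y) ∂(cubeMeasure d)) + B := by
    have hint := integrable_primitive_evalCoord (c₀ := c₀) (c₁ := c₁) (c₂ := c₂) (c₃ := c₃) hL x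
    have hsq := (hasGrowth_monomial 2 0 0 (by norm_num) 1).integrable hL (x, x, x)
    simp only [evalTriple, pow_zero, one_mul, mul_one] at hsq
    rw [← integral_evalCoord_sq (e := e), ← integral_const_mul]
    calc ∫ y, E / ε * evalCoord e N x y ^ 2 ∂(cubeMeasure d)
        ≤ ∫ y, (primitive (cubic c₀ c₁ c₂ c₃) (evalCoord e N x y) + B) ∂(cubeMeasure d) :=
          integral_mono (hsq.const_mul _) (hint.add (integrable_const _)) fun y => hB _
      _ = _ := by rw [integral_add hint (integrable_const _)]; simp
  have h3 := mul_le_mul_of_nonneg_left h2 hε.le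
  have h4 : ε * (E / ε * ‖x‖ ^ 2) = E * ‖x‖ ^ 2 := by field_simp
  rw [h4] at h3
  unfold potential
  linarith

lemma inner_diagLam_coords_le (hlam : ∀ k, 0 ≤ lam k) {u₀ : L2 d} (hu₀ : MemHdotOne e lam u₀) :
    inner ℝ (diagLam lam N (coords e N u₀)) (coords e N u₀) ≤ hdotOneNormSq e lam u₀ := by
  rw [inner_diagLam]
  have h1 : ∑ i : Fin N, lam i * coords e N u₀ i * coords e N u₀ i =
      ∑ k ∈ Finset.range N, lam k * (inner ℝ u₀ (e k)) ^ 2 := by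
    rw [Finset.sum_range]
    refine Finset.sum_congr rfl fun i _ => ?_
    rw [coords_apply, real_inner_comm]
    ring
  rw [h1]
  exact hu₀.sum_le_tsum _ fun k _ => mul_nonneg (hlam k) (sq_nonneg _)

lemma norm_coords_le (w : L2 d) : ‖coords e N w‖ ≤ ‖w‖ := by
  have h1 : ‖coords e N w‖ ^ 2 = inner ℝ (embed e N (coords e N w)) w := by
    rw [inner_embed, real_inner_self_eq_norm_sq]
  have h2 := real_inner_le_norm (embed e N (coords e N w)) w
  rw [← h1, norm_embed] at h2
  by_contra! hlt
  nlinarith [norm_nonneg (coords e N w), norm_nonneg w]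

/-- The energies of the projected initial data are bounded uniformly in `N`. -/
lemma IsDirichletEigenbasis.exists_initial_energy_le (he : IsDirichletEigenbasis e lam)
    (hd : d = 1 ∨ d = 2) (hL : ∀ k, MemLp (e k) 6 (cubeMeasure d)) (C₁ : ℝ) {u₀ v₀ : L2 d}
    (hu₀ : MemHdotOne e lam u₀) :
    ∃ B : ℝ, ∀ N : ℕ, potential e lam N c₀ c₁ c₂ c₃ C₁ (coords e N u₀) +
      1 / 2 * ‖coords e N v₀‖ ^ 2 ≤ B := by
  obtain ⟨C, hC0, hC⟩ := he.exists_normL6_pow_six_le hd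
  set A := |c₃| + |c₂| + |c₁| + |c₀| with hA
  have hA0 : 0 ≤ A := by positivity
  refine ⟨1 / 2 * hdotOneNormSq e lam u₀ +
    A * (1 + C * ‖u₀‖ ^ 2 * hdotOneNormSq e lam u₀ ^ 2) + C₁ + 1 / 2 * ‖v₀‖ ^ 2, fun N => ?_⟩
  set x := coords e N u₀
  have hH := inner_diagLam_coords_le (N := N) he.lam_nonneg hu₀
  have hH0 := inner_diagLam_self_nonneg (N := N) he.lam_nonneg x
  have hx : ‖x‖ ≤ ‖u₀‖ := norm_coords_le u₀
  have hv : ‖coords e N v₀‖ ^ 2 ≤ ‖v₀‖ ^ 2 := by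
    gcongr
    exact norm_coords_le v₀
  have h6 : Integrable (fun y => evalCoord e N x y ^ 6) (cubeMeasure d) ∧
      ∫ y, evalCoord e N x y ^ 6 ∂(cubeMeasure d) = normL6 (embed e N x) ^ 6 := by
    have hp : ∀ y, 0 ≤ evalCoord e N x y ^ 6 := fun y => Even.pow_nonneg (n := 6) (by decide) _
    have hm : AEStronglyMeasurable (fun y => evalCoord e N x y ^ 6) (cubeMeasure d) :=
      ((measurable_evalCoord x).pow_const 6).aestronglyMeasurable
    have e1 : ∀ y, ENNReal.ofReal (evalCoord e N x y ^ 6) = ‖evalCoord e N x y‖ₑ ^ 6 := by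
      intro y
      rw [← Even.pow_abs (n := 6) (by decide), ENNReal.ofReal_pow (abs_nonneg _),
        ← Real.norm_eq_abs, ofReal_norm]
    have e2 : ∫⁻ y, ENNReal.ofReal (evalCoord e N x y ^ 6) ∂(cubeMeasure d) =
        ∫⁻ y, ‖embed e N x y‖ₑ ^ 6 ∂(cubeMeasure d) := by
      refine lintegral_congr_ae ?_
      filter_upwards [coeFn_embed (e := e) x] with y hy
      rw [e1, hy]
    constructor
    · refine ⟨hm, ?_⟩
      rw [hasFiniteIntegral_iff_ofReal (Eventually.of_forall hp), e2, ← eLpNorm_six_pow]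
      exact ENNReal.pow_lt_top (he.memLp_six_embed hd x).2
    · rw [integral_eq_lintegral_of_nonneg_ae (Eventually.of_forall hp) hm, e2, normL6_pow_six]
  have hΦ : ∫ y, primitive (cubic c₀ c₁ c₂ c₃) (evalCoord e N x y) ∂(cubeMeasure d) ≤
      A * (1 + C * ‖u₀‖ ^ 2 * hdotOneNormSq e lam u₀ ^ 2) := by
    calc ∫ y, primitive (cubic c₀ c₁ c₂ c₃) (evalCoord e N x y) ∂(cubeMeasure d)
        ≤ ∫ y, A * (1 + evalCoord e N x y ^ 6) ∂(cubeMeasure d) :=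
          integral_mono (integrable_primitive_evalCoord hL x)
            (((integrable_const 1).add h6.1).const_mul A) fun y => primitive_le _ _ _ _ _
      _ = A * (1 + normL6 (embed e N x) ^ 6) := by
          rw [integral_const_mul, integral_add (integrable_const 1) h6.1, h6.2]
          simp
      _ ≤ _ := by
          have := hC N x
          gcongr
          refine this.trans ?_
          gcongr
  unfold potential
  linarith

/-- Jensen's inequality with equal weights on the `m + 1` terms. -/
lemma exp_sum_le (m : ℕ) (a : ℕ → ℝ) :
    Real.exp (∑ i ∈ Finset.range (m + 1), a i) ≤
      (m + 1 : ℝ)⁻¹ * ∑ i ∈ Finset.range (m + 1), Real.exp ((m + 1) * a i) := by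
  have hm : (0 : ℝ) < m + 1 := by positivity
  have h := convexOn_exp.map_sum_le (t := Finset.range (m + 1)) (w := fun _ => (m + 1 : ℝ)⁻¹)
    (p := fun i => (m + 1 : ℝ) * a i) (fun _ _ => by positivity) (by simp; field_simp)
    (fun _ _ => Set.mem_univ _)
  simp only [smul_eq_mul] at h
  rw [Finset.mul_sum]
  refine le_trans (le_of_eq ?_) h
  congr 1
  exact Finset.sum_congr rfl fun i _ => by field_simp

end SixNorm

/-! ### Assembly of the exponential moment bounds. -/

section Moments

variable {d : ℕ} {e : HilbertBasis ℕ ℝ (L2 d)} {lam : ℕ → ℝ} {N : ℕ} {c₀ c₁ c₂ c₃ : ℝ}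
  {u₀ v₀ : L2 d}

/-- Only the moments at single times enter; nothing about the joint law is needed. -/
lemma lintegral_exp_sum_le {Ω : Type*} [MeasurableSpace Ω] {P : Measure Ω} (m : ℕ)
    {a : ℕ → Ω → ℝ} (ha : ∀ i, AEMeasurable (a i) P) {K : ℝ} (hK : 0 ≤ K)
    (hle : ∀ i ≤ m, ∫⁻ ω, ENNReal.ofReal (Real.exp ((m + 1) * a i ω)) ∂P ≤ ENNReal.ofReal K) :
    ∫⁻ ω, ENNReal.ofReal (Real.exp (∑ i ∈ Finset.range (m + 1), a i ω)) ∂P ≤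
      ENNReal.ofReal K := by
  have hm : (0 : ℝ) < m + 1 := by positivity
  have hmeas : ∀ i, AEMeasurable (fun ω => ENNReal.ofReal (Real.exp ((m + 1) * a i ω))) P :=
    fun i => (Real.measurable_exp.comp_aemeasurable ((ha i).const_mul _)).ennreal_ofReal
  calc ∫⁻ ω, ENNReal.ofReal (Real.exp (∑ i ∈ Finset.range (m + 1), a i ω)) ∂P
      ≤ ∫⁻ ω, ENNReal.ofReal (m + 1 : ℝ)⁻¹ *
          ∑ i ∈ Finset.range (m + 1), ENNReal.ofReal (Real.exp ((m + 1) * a i ω)) ∂P := by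
        refine lintegral_mono fun ω => ?_
        rw [← ENNReal.ofReal_sum_of_nonneg fun _ _ => (Real.exp_pos _).le,
          ← ENNReal.ofReal_mul (by positivity)]
        exact ENNReal.ofReal_le_ofReal (exp_sum_le m fun i => a i ω)
    _ = ENNReal.ofReal (m + 1 : ℝ)⁻¹ * ∑ i ∈ Finset.range (m + 1),
          ∫⁻ ω, ENNReal.ofReal (Real.exp ((m + 1) * a i ω)) ∂P := by
        rw [lintegral_const_mul'' _ (Finset.aemeasurable_fun_sum _ fun i _ => hmeas i),
          lintegral_finsetSum' _ fun i _ => hmeas i]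
    _ ≤ ENNReal.ofReal (m + 1 : ℝ)⁻¹ * ∑ _i ∈ Finset.range (m + 1), ENNReal.ofReal K := by
        gcongr with i hi
        exact hle i (Nat.lt_succ_iff.1 (Finset.mem_range.1 hi))
    _ = ENNReal.ofReal K := by
        rw [← ENNReal.ofReal_sum_of_nonneg fun _ _ => hK, ← ENNReal.ofReal_mul (by positivity)]
        congr 1
        simp
        field_simp

lemma integral_mul_exp_neg_le {τ t T : ℝ} (hτ : 0 ≤ τ) (ht : 0 ≤ t) (htT : t ≤ T) :
    ∫ s in (0 : ℝ)..t, 1 / 2 * τ * Real.exp (-τ * s) ≤ 1 / 2 * τ * T := by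
  calc ∫ s in (0 : ℝ)..t, 1 / 2 * τ * Real.exp (-τ * s)
      ≤ ∫ _s in (0 : ℝ)..t, 1 / 2 * τ := by
        refine intervalIntegral.integral_mono_on ht
          (Continuous.intervalIntegrable (by fun_prop) _ _) (by simp) fun s hs => ?_
        refine mul_le_of_le_one_right (by positivity) (Real.exp_le_one_iff.2 ?_)
        nlinarith [hs.1]
    _ = 1 / 2 * τ * t := by simp; ring
    _ ≤ _ := by gcongr

/-- Exponential moments of the energy. -/
lemma integral_exp_energy_le (hlam : ∀ k, 0 ≤ lam k)
    (hL : ∀ k, MemLp (e k) 6 (cubeMeasure d)) {Q S : L2 d →L[ℝ] L2 d} (hS : S.IsPositive)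
    (hSQ : S ∘L S = Q) (hHS : Summable fun k => ‖S (e k)‖ ^ 2)
    {C₁ : ℝ} (hC₁ : ∀ z, 0 ≤ primitive (cubic c₀ c₁ c₂ c₃) z + C₁) {α : ℝ} (hα : opTrace e Q ≤ α)
    {h₀ : ℝ} (hadm : StepSizeAdmissible e lam (cubic c₀ c₁ c₂ c₃) h₀)
    {Ω : Type*} [MeasurableSpace Ω] {P : Measure Ω} [IsProbabilityMeasure P]
    {W : ℝ≥0 → Ω → L2 d} (hW : IsWienerProcess S P W) {M : ℕ} (hN : 1 ≤ N) {h : ℝ} (hh : 0 < h)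
    (hle : h ≤ h₀) {u v vbar : ℕ → Ω → L2 d}
    (hdisc : IsFullDiscretization e lam (cubic c₀ c₁ c₂ c₃) u₀ v₀ P W N M h u v vbar)
    {m : ℕ} (hm : m ≤ M) :
    Integrable (fun ω => Real.exp (energy e lam (cubic c₀ c₁ c₂ c₃) C₁ (u m ω) (v m ω)
        * Real.exp (-α * (m * h)))) P ∧
      ∫ ω, Real.exp (energy e lam (cubic c₀ c₁ c₂ c₃) C₁ (u m ω) (v m ω)
          * Real.exp (-α * (m * h))) ∂P
        ≤ Real.exp (energy e lam (cubic c₀ c₁ c₂ c₃) C₁ (galerkinProj e N u₀) (galerkinProj e N v₀)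
            + ∫ s in (0 : ℝ)..(m * h), 1 / 2 * opTrace e Q * Real.exp (-α * s)) := by
  obtain ⟨X, hX, hae, hmom⟩ :=
    exists_coords_exp_moment hlam hL hS hSQ hHS hC₁ hα hadm hW hN hh hle hdisc
  rw [galerkinProj_coe, galerkinProj_coe, energy_embed]
  have hcont := continuous_potential (lam := lam) (N := N) (c₀ := c₀) (c₁ := c₁) (c₂ := c₂)
    (c₃ := c₃) hL C₁
  refine integrable_and_integral_le ?_ ?_ (fun ω => (Real.exp_pos _).le) (Real.exp_pos _).le
    (hmom m)
  · filter_upwards [hae m hm] with ω hω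
    rw [hω.1, hω.2, energy_embed]
  · exact (Continuous.measurable (by fun_prop) : Measurable fun p :
      EuclideanSpace ℝ (Fin N) × EuclideanSpace ℝ (Fin N) =>
        Real.exp ((potential e lam N c₀ c₁ c₂ c₃ C₁ p.1 + 1 / 2 * ‖p.2‖ ^ 2) *
          Real.exp (-α * (m * h)))).comp_aemeasurable (hX m)

/-- Exponential moments of the time-averaged squared `L⁶` norm, in coordinates. -/
lemma lintegral_exp_normL6_le (hlam : ∀ k, 0 ≤ lam k)
    (hL : ∀ k, MemLp (e k) 6 (cubeMeasure d)) {C₁ : ℝ}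
    (hC₁ : ∀ z, 0 ≤ primitive (cubic c₀ c₁ c₂ c₃) z + C₁) {τ T c D B h : ℝ} (hτ : 0 ≤ τ)
    (hc : 0 < c) (hh : 0 < h) {M : ℕ} (hM : 1 ≤ M) (hT : M * h = T)
    (hD : ∀ x : EuclideanSpace ℝ (Fin N), normL6 (embed e N x) ^ 2 ≤
      Real.exp (-τ * T) / (2 * T * c) * potential e lam N c₀ c₁ c₂ c₃ C₁ x + D)
    {Ω : Type*} [MeasurableSpace Ω] {P : Measure Ω}
    {X : ℕ → Ω → EuclideanSpace ℝ (Fin N) × EuclideanSpace ℝ (Fin N)}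
    (hX : ∀ m, AEMeasurable (X m) P)
    (hmom : ∀ i ≤ M, ∫⁻ ω, ENNReal.ofReal (Real.exp ((potential e lam N c₀ c₁ c₂ c₃ C₁ (X i ω).1 +
      1 / 2 * ‖(X i ω).2‖ ^ 2) * Real.exp (-τ * (i * h)))) ∂P ≤ ENNReal.ofReal (Real.exp B))
    {m : ℕ} (hm : m ≤ M) :
    ∫⁻ ω, ENNReal.ofReal (Real.exp
        (∑ i ∈ Finset.range (m + 1), c * h * normL6 (embed e N (X i ω).1) ^ 2)) ∂P ≤
      ENNReal.ofReal (Real.exp (2 * T * c * D + B)) := by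
  have hmT : (m : ℝ) * h ≤ T := by
    rw [← hT]
    gcongr
  have hhT : h ≤ T := by
    rw [← hT]
    exact le_mul_of_one_le_left hh.le (by exact_mod_cast hM)
  have hT0 : 0 < T := hh.trans_le hhT
  refine lintegral_exp_sum_le m (fun i => ?_) (Real.exp_pos _).le fun i hi => ?_
  · exact (((measurable_normL6_embed.comp measurable_fst).comp_aemeasurable (hX i)).pow_const
      2).const_mul _
  have hiT : (i : ℝ) * h ≤ T := le_trans (by gcongr) hmT
  rw [Real.exp_add, ENNReal.ofReal_mul (Real.exp_pos _).le]
  refine le_trans ?_ (mul_le_mul_right (hmom i (hi.trans hm)) _)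
  rw [← lintegral_const_mul' _ _ ENNReal.ofReal_ne_top]
  refine lintegral_mono fun ω => ?_
  rw [← ENNReal.ofReal_mul (Real.exp_pos _).le, ← Real.exp_add]
  refine ENNReal.ofReal_le_ofReal (Real.exp_le_exp.2 ?_)
  set n := normL6 (embed e N (X i ω).1)
  set V := potential e lam N c₀ c₁ c₂ c₃ C₁ (X i ω).1
  have hV : 0 ≤ V := potential_nonneg hlam hL hC₁ _
  -- The sum has `m + 1` terms, so the total time is `m h + h`, bounded by `2 T` rather than by `T`.
  calc (m + 1 : ℝ) * (c * h * n ^ 2) = (m * h + h) * (c * n ^ 2) := by ring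
    _ ≤ (T + T) * (c * n ^ 2) := by gcongr
    _ = 2 * T * c * n ^ 2 := by ring
    _ ≤ 2 * T * c * (Real.exp (-τ * T) / (2 * T * c) * V + D) := by
        gcongr
        exact hD _
    _ = 2 * T * c * D + V * Real.exp (-τ * T) := by field_simp; ring
    _ ≤ _ := by
        have hexp : Real.exp (-τ * T) ≤ Real.exp (-τ * (i * h)) := by
          refine Real.exp_le_exp.2 ?_
          nlinarith
        have : 0 ≤ 1 / 2 * ‖(X i ω).2‖ ^ 2 := by positivity
        gcongr
        linarith

end Moments

end StochWave

open StochWave in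
theorem mainTheorem4 (d : ℕ) (hd : d = 1 ∨ d = 2)
    (e : HilbertBasis ℕ ℝ (L2 d)) (lam : ℕ → ℝ) (he : IsDirichletEigenbasis e lam)
    (c₀ c₁ c₂ c₃ : ℝ) (hc₃ : 0 < c₃) :
    (∃ h₀ : ℝ, 0 < h₀ ∧ StepSizeAdmissible e lam (cubic c₀ c₁ c₂ c₃) h₀) ∧
    ∀ (u₀ v₀ : L2 d), MemHdotOne e lam u₀ →
    ∀ (Q S : L2 d →L[ℝ] L2 d), Q.IsPositive → S.IsPositive → S ∘L S = Q →
      (Summable fun k => ‖S (e k)‖ ^ 2) →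
    ∀ T : ℝ, 0 < T →
      -- the exponential moments of the `L⁶` norms
      (∀ c : ℝ, 0 < c → ∃ C : ℝ, 0 < C ∧
        ∀ h₀ : ℝ, StepSizeAdmissible e lam (cubic c₀ c₁ c₂ c₃) h₀ →
        ∀ (Ω : Type*) [MeasurableSpace Ω] (P : Measure Ω) [IsProbabilityMeasure P]
          (W : ℝ≥0 → Ω → L2 d), IsWienerProcess S P W →
        ∀ (N M : ℕ), 1 ≤ N → 1 ≤ M → ∀ h : ℝ, M * h = T → h ≤ h₀ →
        ∀ u v vbar : ℕ → Ω → L2 d,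
          IsFullDiscretization e lam (cubic c₀ c₁ c₂ c₃) u₀ v₀ P W N M h u v vbar →
        ∀ m ≤ M,
          (∀ᵐ ω ∂P, ∀ i ≤ m, MemLp (u i ω) 6 (cubeMeasure d)) ∧
          Integrable
            (fun ω => Real.exp (c * h * ∑ i ∈ Finset.range (m + 1), normL6 (u i ω) ^ 2)) P ∧
          ∫ ω, Real.exp (c * h * ∑ i ∈ Finset.range (m + 1), normL6 (u i ω) ^ 2) ∂P ≤ C) ∧
      -- the exponential moments of the energy
      (∀ C₁ : ℝ, (∀ z : ℝ, 0 ≤ primitive (cubic c₀ c₁ c₂ c₃) z + C₁) →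
        ∀ α : ℝ, opTrace e Q ≤ α →
        ∀ h₀ : ℝ, StepSizeAdmissible e lam (cubic c₀ c₁ c₂ c₃) h₀ →
        ∀ (Ω : Type*) [MeasurableSpace Ω] (P : Measure Ω) [IsProbabilityMeasure P]
          (W : ℝ≥0 → Ω → L2 d), IsWienerProcess S P W →
        ∀ (N M : ℕ), 1 ≤ N → 1 ≤ M → ∀ h : ℝ, M * h = T → h ≤ h₀ →
        ∀ u v vbar : ℕ → Ω → L2 d,
          IsFullDiscretization e lam (cubic c₀ c₁ c₂ c₃) u₀ v₀ P W N M h u v vbar →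
        ∀ m ≤ M,
          Integrable
            (fun ω => Real.exp (energy e lam (cubic c₀ c₁ c₂ c₃) C₁ (u m ω) (v m ω)
              * Real.exp (-α * (m * h)))) P ∧
          ∫ ω, Real.exp (energy e lam (cubic c₀ c₁ c₂ c₃) C₁ (u m ω) (v m ω)
              * Real.exp (-α * (m * h))) ∂P
            ≤ Real.exp (energy e lam (cubic c₀ c₁ c₂ c₃) C₁
                  (galerkinProj e N u₀) (galerkinProj e N v₀)
                + ∫ s in (0 : ℝ)..(m * h), 1 / 2 * opTrace e Q * Real.exp (-α * s))) := by
  have hL := he.memLp_six hd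
  refine ⟨exists_stepSizeAdmissible he.lam_nonneg hL hc₃, ?_⟩
  intro u₀ v₀ hu₀ Q S _ hS hSQ hHS T hT
  have hpos : ∀ {M : ℕ} {h : ℝ}, M * h = T → 0 < h := fun {M h} hMh =>
    pos_of_mul_pos_right (hMh ▸ hT) M.cast_nonneg
  refine ⟨fun c hc => ?_, ?_⟩
  -- The `L⁶` bound does not mention `C₁`; any shift making `Φ + C₁` nonnegative serves.
  · obtain ⟨C₁, hC₁⟩ := exists_mul_sq_le_primitive (c₀ := c₀) (c₁ := c₁) (c₂ := c₂) hc₃ 0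
    simp only [zero_mul] at hC₁
    set τ := opTrace e Q with hτ
    have hτ0 : 0 ≤ τ := by
      rw [hτ, opTrace_eq_tsum hS hSQ]
      exact tsum_nonneg fun _ => sq_nonneg _
    -- This `ε` satisfies `2 T c ε = exp (-τ T)`, the smallest discount on `[0, T]`, so the energy
    -- moment with `α = τ` applies at every grid time.
    obtain ⟨D, hD⟩ := he.exists_normL6_sq_le (c₀ := c₀) (c₁ := c₁) (c₂ := c₂) hd hL hc₃ C₁
      (show 0 < Real.exp (-τ * T) / (2 * T * c) by positivity)
    obtain ⟨B, hB⟩ := he.exists_initial_energy_le (c₀ := c₀) (c₁ := c₁) (c₂ := c₂) (c₃ := c₃)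
      (v₀ := v₀) hd hL C₁ hu₀
    refine ⟨Real.exp (2 * T * c * D + (B + 1 / 2 * τ * T)), Real.exp_pos _, ?_⟩
    intro h₀ hadm Ω _ P _ W hW N M hN hM h hMh hle u v vbar hdisc m hm
    have hh := hpos hMh
    obtain ⟨X, hX, hae, hmom⟩ :=
      exists_coords_exp_moment he.lam_nonneg hL hS hSQ hHS hC₁ hτ.ge hadm hW hN hh hle hdisc
    have hall : ∀ᵐ ω ∂P, ∀ i ≤ m, u i ω = embed e N (X i ω).1 := by
      refine ae_all_iff.2 fun i => ?_
      by_cases hi : i ≤ m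
      · filter_upwards [hae i (hi.trans hm)] with ω hω _ using hω.1
      · exact Eventually.of_forall fun ω hi' => absurd hi' hi
    refine ⟨?_, integrable_and_integral_le (G := fun ω => Real.exp
      (∑ i ∈ Finset.range (m + 1), c * h * normL6 (embed e N (X i ω).1) ^ 2)) ?_ ?_
      (fun ω => (Real.exp_pos _).le) (Real.exp_pos _).le ?_⟩
    · filter_upwards [hall] with ω hω i hi
      rw [hω i hi]
      exact he.memLp_six_embed hd _
    · filter_upwards [hall] with ω hω
      rw [Finset.mul_sum]
      congr 1
      refine Finset.sum_congr rfl fun i hi => ?_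
      rw [hω i (Nat.lt_succ_iff.1 (Finset.mem_range.1 hi))]
    · exact Real.measurable_exp.comp_aemeasurable (Finset.aemeasurable_fun_sum _ fun i _ =>
        (((measurable_normL6_embed.comp measurable_fst).comp_aemeasurable (hX i)).pow_const
          2).const_mul _)
    · refine lintegral_exp_normL6_le he.lam_nonneg hL hC₁ hτ0 hc hh hM hMh (hD N) hX
        (fun i hi => (hmom i).trans ?_) hm
      have hiT : (i : ℝ) * h ≤ T := by
        rw [← hMh]
        gcongr
      gcongr
      · exact hB N
      · exact integral_mul_exp_neg_le hτ0 (by positivity) hiT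
  · intro C₁ hC₁ α hα h₀ hadm Ω _ P _ W hW N M hN _ h hMh hle u v vbar hdisc m hm
    exact integral_exp_energy_le he.lam_nonneg hL hS hSQ hHS hC₁ hα hadm hW hN (hpos hMh) hle
      hdisc hm
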